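/- Let $d\in\{2,3\}$, $L>0$, and let $\mathbb{T}^d=(\mathbb{R}/L\mathbb{Z})^d$ be the torus, identified with the cube $[0,L]^d$, so $|\mathbb{T}^d|=L^d$. Let $\mathcal{V}$ be the set of smooth $L$-periodic vector fields $\mathbb{R}^d\to\mathbb{R}^d$ with zero divergence (no zero-mean condition), let $\mathbb{H}$ and $\mathbb{V}$ be the closures of $\mathcal{V}$ in $L^2(\mathbb{T}^d;\mathbb{R}^d)$ and in $H^1(\mathbb{T}^d;\mathbb{R}^d)$, and let $H^2_p(\mathbb{T}^d;\mathbb{R}^d)$ be the completion of the smooth $L$-periodic fields in the $H^2$-norm. Let $\mathcal{P}$ be the orthogonal projection of $L^2(\mathbb{T}^d;\mathbb{R}^d)$ onto $\mathbb{H}$, $\|\cdot\|_{\mathbb H}$ the $L^2$-norm, and $\mathrm{D}(A)=\mathbb{V}\cap H^2_p(\mathbb{T}^d;\mathbb{R}^d)$. For $y\in \mathrm{D}(A)$ put $Ay=-\mathcal{P}\Delta y$, $B(y)=\mathcal{P}[(y\cdot\nabla)y]$, $C_1(y)=\mathcal{P}(|y|^{r-1}y)$, $C_2(y)=\mathcal{P}(|y|^{q-1}y)$.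 (i) Existence. Let $\mu,\alpha,\beta>0$, $\gamma\in\mathbb{R}$ and $1\le q<r<\infty$. For every $f_e\in\mathbb{H}$ there exists at least one strong solution of the stationary equation $$\mu Ay_e+B(y_e)+\alpha y_e+\beta C_1(y_e)+\gamma C_2(y_e)=f_e,$$ that is, some $y_e\in\mathrm{D}(A)$ for which $(y_e\cdot\nabla)y_e$, $|y_e|^{r-1}y_e$ and $|y_e|^{q-1}y_e$ are in $L^2$ and the equation holds in $\mathbb{H}$. (ii) Uniqueness. There is a constant $C>0$ depending only on $d$ and $L$ such that for all $\mu,\alpha,\beta>0$, $\gamma\in\mathbb{R}$, $1\le q<r<\infty$ and $f_e\in\mathbb{H}$ with $$\min\{\mu,\alpha\}\ \ge\ 2^{q-1}q|\gamma|\,\mathfrak{K}_2+C\left(\frac{1}{2\alpha\mu}\|f_e\|_{\mathbb{H}}^2+\frac{\mathfrak{K}_1}{\mu}|\mathbb{T}^d|\right)^{1/2},$$ where $$\mathfrak{K}_1=|\gamma|^{\frac{r+1}{r-q}}\left(\frac{2(q+1)}{\beta(r+1)}\right)^{\frac{q+1}{r-q}}\frac{r-q}{r+1},\qquad \mathfrak{K}_2=\left(\frac{2^{q-1}q|\gamma|(q-1)}{\beta(r-1)}\right)^{\frac{q-1}{r-q}}\frac{r-q}{r-1}$$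 (with $\mathfrak{K}_2=1$ for $q=1$), the strong solution is unique. -/

import Mathlib

open MeasureTheory
open scoped ContDiff

noncomputable section

namespace CBFeD

/-- `ℝ^d` with the Euclidean norm. -/
abbrev Vec (d : ℕ) : Type := EuclideanSpace ℝ (Fin d)

/-- The cube `[0, L]^d`, with which the torus `(ℝ/Lℤ)^d` is identified. -/
def cube (d : ℕ) (L : ℝ) : Set (Vec d) := {x | ∀ i, x i ∈ Set.Icc 0 L}

/-- Lebesgue measure on the cube, that is, on the torus of period `L`. -/
def torusMeasure (d : ℕ) (L : ℝ) : Measure (Vec d) := volume.restrict (cube d L)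

/-- The space `L²(𝕋^d; ℝ^d)`. -/
abbrev L2 (d : ℕ) (L : ℝ) : Type := Lp (Vec d) 2 (torusMeasure d L)

/-- The partial derivative `∂φ/∂x_i` of a vector field. -/
def partialDeriv {d : ℕ} (i : Fin d) (φ : Vec d → Vec d) : Vec d → Vec d :=
  fun x => fderiv ℝ φ x (EuclideanSpace.single i 1)

/-- `C_p^∞(𝕋^d; ℝ^d)`: the smooth vector fields on `ℝ^d` that are `L`-periodic in every
coordinate. -/
def SmoothPeriodic (d : ℕ) (L : ℝ) : Set (Vec d → Vec d) :=
  {φ | ContDiff ℝ ∞ φ ∧ ∀ (x : Vec d) (i : Fin d), φ (x + EuclideanSpace.single i L) = φ x}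

/-- The divergence `∇ · φ` of a vector field. -/
def divergence {d : ℕ} (φ : Vec d → Vec d) : Vec d → ℝ :=
  fun x => ∑ i, partialDeriv i φ x i

/-- The space `𝒱` of divergence-free fields in `C_p^∞(𝕋^d; ℝ^d)`. -/
def DivFree (d : ℕ) (L : ℝ) : Set (Vec d → Vec d) :=
  {φ | φ ∈ SmoothPeriodic d L ∧ ∀ x, divergence φ x = 0}

/-- The Hilbert space `ℍ`: the closure in `L²(𝕋^d; ℝ^d)` of the (linear) set of all classes of
fields from `𝒱`. -/
def SpaceH (d : ℕ) (L : ℝ) : Submodule ℝ (L2 d L) :=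
  (Submodule.span ℝ
    {u : L2 d L | ∃ φ ∈ DivFree d L, u =ᵐ[torusMeasure d L] φ}).topologicalClosure

instance instCompleteSpaceSpaceH (d : ℕ) (L : ℝ) : CompleteSpace (SpaceH d L) :=
  (Submodule.isClosed_topologicalClosure _).completeSpace_coe

/-- The Leray projection `𝒫`: the orthogonal projection of `L²(𝕋^d; ℝ^d)` onto `ℍ`. -/
def leray (d : ℕ) (L : ℝ) : L2 d L →L[ℝ] L2 d L := (SpaceH d L).starProjection

/-- The space `𝕍`: the closure of `𝒱` in the Sobolev space `H¹`. The closure is taken for the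
convergence in `L²` of the fields together with all their first derivatives. -/
def SpaceV (d : ℕ) (L : ℝ) : Set (L2 d L) :=
  {y | ∃ G : Fin d → L2 d L, (y, G) ∈ closure {p : L2 d L × (Fin d → L2 d L) |
    ∃ φ ∈ DivFree d L, p.1 =ᵐ[torusMeasure d L] φ ∧
      ∀ i, p.2 i =ᵐ[torusMeasure d L] partialDeriv i φ}}

/-- `HasH2Derivs y G D` says that `y` belongs to `ℍ²_p(𝕋^d)`, the completion of `C_p^∞` for the
`H²`-norm, with first derivatives `G i = ∂_i y` and second derivatives `D i j = ∂_j ∂_i y`: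
there are smooth periodic fields that converge to `y` in `L²` while all their derivatives of first
and second order converge in `L²` to the fields `G i` and `D i j`. -/
def HasH2Derivs {d : ℕ} {L : ℝ} (y : L2 d L) (G : Fin d → L2 d L)
    (D : Fin d → Fin d → L2 d L) : Prop :=
  (y, G, D) ∈ closure {p : L2 d L × (Fin d → L2 d L) × (Fin d → Fin d → L2 d L) |
    ∃ φ ∈ SmoothPeriodic d L, p.1 =ᵐ[torusMeasure d L] φ ∧
      (∀ i, p.2.1 i =ᵐ[torusMeasure d L] partialDeriv i φ) ∧
      ∀ i j, p.2.2 i j =ᵐ[torusMeasure d L] partialDeriv j (partialDeriv i φ)}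

/-- The convective term `(y · ∇) y`, where `G i = ∂_i y`. -/
def convection {d : ℕ} {L : ℝ} (y : L2 d L) (G : Fin d → L2 d L) : Vec d → Vec d :=
  fun x => ∑ i, (y x i) • (G i x)

/-- The field `|y|^{s-1} y`. -/
def powerField {d : ℕ} {L : ℝ} (s : ℝ) (y : L2 d L) : Vec d → Vec d :=
  fun x => ‖y x‖ ^ (s - 1) • y x

/-- `y` is a strong solution of `μ A y + B(y) + α y + β C₁(y) + γ C₂(y) = f`: it belongs to
`D(A) = 𝕍 ∩ ℍ²_p(𝕋^d)`, and the equation holds as an equality of elements of `L²`, with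
`A y = -𝒫 Δ y`, `B(y) = 𝒫[(y · ∇) y]`, `C₁(y) = 𝒫(|y|^{r-1} y)`, `C₂(y) = 𝒫(|y|^{q-1} y)`.
Here `b`, `c₁`, `c₂` are the classes in `L²` of `(y · ∇) y`, `|y|^{r-1} y`, `|y|^{q-1} y`. -/
def IsStrongSolution {d : ℕ} {L : ℝ} (μ α β γ r q : ℝ) (f y : L2 d L) : Prop :=
  y ∈ SpaceV d L ∧
  ∃ (G : Fin d → L2 d L) (D : Fin d → Fin d → L2 d L), HasH2Derivs y G D ∧
  ∃ b c₁ c₂ : L2 d L,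
    b =ᵐ[torusMeasure d L] convection y G ∧
    c₁ =ᵐ[torusMeasure d L] powerField r y ∧
    c₂ =ᵐ[torusMeasure d L] powerField q y ∧
    μ • (-leray d L (∑ i, D i i)) + leray d L b + α • y + β • leray d L c₁ + γ • leray d L c₂ = f

/-- The constant `𝔎₁`. -/
def K1 (β γ r q : ℝ) : ℝ :=
  |γ| ^ ((r + 1) / (r - q)) * (2 * (q + 1) / (β * (r + 1))) ^ ((q + 1) / (r - q)) *
    ((r - q) / (r + 1))

/-- The constant `𝔎₂` (for `q = 1` the power with exponent `0` is `1`, so that `𝔎₂ = 1`). -/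
def K2 (β γ r q : ℝ) : ℝ :=
  ((2 : ℝ) ^ (q - 1) * q * |γ| * (q - 1) / (β * (r - 1))) ^ ((q - 1) / (r - q)) *
    ((r - q) / (r - 1))

end CBFeD

end

/-! Existence is a Galerkin argument carried out in H². Tested with y itself, the equation gives an
energy bound: convection drops out because y is divergence free, and Young's inequality gives
β|y|^{r+1} + γ|y|^{q+1} ≥ -𝔎₁ pointwise. Tested with -Δy, which is again a Galerkin field, it gives
an H² bound. There the damping map Q(u) = β|u|^{r-1}u + γ|u|^{q-1}u has a derivative bounded below
by -κ, where κ = 2^{q-1}q|γ|𝔎₂, so ⟨Q(y), Δy⟩ ≤ κ‖∇y‖² after one integration by parts. Convection is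
at most ‖y‖_∞ Σ‖∂_i y‖ ‖Δy‖, and for d ≤ 3 the compactness of H² ⊂ C⁰ yields ‖y‖_∞ ≤ ε‖y‖_{H²} +
C_ε‖y‖, so the term is absorbed by μ‖Δy‖². Because H² fields are bounded, the growth exponent r is
unrestricted.

The finite-dimensional equations are solved by `exists_zero_of_inner_pos`, a form of Brouwer's
theorem. A subsequence of the bounded solutions converges coefficient by coefficient. The fields
then converge uniformly and the gradients in L², by tightness (`isTight_field`, `isTight_gradL2`),
while Δ converges weakly; this suffices to pass to the limit in `exists_residual_eq_zero`.

For uniqueness let w = y₁ - y₂. Testing the difference of the equations with w gives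
min{μ,α}‖w‖²_{H¹} ≤ κ‖w‖² + |⟨(w·∇)y₂, w⟩|. The last term is at most C‖w‖²_{H¹}‖∇y₂‖ by the
embedding H¹ ⊂ L⁴ (`norm_coordMul_field_le`), and the energy bound for y₂ controls ‖∇y₂‖
(`mul_h1sq_sub_le`, `energy_bound`).

All spaces are made explicit through the Hartley functions cos + sin of the phase 2πk·x/L. They form
a real orthonormal system, and differentiation maps the function of index k to a real multiple of
that of index -k. A field y in H² is encoded by the ℓ² family of Hartley coefficients of y - Δy
(`HasH2Derivs.exists_coef`); y and its derivatives up to order two are then bounded Fourier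
multipliers, and divergence freeness is orthogonality to the frequency vector. -/

set_option linter.unusedSectionVars false

noncomputable section

namespace CBFeD

/-! ### Brouwer's theorem: zeros of coercive vector fields. -/

section Brouwer

variable {E : Type*} [NormedAddCommGroup E] [InnerProductSpace ℝ E] [FiniteDimensional ℝ E]

/-- The determinant of `1 + A` is recovered by Lagrange interpolation from the determinants
of `1 + v i • A` at `dim E + 1` nodes. -/
lemma det_one_add_eq_sum (A : E →ₗ[ℝ] E) {v : ℕ → ℝ} (hv : Function.Injective v) :
    LinearMap.det (1 + A) = ∑ i ∈ Finset.range (Module.finrank ℝ E + 1),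
      LinearMap.det (1 + v i • A) *
        (Lagrange.basis (Finset.range (Module.finrank ℝ E + 1)) v i).eval 1 := by
  classical
  let b := Module.finBasis ℝ E
  let M := LinearMap.toMatrix b b A
  -- As a function of t, det(1 + tA) is a polynomial of degree at most dim E, so dim E + 1 nodes
  -- determine it.
  let p : Polynomial ℝ :=
    Matrix.det ((Polynomial.X : Polynomial ℝ) • M.map (Polynomial.C : ℝ →+* Polynomial ℝ) +
      (1 : Matrix (Fin (Module.finrank ℝ E)) (Fin (Module.finrank ℝ E)) ℝ).map
        (Polynomial.C : ℝ →+* Polynomial ℝ))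
  have hp : ∀ t : ℝ, p.eval t = LinearMap.det (1 + t • A) := by
    intro t
    rw [← LinearMap.det_toMatrix b, ← Polynomial.coe_evalRingHom, RingHom.map_det]
    congr 1
    ext i j
    simp only [RingHom.mapMatrix_apply, Matrix.map_apply, Matrix.add_apply, Matrix.smul_apply,
      map_add, LinearMap.toMatrix_one, map_smul]
    simp [M, add_comm]
    ring
  have hdeg : p.degree < ((Finset.range (Module.finrank ℝ E + 1)).card : ℕ) := by
    refine lt_of_le_of_lt Polynomial.degree_le_natDegree ?_
    have := Polynomial.natDegree_det_X_add_C_le M 1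
    rw [Fintype.card_fin] at this
    rw [Finset.card_range]
    exact_mod_cast Nat.lt_succ_of_le this
  have h := Lagrange.eq_interpolate (f := p) (hv.injOn (s := _)) hdeg
  have h1 := hp 1
  rw [one_smul] at h1
  rw [← h1, h, Lagrange.interpolate_apply, Polynomial.eval_finsetSum]
  refine Finset.sum_congr rfl fun i _ => ?_
  rw [Polynomial.eval_mul, Polynomial.eval_C, hp]

/-- Each 1 + sA with s in [0, 1] is injective because ‖sA‖ < 1. The determinant therefore never
vanishes along the path from the identity and keeps its sign. -/
lemma det_one_add_pos {A : E →L[ℝ] E} (hA : ‖A‖ < 1) : 0 < (1 + A).det := by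
  have hne : ∀ s ∈ Set.Icc (0 : ℝ) 1, (1 + s • A).det ≠ 0 := by
    intro s hs h0
    obtain ⟨v, hv, hv0⟩ := Submodule.exists_mem_ne_zero_of_ne_bot
      (LinearMap.bot_lt_ker_of_det_eq_zero (f := ((1 + s • A : E →L[ℝ] E) : E →ₗ[ℝ] E)) h0).ne'
    have hv' : v + s • A v = 0 := by simpa using hv
    have h1 : ‖v‖ = ‖s • A v‖ := by
      conv_lhs => rw [eq_neg_of_add_eq_zero_left hv', norm_neg]
    rw [norm_smul, Real.norm_of_nonneg hs.1] at h1
    have h2 : s * ‖A v‖ ≤ ‖A‖ * ‖v‖ := by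
      calc s * ‖A v‖ ≤ 1 * ‖A v‖ := by gcongr; exact hs.2
        _ ≤ ‖A‖ * ‖v‖ := by rw [one_mul]; exact A.le_opNorm v
    have h3 : 0 < ‖v‖ := norm_pos_iff.2 hv0
    nlinarith
  have hc : ContinuousOn (fun s : ℝ => (1 + s • A).det) (Set.Icc 0 1) :=
    (ContinuousLinearMap.continuous_det.comp (by fun_prop)).continuousOn
  by_contra hle
  have h1 : (1 + (1 : ℝ) • A).det ≤ 0 := by simpa using hle
  have h0 : (0 : ℝ) ≤ (1 + (0 : ℝ) • A).det := by
    simp [ContinuousLinearMap.det]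
  obtain ⟨s, hs, hs0⟩ := intermediate_value_Icc' zero_le_one hc ⟨h1, h0⟩
  exact hne s hs hs0

/-- Constants approximate Φ locally, and a smooth partition of unity glues them; convexity of balls
preserves the error. -/
lemma exists_contDiff_norm_sub_lt {Φ : E → E} (hΦ : Continuous Φ) {δ : ℝ} (hδ : 0 < δ) :
    ∃ Ψ : E → E, ContDiff ℝ 1 Ψ ∧ ∀ x, ‖Ψ x - Φ x‖ < δ := by
  obtain ⟨g, hg⟩ := exists_contMDiffMap_forall_mem_convex_of_local_const (n := ⊤)
    (modelWithCornersSelf ℝ E) (t := fun x => Metric.ball (Φ x) δ)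
    (fun x => convex_ball _ _) (fun x => ⟨Φ x, by
      filter_upwards [hΦ.continuousAt.eventually (Metric.ball_mem_nhds (Φ x) hδ)] with y hy
      rw [Metric.mem_ball, dist_comm]
      exact hy⟩)
  exact ⟨g, g.contMDiff.contDiff.of_le (by norm_cast), fun x => by
    rw [← dist_eq_norm]; exact hg x⟩

section Volume

variable [MeasurableSpace E] [BorelSpace E]

/-- A small Lipschitz perturbation of the identity that is supported in a ball preserves the
volume of the ball. -/
lemma setIntegral_det_one_add_eq (μ : Measure E) [μ.IsAddHaarMeasure] {ρ K t : ℝ}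
    {g : E → E} (hg : ContDiff ℝ 1 g) (hg0 : ∀ x, ‖x‖ = ρ → g x = 0) (hρ : 0 < ρ)
    (hK : ∀ x ∈ Metric.closedBall (0 : E) ρ, ‖fderiv ℝ g x‖ ≤ K) (ht : 0 ≤ t) (htK : t * K < 1) :
    ∫ x in Metric.ball (0 : E) ρ, (1 + t • fderiv ℝ g x).det ∂μ =
      μ.real (Metric.ball (0 : E) ρ) := by
  classical
  have hK0 : 0 ≤ K := (norm_nonneg _).trans (hK 0 (by simp [hρ.le]))
  -- The extension of g by zero stays K-Lipschitz on all of E. Hence x ↦ x + t gh(x) is a bijection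
  -- of E that fixes the complement of the ball, and so maps the ball onto itself.
  set gh : E → E := fun x => if ‖x‖ ≤ ρ then g x else 0 with hgh
  have hin : ∀ x, ‖x‖ ≤ ρ → gh x = g x := fun x hx => if_pos hx
  have hout : ∀ x, ρ ≤ ‖x‖ → gh x = 0 := by
    intro x hx
    by_cases h : ‖x‖ ≤ ρ
    · rw [hin x h, hg0 x (le_antisymm h hx)]
    · exact if_neg h
  have hlipB : ∀ x y, ‖x‖ ≤ ρ → ‖y‖ ≤ ρ → ‖g x - g y‖ ≤ K * ‖x - y‖ := by
    intro x y hx hy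
    exact (convex_closedBall (0 : E) ρ).norm_image_sub_le_of_norm_fderiv_le
      (fun z _ => (hg.differentiable one_ne_zero).differentiableAt) hK
      (by simpa using hy) (by simpa using hx)
  have hcross : ∀ x y, ‖x‖ ≤ ρ → ρ < ‖y‖ → ‖g x‖ ≤ K * ‖x - y‖ := by
    intro x y hx hy
    have hy0 : ‖y‖ ≠ 0 := by linarith
    -- A point of the sphere, where g vanishes, that is no farther from x than y is: the radial
    -- projection of x, or of y when x = 0.
    obtain ⟨z, hz, hxz⟩ : ∃ z : E, ‖z‖ = ρ ∧ ‖x - z‖ ≤ ‖x - y‖ := by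
      by_cases hx0 : x = 0
      · refine ⟨(ρ / ‖y‖) • y, ?_, ?_⟩
        · rw [norm_smul, Real.norm_of_nonneg (by positivity)]; field_simp
        · rw [hx0, zero_sub, zero_sub, norm_neg, norm_neg, norm_smul,
            Real.norm_of_nonneg (by positivity), div_mul_cancel₀ _ hy0]
          exact hy.le
      · have hx0' : ‖x‖ ≠ 0 := norm_ne_zero_iff.2 hx0
        refine ⟨(ρ / ‖x‖) • x, ?_, ?_⟩
        · rw [norm_smul, Real.norm_of_nonneg (by positivity)]; field_simp
        · have : x - (ρ / ‖x‖) • x = (1 - ρ / ‖x‖) • x := by rw [sub_smul, one_smul]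
          rw [this, norm_smul, Real.norm_eq_abs]
          have h1 : |1 - ρ / ‖x‖| * ‖x‖ = |‖x‖ - ρ| := by
            rw [← abs_of_nonneg (norm_nonneg x), ← abs_mul, abs_of_nonneg (norm_nonneg x)]
            congr 1
            field_simp
          rw [h1, abs_of_nonpos (by linarith)]
          have := norm_sub_norm_le y x
          rw [norm_sub_rev] at this
          linarith
    have := hlipB x z hx hz.le
    rw [hg0 z hz, sub_zero] at this
    exact this.trans (by gcongr)
  have hlip : ∀ x y, ‖gh x - gh y‖ ≤ K * ‖x - y‖ := by
    intro x y
    rcases le_or_gt ‖x‖ ρ with hx | hx <;> rcases le_or_gt ‖y‖ ρ with hy | hy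
    · rw [hin x hx, hin y hy]; exact hlipB x y hx hy
    · rw [hin x hx, hout y hy.le, sub_zero]; exact hcross x y hx hy
    · rw [hin y hy, hout x hx.le, zero_sub, norm_neg, norm_sub_rev]; exact hcross y x hy hx
    · rw [hout x hx.le, hout y hy.le, sub_zero, norm_zero]; positivity
  set F : E → E := fun x => x + t • gh x with hF
  have hinj : Function.Injective F := by
    intro x y hxy
    have h1 : x - y = -(t • (gh x - gh y)) := by
      rw [smul_sub, neg_sub, sub_eq_sub_iff_add_eq_add]
      simpa only [hF, add_comm] using hxy
    have h2 : ‖x - y‖ ≤ t * K * ‖x - y‖ := by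
      calc ‖x - y‖ = t * ‖gh x - gh y‖ := by
            conv_lhs => rw [h1, norm_neg, norm_smul, Real.norm_of_nonneg ht]
        _ ≤ t * (K * ‖x - y‖) := by gcongr; exact hlip x y
        _ = _ := by ring
    by_contra hne
    have : 0 < ‖x - y‖ := norm_pos_iff.2 (sub_ne_zero.2 hne)
    nlinarith
  -- The equation x + t gh(x) = y is a fixed point problem for a contraction of ratio tK < 1.
  have hsurj : Function.Surjective F := by
    intro y
    have hcon : ContractingWith ⟨t * K, by positivity⟩ (fun x => y - t • gh x) := by
      refine ⟨by exact_mod_cast htK, LipschitzWith.of_dist_le_mul fun a b => ?_⟩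
      rw [dist_eq_norm, dist_eq_norm, sub_sub_sub_cancel_left, ← smul_sub, norm_smul,
        Real.norm_of_nonneg ht, norm_sub_rev]
      change _ ≤ t * K * _
      rw [mul_assoc]
      gcongr
      exact hlip a b
    exact ⟨ContractingWith.fixedPoint _ hcon,
      (sub_eq_iff_eq_add.1 hcon.fixedPoint_isFixedPt.eq).symm⟩
  have himg : F '' Metric.ball 0 ρ = Metric.ball 0 ρ := by
    have hcompl : ∀ x, ρ ≤ ‖x‖ → F x = x := fun x hx => by simp [hF, hout x hx]
    ext y
    constructor
    · rintro ⟨x, hx, rfl⟩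
      by_contra hy
      have h1 : F (F x) = F x := hcompl _ (by simpa using hy)
      have h2 := hinj h1
      rw [h2] at hy
      exact hy hx
    · intro hy
      obtain ⟨x, rfl⟩ := hsurj y
      refine ⟨x, ?_, rfl⟩
      by_contra hx
      rw [hcompl x (by simpa using hx)] at hy
      exact hx hy
  have hder : ∀ x ∈ Metric.ball (0 : E) ρ,
      HasFDerivWithinAt F (1 + t • fderiv ℝ g x) (Metric.ball 0 ρ) x := by
    intro x hx
    have h1 : HasFDerivAt (fun x => x + t • g x) (1 + t • fderiv ℝ g x) x :=
      (hasFDerivAt_id x).add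
        ((hg.differentiable one_ne_zero).differentiableAt.hasFDerivAt.const_smul t)
    refine h1.hasFDerivWithinAt.congr (fun z hz => ?_) ?_
    · simp only [hF]; rw [hin z (by simpa using (Metric.mem_ball.1 hz).le)]
    · simp only [hF]; rw [hin x (by simpa using (Metric.mem_ball.1 hx).le)]
  have hcv := integral_image_eq_integral_abs_det_fderiv_smul μ Metric.isOpen_ball.measurableSet
    hder hinj.injOn (fun _ => (1 : ℝ))
  rw [himg] at hcv
  simp only [integral_const, smul_eq_mul, mul_one, measureReal_restrict_apply_univ] at hcv
  rw [hcv]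
  refine setIntegral_congr_fun Metric.isOpen_ball.measurableSet fun x hx => ?_
  have hpos : 0 < (1 + t • fderiv ℝ g x).det := by
    refine det_one_add_pos ?_
    rw [norm_smul, Real.norm_of_nonneg ht]
    exact lt_of_le_of_lt (by gcongr; exact hK x (Metric.ball_subset_closedBall hx)) htK
  exact (abs_of_pos hpos).symm

/-- There is no nowhere vanishing `C¹` field that is the identity far away. -/
lemma exists_zero_of_eq_id_of_le_norm {w : E → E} (hw : ContDiff ℝ 1 w) {ρ : ℝ} (hρ : 0 < ρ)
    (hid : ∀ x, ρ ≤ ‖x‖ → w x = x) : ∃ x, w x = 0 := by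
  by_contra! hne
  let μ : Measure E := MeasureTheory.Measure.addHaar
  have hn0 : ∀ x, ‖w x‖ ≠ 0 := fun x => norm_ne_zero_iff.2 (hne x)
  -- Normalizing w gives a C¹ map into the sphere of radius ρ that is the identity on that sphere.
  set r : E → E := fun x => (ρ * ‖w x‖⁻¹) • w x with hr
  have hrC : ContDiff ℝ 1 r :=
    (contDiff_const.mul ((hw.norm ℝ hne).inv hn0)).smul hw
  have hrn : ∀ x, ‖r x‖ = ρ := by
    intro x
    rw [hr]
    simp only
    rw [norm_smul, norm_mul, norm_inv, norm_norm, Real.norm_of_nonneg hρ.le]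
    field_simp [hn0 x]
  set g : E → E := fun x => r x - x with hgdef
  have hg : ContDiff ℝ 1 g := hrC.sub contDiff_id
  have hg0 : ∀ x, ‖x‖ = ρ → g x = 0 := by
    intro x hx
    simp only [hgdef, hr]
    rw [hid x hx.ge, hx, mul_inv_cancel₀ hρ.ne', one_smul, sub_self]
  have hgr : ∀ x, 1 + fderiv ℝ g x = fderiv ℝ r x := by
    intro x
    have h1 : fderiv ℝ g x = fderiv ℝ r x - 1 :=
      ((hrC.differentiable one_ne_zero).differentiableAt.hasFDerivAt.sub (hasFDerivAt_id x)).fderiv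
    rw [h1]; abel
  have hdet : ∀ x, (1 + fderiv ℝ g x).det = 0 := by
    intro x
    rw [hgr]
    -- If r'(x) were invertible, some v would satisfy r'(x)v = r(x). Differentiating |r|² = ρ² in
    -- the direction v would then give 2ρ² = 0.
    by_contra h0
    have hu : IsUnit (LinearMap.det (fderiv ℝ r x : E →ₗ[ℝ] E)) := isUnit_iff_ne_zero.2 h0
    obtain ⟨v, hv⟩ := (LinearMap.equivOfDetNeZero (fderiv ℝ r x : E →ₗ[ℝ] E) h0).surjective (r x)
    have hv' : fderiv ℝ r x v = r x := hv
    have hd : HasFDerivAt r (fderiv ℝ r x) x :=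
      (hrC.differentiable one_ne_zero).differentiableAt.hasFDerivAt
    have h2 := (hd.inner ℝ hd)
    have h3 : (fun y => inner ℝ (r y) (r y)) = fun _ => ρ ^ 2 := by
      ext y; rw [real_inner_self_eq_norm_sq, hrn]
    rw [h3] at h2
    have h4 := h2.unique (hasFDerivAt_const _ _)
    have h5 := congrArg (fun l => l v) h4
    simp [hv', hrn] at h5
    exact hρ.ne' h5
  obtain ⟨K, hK⟩ := (isCompact_closedBall (0 : E) ρ).exists_bound_of_continuousOn
    (hg.continuous_fderiv one_ne_zero).continuousOn
  have hK0 : 0 ≤ K := (norm_nonneg _).trans (hK 0 (by simp [hρ.le]))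
  -- Distinct interpolation nodes, all small enough for the volume formula, which needs v i * K < 1.
  let v : ℕ → ℝ := fun i => ((i : ℝ) + 1 + K)⁻¹
  have hv : Function.Injective v := by
    intro i j hij
    have := inv_injective hij
    exact_mod_cast add_right_cancel (add_right_cancel this)
  have hvn : ∀ i, 0 ≤ v i ∧ v i * K < 1 := by
    intro i
    have hp : (0 : ℝ) < (i : ℝ) + 1 + K := by positivity
    refine ⟨by positivity, ?_⟩
    rw [inv_mul_lt_iff₀ hp]
    have : (0 : ℝ) ≤ i := by positivity
    linarith
  have hint : ∀ t : ℝ, IntegrableOn (fun x => (1 + t • fderiv ℝ g x).det)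
      (Metric.ball (0 : E) ρ) μ := by
    intro t
    have hc : Continuous fun x => (1 + t • fderiv ℝ g x).det :=
      ContinuousLinearMap.continuous_det.comp
        (continuous_const.add ((hg.continuous_fderiv one_ne_zero).const_smul t))
    exact (hc.continuousOn.integrableOn_compact (isCompact_closedBall 0 ρ)).mono_set
      Metric.ball_subset_closedBall
  have key : (0 : ℝ) = μ.real (Metric.ball (0 : E) ρ) := by
    set n := Module.finrank ℝ E
    -- The determinants at t = 1 integrate to 0. By interpolation the same integral is a combination
    -- of the integrals at the nodes, each equal to the volume, with weights that sum to 1.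
    calc (0 : ℝ) = ∫ x in Metric.ball (0 : E) ρ, (1 + fderiv ℝ g x).det ∂μ := by simp [hdet]
      _ = ∫ x in Metric.ball (0 : E) ρ, ∑ i ∈ Finset.range (n + 1),
            (1 + v i • fderiv ℝ g x).det *
              (Lagrange.basis (Finset.range (n + 1)) v i).eval 1 ∂μ := by
          congr 1; ext x; exact det_one_add_eq_sum (fderiv ℝ g x : E →ₗ[ℝ] E) hv
      _ = ∑ i ∈ Finset.range (n + 1), μ.real (Metric.ball (0 : E) ρ) *
              (Lagrange.basis (Finset.range (n + 1)) v i).eval 1 := by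
          rw [integral_finsetSum _ fun i _ => (hint (v i)).mul_const _]
          refine Finset.sum_congr rfl fun i _ => ?_
          rw [integral_mul_const,
            setIntegral_det_one_add_eq μ hg hg0 hρ hK (hvn i).1 (hvn i).2]
      _ = _ := by
          rw [← Finset.mul_sum, ← Polynomial.eval_finsetSum,
            Lagrange.sum_basis hv.injOn ⟨0, by simp⟩]
          simp
  have hpos : 0 < μ.real (Metric.ball (0 : E) ρ) :=
    ENNReal.toReal_pos (Metric.measure_ball_pos μ _ hρ).ne' measure_ball_lt_top.ne
  exact hpos.ne key

end Volume

/-- A continuous coercive vector field on a Euclidean space has a zero. -/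
theorem exists_zero_of_inner_pos {Φ : E → E} (hΦ : Continuous Φ) {R : ℝ} (hR : 0 < R)
    (hpos : ∀ x, R ≤ ‖x‖ → 0 < inner ℝ (Φ x) x) : ∃ x, Φ x = 0 := by
  borelize E
  by_contra! hne
  obtain ⟨m, hm, hmb⟩ : ∃ m > 0, ∀ x ∈ Metric.closedBall (0 : E) (2 * R), m ≤ ‖Φ x‖ := by
    obtain ⟨x, _, hx⟩ := (isCompact_closedBall (0 : E) (2 * R)).exists_isMinOn
      ⟨0, by simp [hR.le]⟩ hΦ.norm.continuousOn
    exact ⟨‖Φ x‖, norm_pos_iff.2 (hne x), fun y hy => hx hy⟩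
  obtain ⟨m', hm', hmb'⟩ : ∃ m' > 0, ∀ x, R ≤ ‖x‖ → ‖x‖ ≤ 2 * R → m' ≤ inner ℝ (Φ x) x := by
    have hcomp : IsCompact (Metric.closedBall (0 : E) (2 * R) ∩ {x | R ≤ ‖x‖}) :=
      (isCompact_closedBall _ _).inter_right (isClosed_le continuous_const continuous_norm)
    rcases (Metric.closedBall (0 : E) (2 * R) ∩ {x | R ≤ ‖x‖}).eq_empty_or_nonempty with he | hn
    · refine ⟨1, one_pos, fun x h1 h2 => ?_⟩
      have : x ∈ Metric.closedBall (0 : E) (2 * R) ∩ {x | R ≤ ‖x‖} := ⟨by simpa using h2, h1⟩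
      rw [he] at this
      exact this.elim
    · obtain ⟨x, hx1, hx⟩ := hcomp.exists_isMinOn hn (hΦ.inner (𝕜 := ℝ) continuous_id).continuousOn
      exact ⟨_, hpos x hx1.2, fun y h1 h2 => hx ⟨by simpa using h2, h1⟩⟩
  -- The bound δ < m keeps the smooth approximant Ψ nonzero on the ball of radius 2R, and δ * (2 *
  -- R) < m' keeps ⟨Ψ(x), x⟩ positive for R ≤ |x| ≤ 2R.
  obtain ⟨δ, hδ, hδm, hδm'⟩ : ∃ δ > 0, δ < m ∧ δ * (2 * R) < m' :=
    ⟨min (m / 2) (m' / (4 * R)), by positivity, (min_le_left _ _).trans_lt (by linarith), by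
      calc min (m / 2) (m' / (4 * R)) * (2 * R) ≤ m' / (4 * R) * (2 * R) := by
            gcongr; exact min_le_right _ _
        _ = m' / 2 := by field_simp; ring
        _ < m' := by linarith⟩
  obtain ⟨Ψ, hΨ, hΨd⟩ := exists_contDiff_norm_sub_lt hΦ hδ
  let χ : ContDiffBump (0 : E) := ⟨R, 2 * R, hR, by linarith⟩
  -- This equals Ψ for |x| ≤ R and the identity for |x| ≥ 2R. Between the two radii both fields have
  -- a positive product with x, so w vanishes nowhere, against the previous lemma.
  set w : E → E := fun x => χ x • Ψ x + (1 - χ x) • x with hwdef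
  have hχ : ContDiff ℝ 1 χ := χ.contDiff
  have hw : ContDiff ℝ 1 w := (hχ.smul hΨ).add ((contDiff_const.sub hχ).smul contDiff_id)
  obtain ⟨x, hx⟩ := exists_zero_of_eq_id_of_le_norm hw (ρ := 2 * R) (by linarith) (by
    intro x hx
    have : χ x = 0 := χ.zero_of_le_dist (by simpa using hx)
    simp [hwdef, this])
  rcases le_or_gt ‖x‖ R with h | h
  · have h1 : χ x = 1 := χ.one_of_mem_closedBall (by simpa using h)
    have h2 : Ψ x = 0 := by simpa [hwdef, h1] using hx
    have h3 := hΨd x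
    rw [h2, zero_sub, norm_neg] at h3
    have := hmb x (by simp; linarith)
    linarith
  · have h0 : inner ℝ (w x) x = 0 := by rw [hx, inner_zero_left]
    simp only [hwdef] at h0
    rw [inner_add_left, real_inner_smul_left, real_inner_smul_left,
      real_inner_self_eq_norm_sq] at h0
    have hx2 : 0 < ‖x‖ ^ 2 := pow_pos (hR.trans h) 2
    rcases le_or_gt (2 * R) ‖x‖ with h' | h'
    · have : χ x = 0 := χ.zero_of_le_dist (by simpa using h')
      rw [this] at h0
      linarith
    · have h1 : 0 < inner ℝ (Ψ x) x := by
        have e : inner ℝ (Ψ x) x = inner ℝ (Φ x) x + inner ℝ (Ψ x - Φ x) x := by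
          rw [← inner_add_left]; congr 1; abel
        have b1 := hmb' x h.le h'.le
        have b2 := (abs_le.1 (abs_real_inner_le_norm (Ψ x - Φ x) x)).1
        have b3 : ‖Ψ x - Φ x‖ * ‖x‖ ≤ δ * (2 * R) := by
          gcongr
          exact (hΨd x).le
        linarith
      have h2 := χ.nonneg' x
      have h3 := χ.le_one (x := x)
      rcases h2.eq_or_lt with h4 | h4
      · rw [← h4] at h0; linarith
      · have := mul_pos h4 h1
        have : 0 ≤ (1 - χ x) * ‖x‖ ^ 2 := by
          have : 0 ≤ 1 - χ x := by linarith
          positivity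
        linarith

end Brouwer

/-! ### Pointwise estimates for the damping term and the constants 𝔎₁, 𝔎₂. -/

section PowerMap

/-- Sharp form of Young's inequality for two powers of one variable. -/
lemma mul_rpow_le_mul_rpow_add {a b m n s : ℝ} (ha : 0 ≤ a) (hb : 0 < b) (hm : 0 < m)
    (hmn : m < n) (hs : 0 ≤ s) :
    a * s ^ m ≤ b * s ^ n + a * (a * m / (b * n)) ^ (m / (n - m)) * ((n - m) / n) := by
  have hn : 0 < n := hm.trans hmn
  have hd : 0 < n - m := by linarith
  rcases ha.eq_or_lt with rfl | ha
  · simp; positivity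
  set z : ℝ := a * m / (b * n) with hz
  have hz0 : 0 < z := by positivity
  -- The point t maximizes a s^m - b s^n. In the variable s/t the claim is the weighted
  -- arithmetic-geometric inequality for (s/t)^n and 1.
  set t : ℝ := z ^ (1 / (n - m)) with ht
  have ht0 : 0 < t := by positivity
  have htm : t ^ m = z ^ (m / (n - m)) := by
    rw [ht, ← Real.rpow_mul hz0.le]; congr 1; ring
  have htn : t ^ n = t ^ m * z := by
    have : t ^ (n - m) = z := by
      rw [ht, ← Real.rpow_mul hz0.le, one_div_mul_cancel hd.ne', Real.rpow_one]
    rw [← this, ← Real.rpow_add ht0]; congr 1; ring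
  have hx : 0 ≤ s / t := by positivity
  have key : (s / t) ^ m ≤ m / n * (s / t) ^ n + (n - m) / n := by
    have := Real.geom_mean_le_arith_mean2_weighted (w₁ := m / n) (w₂ := (n - m) / n)
      (p₁ := (s / t) ^ n) (p₂ := 1) (by positivity) (by positivity) (by positivity) zero_le_one
      (by field_simp; ring)
    rw [Real.one_rpow, mul_one, mul_one, ← Real.rpow_mul hx, mul_div_cancel₀ _ hn.ne'] at this
    exact this
  rw [Real.div_rpow hs ht0.le, Real.div_rpow hs ht0.le, htn] at key
  have htm0 : 0 < t ^ m := by positivity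
  have h2 := mul_le_mul_of_nonneg_left key (by positivity : 0 ≤ a * t ^ m)
  rw [← htm]
  calc a * s ^ m = a * t ^ m * (s ^ m / t ^ m) := by field_simp
    _ ≤ _ := h2
    _ = b * s ^ n + a * t ^ m * ((n - m) / n) := by
      rw [mul_add]
      congr 1
      rw [hz]
      field_simp

lemma K1_nonneg {β γ r q : ℝ} (hβ : 0 < β) (hq : 1 ≤ q) (hqr : q < r) : 0 ≤ K1 β γ r q := by
  have h1 : 0 ≤ r - q := by linarith
  have h2 : 0 ≤ r + 1 := by linarith
  have h3 : 0 ≤ q + 1 := by linarith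
  unfold K1
  positivity

/-- Serves the degenerate case of uniqueness, in which the quantity under the square root is zero.
-/
lemma eq_zero_of_K1_eq_zero {β γ r q : ℝ} (hβ : 0 < β) (hq : 1 ≤ q) (hqr : q < r)
    (h : K1 β γ r q = 0) : γ = 0 := by
  have h1 : 0 < r - q := by linarith
  have h2 : 0 < r + 1 := by linarith
  have h3 : 0 < q + 1 := by linarith
  by_contra hγ
  have : 0 < |γ| := abs_pos.2 hγ
  have : 0 < K1 β γ r q := by unfold K1; positivity
  exact this.ne' h

/-- Young's inequality is applied with β/2 in place of β, which is the origin of the factor 2 in 𝔎₁;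
the other half of the β term is dropped. -/
lemma abs_mul_rpow_le_K1 {β γ r q s : ℝ} (hβ : 0 < β) (hq : 1 ≤ q) (hqr : q < r) (hs : 0 ≤ s) :
    |γ| * s ^ (q + 1) ≤ β * s ^ (r + 1) + K1 β γ r q := by
  have h1 : 0 < r - q := by linarith
  have h2 : 0 < r + 1 := by linarith
  have h3 : 0 < q + 1 := by linarith
  have key := mul_rpow_le_mul_rpow_add (abs_nonneg γ) (half_pos hβ) h3
    (by linarith : q + 1 < r + 1) hs
  have e : r + 1 - (q + 1) = r - q := by ring
  rw [e] at key
  have hK : |γ| * (|γ| * (q + 1) / (β / 2 * (r + 1))) ^ ((q + 1) / (r - q)) *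
      ((r - q) / (r + 1)) = K1 β γ r q := by
    unfold K1
    congr 1
    have e1 : |γ| * (q + 1) / (β / 2 * (r + 1)) = |γ| * (2 * (q + 1) / (β * (r + 1))) := by
      field_simp
    have e2 : (r + 1) / (r - q) = 1 + (q + 1) / (r - q) := by field_simp; ring
    rw [e1, Real.mul_rpow (abs_nonneg _) (by positivity), e2, ← mul_assoc]
    congr 1
    rcases (abs_nonneg γ).eq_or_lt with h | h
    · rw [← h, zero_mul, Real.zero_rpow (by positivity)]
    · rw [Real.rpow_add h, Real.rpow_one]
  rw [hK] at key
  have : 0 ≤ s ^ (r + 1) := by positivity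
  nlinarith

/-- The monotonicity defect `2^{q-1} q |γ| 𝔎₂` of the damping terms. -/
def kappa (β γ r q : ℝ) : ℝ := (2 : ℝ) ^ (q - 1) * q * |γ| * K2 β γ r q

lemma kappa_nonneg {β γ r q : ℝ} (hβ : 0 < β) (hq : 1 ≤ q) (hqr : q < r) :
    0 ≤ kappa β γ r q := by
  have h1 : 0 ≤ r - q := by linarith
  have h2 : 0 ≤ r - 1 := by linarith
  have h3 : 0 ≤ q - 1 := by linarith
  unfold kappa K2
  positivity

/-- Enlarge the left side by 2^{q-1} ≥ 1, then apply Young's inequality with the exponents q - 1 < r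
- 1. For q = 1 the lower exponent is zero and Young does not apply, but then κ = |γ| bounds the left
side directly. -/
lemma mul_rpow_le_kappa {β γ r q s : ℝ} (hβ : 0 < β) (hq : 1 ≤ q) (hqr : q < r) (hs : 0 ≤ s) :
    q * |γ| * s ^ (q - 1) ≤ β * s ^ (r - 1) + kappa β γ r q := by
  have hq0 : 0 < q := by linarith
  have h2 : (1 : ℝ) ≤ 2 ^ (q - 1) := Real.one_le_rpow one_le_two (by linarith)
  have hle : q * |γ| * s ^ (q - 1) ≤ 2 ^ (q - 1) * q * |γ| * s ^ (q - 1) := by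
    have : 0 ≤ q * |γ| * s ^ (q - 1) := by positivity
    nlinarith
  refine hle.trans ?_
  rcases hq.eq_or_lt with rfl | hq1
  · have : (r - 1) / (r - 1) = 1 := div_self (by linarith)
    have : 0 ≤ β * s ^ (r - 1) := by positivity
    simp [kappa, K2, *]
  · have key := mul_rpow_le_mul_rpow_add (a := 2 ^ (q - 1) * q * |γ|) (by positivity) hβ
      (by linarith : 0 < q - 1) (by linarith : q - 1 < r - 1) hs
    have e : r - 1 - (q - 1) = r - q := by ring
    rw [e] at key
    unfold kappa K2
    rw [← mul_assoc]
    exact key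

variable {E : Type*} [NormedAddCommGroup E] [InnerProductSpace ℝ E]

/-- The map `u ↦ |u|^{s-1} u`. -/
def pw (s : ℝ) (u : E) : E := ‖u‖ ^ (s - 1) • u

/-- The derivative of `pw s` at `u`. -/
def pwD (s : ℝ) (u : E) : E →L[ℝ] E :=
  ‖u‖ ^ (s - 1) • ContinuousLinearMap.id ℝ E +
    ((s - 1) * ‖u‖ ^ (s - 3)) • (innerSL ℝ u).smulRight u

lemma continuous_pw {s : ℝ} (hs : 1 ≤ s) : Continuous (pw s : E → E) :=
  (continuous_norm.rpow_const fun _ => Or.inr (by linarith)).smul continuous_id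

lemma inner_pw {s : ℝ} (hs : 1 ≤ s) (u : E) : inner ℝ (pw s u) u = ‖u‖ ^ (s + 1) := by
  rw [pw, real_inner_smul_left, real_inner_self_eq_norm_sq]
  rcases (norm_nonneg u).eq_or_lt with h | h
  · rw [← h, Real.zero_rpow (by linarith : s + 1 ≠ 0)]; simp
  · rw [← Real.rpow_natCast, ← Real.rpow_add h]; congr 1; push_cast; ring

/-- The factor s - 1 is essential: for s = 1 and u = 0, the powers alone would give 0 on the left
and 0^0 = 1 on the right. -/
lemma norm_pow_mul_sq {F : Type*} [NormedAddCommGroup F] {s : ℝ} (u : F) (hs : 1 ≤ s) :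
    (s - 1) * ‖u‖ ^ (s - 3) * (‖u‖ * ‖u‖) = (s - 1) * ‖u‖ ^ (s - 1) := by
  rcases hs.eq_or_lt with rfl | hs
  · simp
  rcases (norm_nonneg u).eq_or_lt with h | h
  · rw [← h, Real.zero_rpow (by linarith : s - 1 ≠ 0)]; simp
  · have : ‖u‖ ^ (s - 1) = ‖u‖ ^ (s - 3) * ‖u‖ ^ (2 : ℝ) := by
      rw [← Real.rpow_add h]; congr 1; ring
    rw [this, Real.rpow_two]; ring

/-- For s = 1 the map is the identity. For s > 1 it is o(|x|) at the origin, and away from the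
origin ‖x‖^{s-1} is a power of the smooth function ‖x‖². -/
lemma hasFDerivAt_pw {s : ℝ} (hs : 1 ≤ s) (u : E) : HasFDerivAt (pw s) (pwD s u) u := by
  rcases hs.eq_or_lt with rfl | hs1
  · have h1 : (pw 1 : E → E) = id := by ext x; simp [pw]
    have h2 : pwD 1 u = ContinuousLinearMap.id ℝ E := by ext x; simp [pwD]
    rw [h1, h2]
    exact hasFDerivAt_id u
  rcases eq_or_ne u 0 with rfl | hu
  · have h2 : pwD s (0 : E) = 0 := by
      ext x; simp [pwD, Real.zero_rpow (by linarith : s - 1 ≠ 0)]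
    rw [h2, hasFDerivAt_iff_isLittleO_nhds_zero]
    have h0 : pw s (0 : E) = 0 := by simp [pw]
    simp only [zero_add, h0, sub_zero, _root_.zero_apply]
    have hl : Filter.Tendsto (fun x : E => ‖x‖ ^ (s - 1)) (nhds 0) (nhds 0) := by
      have : Continuous fun x : E => ‖x‖ ^ (s - 1) :=
        continuous_norm.rpow_const fun _ => Or.inr (by linarith)
      have h := this.tendsto 0
      rwa [norm_zero, Real.zero_rpow (by linarith : s - 1 ≠ 0)] at h
    have := ((Asymptotics.isLittleO_one_iff ℝ).2 hl).smul_isBigO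
      (Asymptotics.isBigO_refl (fun x : E => x) (nhds 0))
    simpa [pw] using this
  · have hn : ‖u‖ ≠ 0 := norm_ne_zero_iff.2 hu
    have hp : 0 < ‖u‖ := norm_pos_iff.2 hu
    have h1 : HasFDerivAt (fun x : E => ‖x‖ ^ (s - 1))
        (((s - 1) * ‖u‖ ^ (s - 3)) • innerSL ℝ u) u := by
      have h := ((hasStrictFDerivAt_norm_sq u).hasFDerivAt).rpow_const (p := (s - 1) / 2)
        (Or.inl (by positivity))
      have e : (fun x : E => (‖x‖ ^ 2) ^ ((s - 1) / 2)) = fun x => ‖x‖ ^ (s - 1) := by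
        ext x
        rw [← Real.rpow_natCast, ← Real.rpow_mul (norm_nonneg x)]
        congr 1
        push_cast
        ring
      rw [e] at h
      convert h using 1
      ext x
      have e2 : (‖u‖ ^ 2) ^ ((s - 1) / 2 - 1) = ‖u‖ ^ (s - 3) := by
        rw [← Real.rpow_natCast, ← Real.rpow_mul (norm_nonneg u)]
        congr 1
        push_cast
        ring
      rw [e2]
      simp
      ring
    have := h1.smul (hasFDerivAt_id u)
    have e3 : pwD s u = ‖u‖ ^ (s - 1) • ContinuousLinearMap.id ℝ E +
        (((s - 1) * ‖u‖ ^ (s - 3)) • innerSL ℝ u).smulRight (id u) := by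
      ext x
      simp [pwD, mul_smul]
    rw [e3]
    exact this

lemma inner_pwD (s : ℝ) (u w : E) : inner ℝ (pwD s u w) w =
    ‖u‖ ^ (s - 1) * ‖w‖ ^ 2 + (s - 1) * ‖u‖ ^ (s - 3) * (inner ℝ u w) ^ 2 := by
  simp only [pwD, _root_.add_apply, _root_.smul_apply,
    ContinuousLinearMap.id_apply, ContinuousLinearMap.smulRight_apply, innerSL_apply_apply,
    inner_add_left, real_inner_smul_left, real_inner_self_eq_norm_sq]
  ring

lemma le_inner_pwD {s : ℝ} (hs : 1 ≤ s) (u w : E) :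
    ‖u‖ ^ (s - 1) * ‖w‖ ^ 2 ≤ inner ℝ (pwD s u w) w := by
  rw [inner_pwD]
  have : 0 ≤ s - 1 := by linarith
  have : 0 ≤ (s - 1) * ‖u‖ ^ (s - 3) * (inner ℝ u w) ^ 2 := by positivity
  linarith

lemma inner_pwD_le {s : ℝ} (hs : 1 ≤ s) (u w : E) :
    inner ℝ (pwD s u w) w ≤ s * ‖u‖ ^ (s - 1) * ‖w‖ ^ 2 := by
  rw [inner_pwD]
  have h1 : 0 ≤ s - 1 := by linarith
  have h2 : (inner ℝ u w) ^ 2 ≤ (‖u‖ * ‖w‖) ^ 2 := by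
    rw [← sq_abs]
    gcongr
    exact abs_real_inner_le_norm u w
  have h3 := mul_le_mul_of_nonneg_left h2 (by positivity : 0 ≤ (s - 1) * ‖u‖ ^ (s - 3))
  have h4 := norm_pow_mul_sq u hs
  have h5 : (s - 1) * ‖u‖ ^ (s - 3) * (‖u‖ * ‖w‖) ^ 2 = (s - 1) * ‖u‖ ^ (s - 1) * ‖w‖ ^ 2 := by
    rw [← h4]; ring
  linarith

lemma norm_pwD_le {s : ℝ} (hs : 1 ≤ s) (u : E) : ‖pwD s u‖ ≤ s * ‖u‖ ^ (s - 1) := by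
  have h1 : 0 ≤ s - 1 := by linarith
  refine ContinuousLinearMap.opNorm_le_bound _ (by positivity) fun w => ?_
  have e : pwD s u w = ‖u‖ ^ (s - 1) • w + ((s - 1) * ‖u‖ ^ (s - 3) * inner ℝ u w) • u := by
    simp only [pwD, _root_.add_apply, _root_.smul_apply, ContinuousLinearMap.id_apply,
      ContinuousLinearMap.smulRight_apply, innerSL_apply_apply, mul_smul]
  rw [e]
  refine (norm_add_le _ _).trans ?_
  rw [norm_smul, norm_smul, norm_mul, Real.norm_of_nonneg (by positivity),
    Real.norm_of_nonneg (by positivity)]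
  have h2 : ‖inner ℝ u w‖ ≤ ‖u‖ * ‖w‖ := abs_real_inner_le_norm u w
  have h3 : (s - 1) * ‖u‖ ^ (s - 3) * ‖inner ℝ u w‖ * ‖u‖ ≤
      (s - 1) * ‖u‖ ^ (s - 3) * (‖u‖ * ‖w‖) * ‖u‖ := by gcongr
  have h4 := norm_pow_mul_sq u hs
  have h5 : (s - 1) * ‖u‖ ^ (s - 3) * (‖u‖ * ‖w‖) * ‖u‖ = (s - 1) * ‖u‖ ^ (s - 1) * ‖w‖ := by
    rw [← h4]; ring
  linarith

lemma continuous_pwD {s : ℝ} (hs : 1 ≤ s) : Continuous (pwD s : E → E →L[ℝ] E) := by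
  rcases hs.eq_or_lt with rfl | hs1
  · have : (pwD 1 : E → E →L[ℝ] E) = fun _ => ContinuousLinearMap.id ℝ E := by
      ext u x; simp [pwD]
    rw [this]; exact continuous_const
  rw [continuous_iff_continuousAt]
  intro u
  rcases eq_or_ne u 0 with rfl | hu
  · have h0 : pwD s (0 : E) = 0 := by
      ext x; simp [pwD, Real.zero_rpow (by linarith : s - 1 ≠ 0)]
    rw [ContinuousAt, h0]
    refine squeeze_zero_norm (fun u => norm_pwD_le hs u) ?_
    have : Continuous fun x : E => s * ‖x‖ ^ (s - 1) :=
      continuous_const.mul (continuous_norm.rpow_const fun _ => Or.inr (by linarith))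
    have h := this.tendsto 0
    rwa [norm_zero, Real.zero_rpow (by linarith : s - 1 ≠ 0), mul_zero] at h
  · have hn : ‖u‖ ≠ 0 := norm_ne_zero_iff.2 hu
    have h1 : ContinuousAt (fun x : E => ‖x‖ ^ (s - 1)) u :=
      continuous_norm.continuousAt.rpow_const (Or.inl hn)
    have h2 : ContinuousAt (fun x : E => (s - 1) * ‖x‖ ^ (s - 3)) u :=
      continuousAt_const.mul (continuous_norm.continuousAt.rpow_const (Or.inl hn))
    have h3 : Continuous fun x : E => (innerSL ℝ x).smulRight x := by fun_prop
    exact (h1.smul continuousAt_const).add (h2.smul h3.continuousAt)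

/-- The damping nonlinearity `u ↦ β |u|^{r-1} u + γ |u|^{q-1} u`. -/
def damp (β γ r q : ℝ) (u : E) : E := β • pw r u + γ • pw q u

/-- The derivative of the damping nonlinearity. -/
def dampD (β γ r q : ℝ) (u : E) : E →L[ℝ] E := β • pwD r u + γ • pwD q u

variable {β γ r q : ℝ}

lemma continuous_damp (hq : 1 ≤ q) (hqr : q < r) : Continuous (damp β γ r q : E → E) :=
  ((continuous_pw (by linarith)).const_smul β).add ((continuous_pw hq).const_smul γ)

lemma hasFDerivAt_damp (hq : 1 ≤ q) (hqr : q < r) (u : E) :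
    HasFDerivAt (damp β γ r q) (dampD β γ r q u) u :=
  ((hasFDerivAt_pw (by linarith) u).const_smul β).add ((hasFDerivAt_pw hq u).const_smul γ)

lemma contDiff_damp (hq : 1 ≤ q) (hqr : q < r) : ContDiff ℝ 1 (damp β γ r q : E → E) := by
  rw [contDiff_one_iff_fderiv]
  refine ⟨fun u => (hasFDerivAt_damp hq hqr u).differentiableAt, ?_⟩
  have : fderiv ℝ (damp β γ r q : E → E) = dampD β γ r q :=
    funext fun u => (hasFDerivAt_damp hq hqr u).fderiv
  rw [this]
  exact ((continuous_pwD (by linarith)).const_smul β).add ((continuous_pwD hq).const_smul γ)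

/-- The β part contributes at least β|u|^{r-1}|w|², the γ part at least -q|γ||u|^{q-1}|w|²; κ is the
bound for the deficit. -/
lemma neg_kappa_le_inner_dampD (hβ : 0 < β) (hq : 1 ≤ q) (hqr : q < r) (u w : E) :
    -(kappa β γ r q * ‖w‖ ^ 2) ≤ inner ℝ (dampD β γ r q u w) w := by
  have e : inner ℝ (dampD β γ r q u w) w =
      β * inner ℝ (pwD r u w) w + γ * inner ℝ (pwD q u w) w := by
    simp [dampD, inner_add_left, real_inner_smul_left]
  rw [e]
  have h1 := mul_le_mul_of_nonneg_left (le_inner_pwD (by linarith : 1 ≤ r) u w) hβ.le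
  have h2 : |γ * inner ℝ (pwD q u w) w| ≤ |γ| * (q * ‖u‖ ^ (q - 1) * ‖w‖ ^ 2) := by
    rw [abs_mul]
    gcongr
    rw [abs_of_nonneg]
    · exact inner_pwD_le hq u w
    · exact le_trans (by positivity) (le_inner_pwD hq u w)
  have h3 := (abs_le.1 h2).1
  have h4 := mul_le_mul_of_nonneg_right
    (mul_rpow_le_kappa (γ := γ) hβ hq hqr (norm_nonneg u)) (sq_nonneg ‖w‖)
  nlinarith

/-- Mean value theorem along the segment from b to a, applied to the component of the damping map in
the direction a - b. -/
lemma neg_kappa_le_inner_damp_sub (hβ : 0 < β) (hq : 1 ≤ q) (hqr : q < r) (a b : E) :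
    -(kappa β γ r q * ‖a - b‖ ^ 2) ≤ inner ℝ (damp β γ r q a - damp β γ r q b) (a - b) := by
  set w := a - b with hw
  set φ : ℝ → ℝ := fun t => inner ℝ (damp β γ r q (b + t • w)) w
  have hd : ∀ t, HasDerivAt φ (inner ℝ (dampD β γ r q (b + t • w) w) w) t := by
    intro t
    have h1 : HasDerivAt (fun t : ℝ => b + t • w) w t := by
      simpa using ((hasDerivAt_id t).smul_const w).const_add b
    have h2 := (hasFDerivAt_damp (β := β) (γ := γ) hq hqr (b + t • w)).comp_hasDerivAt t h1
    have h3 := h2.inner ℝ (hasDerivAt_const t w)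
    simpa using h3
  obtain ⟨t, _, ht⟩ := exists_hasDerivAt_eq_slope φ _ zero_lt_one
    (fun t _ => (hd t).continuousAt.continuousWithinAt) (fun t _ => hd t)
  have h0 : φ 1 - φ 0 = inner ℝ (damp β γ r q a - damp β γ r q b) w := by
    simp only [φ]
    rw [inner_sub_left]
    congr 3 <;> simp [hw]
  rw [← h0]
  simp only [sub_zero, div_one] at ht
  rw [← ht]
  exact neg_kappa_le_inner_dampD hβ hq hqr _ _

lemma neg_K1_le_inner_damp (hβ : 0 < β) (hq : 1 ≤ q) (hqr : q < r) (u : E) :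
    -K1 β γ r q ≤ inner ℝ (damp β γ r q u) u := by
  have e : inner ℝ (damp β γ r q u) u = β * ‖u‖ ^ (r + 1) + γ * ‖u‖ ^ (q + 1) := by
    simp only [damp, inner_add_left, real_inner_smul_left]
    rw [inner_pw (by linarith), inner_pw hq]
  rw [e]
  have h1 := abs_mul_rpow_le_K1 (γ := γ) hβ hq hqr (norm_nonneg u)
  have h2 : -(|γ| * ‖u‖ ^ (q + 1)) ≤ γ * ‖u‖ ^ (q + 1) := by
    rw [← neg_mul]
    gcongr
    exact neg_abs_le γ
  linarith

end PowerMap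

/-! ### Integration by parts for periodic fields. -/

section Torus

variable {d : ℕ} {L : ℝ}

lemma toLp_preimage_cube : (WithLp.toLp 2 : (Fin d → ℝ) → Vec d) ⁻¹' cube d L =
    Set.Icc 0 (fun _ => L) := by
  ext x
  simp [cube, Set.mem_Icc, Pi.le_def, forall_and]

lemma setIntegral_cube {F : Type*} [NormedAddCommGroup F] [NormedSpace ℝ F] (h : Vec d → F) :
    ∫ x, h x ∂torusMeasure d L = ∫ x in Set.Icc (0 : Fin d → ℝ) (fun _ => L), h (WithLp.toLp 2 x) := by
  rw [torusMeasure, ← toLp_preimage_cube]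
  exact ((PiLp.volume_preserving_toLp (Fin d)).setIntegral_preimage_emb
    (MeasurableEquiv.toLp 2 (Fin d → ℝ)).measurableEmbedding h (cube d L)).symm

lemma isCompact_cube : IsCompact (cube d L) := by
  have h : cube d L = (WithLp.toLp 2 : (Fin d → ℝ) → Vec d) '' Set.Icc 0 (fun _ => L) := by
    rw [← toLp_preimage_cube, Set.image_preimage_eq _ (WithLp.toLp_surjective 2)]
  rw [h]
  exact isCompact_Icc.image (PiLp.continuous_toLp 2 _)

instance : IsFiniteMeasure (torusMeasure d L) :=
  ⟨by rw [torusMeasure, Measure.restrict_apply_univ]; exact isCompact_cube.measure_lt_top⟩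

lemma measureReal_torus (hL : 0 < L) : (torusMeasure d L).real Set.univ = L ^ d := by
  have h := setIntegral_cube (d := d) (L := L) (fun _ => (1 : ℝ))
  simp only [integral_const, smul_eq_mul, mul_one, measureReal_restrict_apply_univ] at h
  rw [h, Measure.real, Real.volume_Icc_pi]
  simp [ENNReal.toReal_ofReal hL.le]

lemma Continuous.integrable_torus {F : Type*} [NormedAddCommGroup F] {h : Vec d → F}
    (hh : Continuous h) : Integrable h (torusMeasure d L) :=
  hh.continuousOn.integrableOn_compact isCompact_cube

/-- The integral over the torus of a partial derivative vanishes. -/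
lemma integral_fderiv_single (hL : 0 < L) {g : Vec d → ℝ} (hg : ContDiff ℝ 1 g) (i : Fin d)
    (hper : ∀ x : Vec d, g (x + EuclideanSpace.single i L) = g x) :
    ∫ x, fderiv ℝ g x (EuclideanSpace.single i 1) ∂torusMeasure d L = 0 := by
  obtain _ | n := d
  · exact i.elim0
  rw [setIntegral_cube]
  let T : (Fin (n + 1) → ℝ) →L[ℝ] Vec (n + 1) :=
    (PiLp.continuousLinearEquiv 2 ℝ (fun _ : Fin (n + 1) => ℝ)).symm
  have hT : ∀ x, T x = WithLp.toLp 2 x := fun x => rfl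
  have hTs : ∀ j, T (Pi.single j 1) = EuclideanSpace.single j 1 := fun j => rfl
  -- Divergence theorem for the field whose only nonzero component is g, in position i. The two
  -- faces orthogonal to direction i cancel by periodicity.
  let f : Fin (n + 1) → (Fin (n + 1) → ℝ) → ℝ := fun j x => if j = i then g (T x) else 0
  let f' : Fin (n + 1) → (Fin (n + 1) → ℝ) → (Fin (n + 1) → ℝ) →L[ℝ] ℝ :=
    fun j x => if j = i then (fderiv ℝ g (T x)).comp T else 0
  have hsum : ∀ x, ∑ j, f' j x (Pi.single j 1) =
      fderiv ℝ g (WithLp.toLp 2 x) (EuclideanSpace.single i 1) := by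
    intro x
    rw [Finset.sum_eq_single i]
    · simp only [f', if_true, ContinuousLinearMap.comp_apply, hTs, hT]
    · intro j _ hj; simp [f', hj]
    · simp
  have hcd : Continuous fun x : Vec (n + 1) => fderiv ℝ g x (EuclideanSpace.single i 1) :=
    (hg.continuous_fderiv one_ne_zero).clm_apply continuous_const
  have key := integral_divergence_of_hasFDerivAt_off_countable' (0 : Fin (n + 1) → ℝ)
    (fun _ => L) (fun _ => hL.le) f f' ∅ Set.countable_empty
    (fun j => by
      by_cases hj : j = i
      · simp only [f, hj, if_true]
        exact (hg.continuous.comp T.continuous).continuousOn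
      · simp only [f, hj, if_false]; exact continuousOn_const)
    (fun x _ j => by
      by_cases hj : j = i
      · simp only [f, f', hj, if_true]
        exact ((hg.differentiable one_ne_zero).differentiableAt.hasFDerivAt).comp x T.hasFDerivAt
      · simp only [f, f', hj, if_false]; exact hasFDerivAt_const _ _)
    (by
      simp_rw [hsum]
      exact (hcd.comp (PiLp.continuous_toLp 2 _)).continuousOn.integrableOn_compact isCompact_Icc)
  simp_rw [hsum] at key
  rw [key]
  refine Finset.sum_eq_zero fun j _ => ?_
  by_cases hj : j = i
  · subst hj
    rw [sub_eq_zero]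
    congr 1
    ext x
    simp only [f, if_true]
    rw [← hper (T (j.insertNth ((0 : Fin (n + 1) → ℝ) j) x))]
    congr 1
    ext l
    refine Fin.succAboveCases j ?_ (fun m => ?_) l
    · simp [hT]
    · simp [hT, Fin.succAbove_ne]
  · simp [f, hj]

/-- Periodicity in every coordinate with period `L`. -/
def IsPeriodic {F : Type*} (L : ℝ) (φ : Vec d → F) : Prop :=
  ∀ (x : Vec d) (i : Fin d), φ (x + EuclideanSpace.single i L) = φ x

lemma IsPeriodic.fderiv {F : Type*} [NormedAddCommGroup F] [NormedSpace ℝ F] {φ : Vec d → F}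
    (h : IsPeriodic L φ) : IsPeriodic L (_root_.fderiv ℝ φ) := by
  intro x i
  have : (fun y => φ (y + EuclideanSpace.single i L)) = φ := funext fun y => h y i
  conv_rhs => rw [← this]
  rw [fderiv_comp_add_right]

lemma IsPeriodic.partialDeriv {φ : Vec d → Vec d} (h : IsPeriodic L φ) (j : Fin d) :
    IsPeriodic L (CBFeD.partialDeriv j φ) := by
  intro x i
  simp only [CBFeD.partialDeriv]
  rw [h.fderiv x i]

lemma integral_inner_partialDeriv (hL : 0 < L) {φ ψ : Vec d → Vec d} (hφ : ContDiff ℝ 1 φ)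
    (hψ : ContDiff ℝ 1 ψ) (pφ : IsPeriodic L φ) (pψ : IsPeriodic L ψ) (i : Fin d) :
    ∫ x, inner ℝ (partialDeriv i φ x) (ψ x) ∂torusMeasure d L =
      -∫ x, inner ℝ (φ x) (partialDeriv i ψ x) ∂torusMeasure d L := by
  have h := integral_fderiv_single hL (hφ.inner ℝ hψ) i
    (fun x => by simp only [pφ x i, pψ x i])
  have e : ∀ x, fderiv ℝ (fun y => inner ℝ (φ y) (ψ y)) x (EuclideanSpace.single i 1) =
      inner ℝ (φ x) (partialDeriv i ψ x) + inner ℝ (partialDeriv i φ x) (ψ x) := by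
    intro x
    rw [fderiv_inner_apply ℝ (hφ.differentiable one_ne_zero).differentiableAt
      (hψ.differentiable one_ne_zero).differentiableAt]
    rfl
  have c1 : Continuous fun x => inner ℝ (φ x) (partialDeriv i ψ x) :=
    hφ.continuous.inner ((hψ.continuous_fderiv one_ne_zero).clm_apply continuous_const)
  have c2 : Continuous fun x => inner ℝ (partialDeriv i φ x) (ψ x) :=
    ((hφ.continuous_fderiv one_ne_zero).clm_apply continuous_const).inner hψ.continuous
  simp_rw [e] at h
  rw [integral_add (Continuous.integrable_torus c1) (Continuous.integrable_torus c2)] at h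
  linarith

end Torus

/-! ### The Hartley functions. -/

section Hartley

variable {d : ℕ} (L : ℝ)

/-- The frequencies `2πk_i/L`. -/
def freq (k : Fin d → ℤ) (i : Fin d) : ℝ := 2 * Real.pi / L * k i

/-- The phase `2πk·x/L`. -/
def phase (k : Fin d → ℤ) : Vec d →L[ℝ] ℝ := ∑ i, freq L k i • EuclideanSpace.proj i

/-- The eigenvalues of `-Δ`. -/
def lam (k : Fin d → ℤ) : ℝ := ∑ i, freq L k i ^ 2

/-- The weights of the `H¹`-norm. -/
def wt (k : Fin d → ℤ) : ℝ := 1 + lam L k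

/-- The Hartley functions, a real orthonormal system of trigonometric functions. -/
def har (k : Fin d → ℤ) (x : Vec d) : ℝ :=
  (√(L ^ d))⁻¹ * (Real.cos (phase L k x) + Real.sin (phase L k x))

/-- A uniform bound for the Hartley functions. -/
def harBound (d : ℕ) (L : ℝ) : ℝ := 2 * (√(L ^ d))⁻¹

variable {L}

lemma freq_neg (k : Fin d → ℤ) (i : Fin d) : freq L (-k) i = -freq L k i := by simp [freq]
lemma freq_add (k l : Fin d → ℤ) (i : Fin d) : freq L (k + l) i = freq L k i + freq L l i := by
  simp [freq]; ring
lemma phase_apply (k : Fin d → ℤ) (x : Vec d) : phase L k x = ∑ i, freq L k i * x i := by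
  simp [phase, sum_apply]
lemma phase_neg (k : Fin d → ℤ) (x : Vec d) : phase L (-k) x = -phase L k x := by
  simp [phase_apply, freq_neg]
lemma phase_add (k l : Fin d → ℤ) (x : Vec d) :
    phase L (k + l) x = phase L k x + phase L l x := by
  simp [phase_apply, freq_add, add_mul, Finset.sum_add_distrib]
lemma phase_zero (x : Vec d) : phase L 0 x = 0 := by simp [phase_apply, freq]
lemma phase_single (k : Fin d → ℤ) (i : Fin d) (t : ℝ) :
    phase L k (EuclideanSpace.single i t) = freq L k i * t := by
  simp [phase_apply]

lemma lam_nonneg (k : Fin d → ℤ) : 0 ≤ lam L k := Finset.sum_nonneg fun _ _ => sq_nonneg _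
lemma one_le_wt (k : Fin d → ℤ) : 1 ≤ wt L k := le_add_of_nonneg_right (lam_nonneg k)
lemma wt_pos (k : Fin d → ℤ) : 0 < wt L k := one_pos.trans_le (one_le_wt k)
lemma freq_sq_le_wt (k : Fin d → ℤ) (i : Fin d) : freq L k i ^ 2 ≤ wt L k := by
  have : freq L k i ^ 2 ≤ lam L k :=
    Finset.single_le_sum (f := fun i => freq L k i ^ 2) (fun _ _ => sq_nonneg _)
      (Finset.mem_univ i)
  have := lam_nonneg (L := L) k
  unfold wt; linarith
lemma abs_freq_le_wt (k : Fin d → ℤ) (i : Fin d) : |freq L k i| ≤ wt L k := by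
  have h1 := freq_sq_le_wt (L := L) k i
  have h2 := one_le_wt (L := L) k
  rw [← sq_abs] at h1
  nlinarith [abs_nonneg (freq L k i)]

lemma continuous_har (k : Fin d → ℤ) : Continuous (har L k) := by
  unfold har; fun_prop

lemma harBound_nonneg : 0 ≤ harBound d L := by unfold harBound; positivity

lemma abs_har_le (k : Fin d → ℤ) (x : Vec d) : |har L k x| ≤ harBound d L := by
  rw [har, harBound, abs_mul, abs_of_nonneg (by positivity : 0 ≤ (√(L ^ d))⁻¹), mul_comm]
  gcongr
  calc _ ≤ |Real.cos (phase L k x)| + |Real.sin (phase L k x)| := abs_add_le _ _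
    _ ≤ 1 + 1 := add_le_add (Real.abs_cos_le_one _) (Real.abs_sin_le_one _)
    _ = 2 := by norm_num

lemma contDiff_har (k : Fin d → ℤ) : ContDiff ℝ ∞ (har L k) := by
  unfold har
  exact contDiff_const.mul ((phase L k).contDiff.cos.add (phase L k).contDiff.sin)

/-- The derivative cos - sin of cos + sin is cos + sin at the opposite phase. Differentiation thus
acts on the indices by k ↦ -k, and all coefficients stay real. -/
lemma hasFDerivAt_har (k : Fin d → ℤ) (x : Vec d) :
    HasFDerivAt (har L k) (har L (-k) x • phase L k) x := by
  have h := (((phase L k).hasFDerivAt (x := x)).cos.add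
    ((phase L k).hasFDerivAt (x := x)).sin).const_mul (√(L ^ d))⁻¹
  refine h.congr_fderiv ?_
  rw [har, phase_neg, Real.cos_neg, Real.sin_neg]
  ext v
  simp
  ring

lemma phase_add_single (hL : 0 < L) (k : Fin d → ℤ) (x : Vec d) (i : Fin d) :
    phase L k (x + EuclideanSpace.single i L) = phase L k x + k i * (2 * Real.pi) := by
  rw [map_add, phase_single, freq]
  field_simp

lemma isPeriodic_har (hL : 0 < L) (k : Fin d → ℤ) : IsPeriodic L (har L k) := by
  intro x i
  simp only [har, phase_add_single hL, Real.cos_add_int_mul_two_pi, Real.sin_add_int_mul_two_pi]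

lemma har_mul_har (hL : 0 < L) (k l : Fin d → ℤ) (x : Vec d) : har L k x * har L l x =
    (L ^ d)⁻¹ * (Real.cos (phase L (k - l) x) + Real.sin (phase L (k + l) x)) := by
  have h : (√(L ^ d))⁻¹ * (√(L ^ d))⁻¹ = (L ^ d)⁻¹ := by
    rw [← mul_inv, Real.mul_self_sqrt (by positivity)]
  rw [sub_eq_add_neg, phase_add, phase_add, phase_neg, ← sub_eq_add_neg, Real.cos_sub,
    Real.sin_add, ← h, har, har]
  ring

/-- The product formula for Hartley functions. -/
lemma har_mul_har' (hL : 0 < L) (k l : Fin d → ℤ) (x : Vec d) : har L k x * har L l x =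
    (√(L ^ d))⁻¹ / 2 *
      (har L (k - l) x + har L (l - k) x + har L (k + l) x - har L (-(k + l)) x) := by
  have h : (√(L ^ d))⁻¹ * (√(L ^ d))⁻¹ = (L ^ d)⁻¹ := by
    rw [← mul_inv, Real.mul_self_sqrt (by positivity)]
  rw [har_mul_har hL, ← h, ← neg_sub k l]
  simp only [har, phase_neg, Real.cos_neg, Real.sin_neg]
  ring

/-- In a direction where the frequency is nonzero, sine and cosine of the phase are multiples of
partial derivatives of periodic functions. -/
lemma integral_phase (hL : 0 < L) {k : Fin d → ℤ} (hk : k ≠ 0) :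
    ∫ x, Real.cos (phase L k x) ∂torusMeasure d L = 0 ∧
      ∫ x, Real.sin (phase L k x) ∂torusMeasure d L = 0 := by
  obtain ⟨i, hi⟩ := Function.ne_iff.1 hk
  have hf : freq L k i ≠ 0 := by
    have : (k i : ℝ) ≠ 0 := by exact_mod_cast hi
    have := Real.pi_pos
    unfold freq
    positivity
  constructor
  · have h := integral_fderiv_single hL (g := fun x => Real.sin (phase L k x))
      (phase L k).contDiff.sin i
      (fun x => by rw [phase_add_single hL, Real.sin_add_int_mul_two_pi])
    have e : ∀ x, fderiv ℝ (fun x => Real.sin (phase L k x)) x (EuclideanSpace.single i 1) =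
        freq L k i * Real.cos (phase L k x) := by
      intro x
      rw [((phase L k).hasFDerivAt (x := x)).sin.fderiv]
      simp [phase_single, mul_comm]
    simp_rw [e] at h
    rw [integral_const_mul] at h
    exact (mul_eq_zero.1 h).resolve_left hf
  · have h := integral_fderiv_single hL (g := fun x => Real.cos (phase L k x))
      (phase L k).contDiff.cos i
      (fun x => by rw [phase_add_single hL, Real.cos_add_int_mul_two_pi])
    have e : ∀ x, fderiv ℝ (fun x => Real.cos (phase L k x)) x (EuclideanSpace.single i 1) =
        -freq L k i * Real.sin (phase L k x) := by
      intro x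
      rw [((phase L k).hasFDerivAt (x := x)).cos.fderiv]
      simp [phase_single, mul_comm]
    simp_rw [e] at h
    rw [integral_const_mul] at h
    exact (mul_eq_zero.1 h).resolve_left (neg_ne_zero.2 hf)

lemma integral_har_mul_har (hL : 0 < L) (k l : Fin d → ℤ) :
    ∫ x, har L k x * har L l x ∂torusMeasure d L = if k = l then 1 else 0 := by
  simp_rw [har_mul_har hL]
  have c1 : Continuous fun x => Real.cos (phase L (k - l) x) := by fun_prop
  have c2 : Continuous fun x => Real.sin (phase L (k + l) x) := by fun_prop
  have hs : ∫ x, Real.sin (phase L (k + l) x) ∂torusMeasure d L = 0 := by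
    by_cases h : k + l = 0
    · simp [h, phase_zero]
    · exact (integral_phase hL h).2
  rw [integral_const_mul, integral_add (Continuous.integrable_torus c1)
    (Continuous.integrable_torus c2), hs, add_zero]
  split_ifs with h
  · simp only [h, sub_self, phase_zero, Real.cos_zero, integral_const, smul_eq_mul, mul_one]
    rw [measureReal_torus hL, inv_mul_cancel₀ (by positivity)]
  · rw [(integral_phase hL (sub_ne_zero.2 h)).1, mul_zero]

end Hartley

/-! ### Uniform density of trigonometric polynomials. -/

section Completeness

variable {d : ℕ} {L : ℝ}

lemma mFourier_coe (k : Fin d → ℤ) (x : Vec d) :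
    UnitAddTorus.mFourier k (fun i => ((x i / L : ℝ) : UnitAddCircle)) =
      Complex.exp (phase L k x * Complex.I) := by
  simp only [UnitAddTorus.mFourier, ContinuousMap.coe_mk, fourier_coe_apply]
  rw [← Complex.exp_sum, phase_apply]
  congr 1
  push_cast
  rw [Finset.sum_mul]
  refine Finset.sum_congr rfl fun i _ => ?_
  simp only [freq]
  push_cast
  ring

/-- The trigonometric polynomials are uniformly dense in the continuous periodic functions. -/
lemma exists_mem_span_har_norm_sub_lt (hL : 0 < L) {g : Vec d → ℝ} (hg : Continuous g)
    (hp : IsPeriodic L g) {ε : ℝ} (hε : 0 < ε) :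
    ∃ p ∈ Submodule.span ℝ (Set.range (har L : (Fin d → ℤ) → Vec d → ℝ)),
      ∀ x, |g x - p x| < ε := by
  let π : (Fin d → ℝ) → UnitAddTorus (Fin d) := Pi.map fun _ => ((↑) : ℝ → UnitAddCircle)
  have hπ : IsOpenQuotientMap π :=
    IsOpenQuotientMap.piMap fun _ => QuotientAddGroup.isOpenQuotientMap_mk
  have hperZ : ∀ (n : Fin d → ℤ) (x : Vec d), g (x + WithLp.toLp 2 (fun i => n i * L)) = g x := by
    intro n
    have hsa : ∀ (i : Fin d) (a b : ℝ), (EuclideanSpace.single i a : Vec d) +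
        EuclideanSpace.single i b = EuclideanSpace.single i (a + b) := by
      intro i a b
      ext j
      by_cases h : j = i <;> simp [h]
    have hs0 : ∀ i : Fin d, (EuclideanSpace.single i 0 : Vec d) = 0 := by
      intro i
      ext j
      by_cases h : j = i <;> simp [h]
    have h1 : ∀ (i : Fin d) (m : ℤ) (x : Vec d), g (x + EuclideanSpace.single i (m * L)) = g x := by
      intro i m
      induction m using Int.induction_on with
      | zero => intro x; simp [hs0]
      | succ m ih =>
        intro x
        have : x + EuclideanSpace.single i (((m : ℤ) + 1 : ℤ) * L) =
            x + EuclideanSpace.single i (((m : ℤ) : ℝ) * L) + EuclideanSpace.single i L := by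
          rw [add_assoc, hsa]; congr 2; push_cast; ring
        rw [this, hp, ih]
      | pred m ih =>
        intro x
        rw [← hp]
        have : x + EuclideanSpace.single i ((-(m : ℤ) - 1 : ℤ) * L) + EuclideanSpace.single i L =
            x + EuclideanSpace.single i (((-(m : ℤ) : ℤ) : ℝ) * L) := by
          rw [add_assoc, hsa]; congr 2; push_cast; ring
        rw [this, ih]
    have h2 : ∀ (s : Finset (Fin d)) (x : Vec d),
        g (x + ∑ i ∈ s, EuclideanSpace.single i (n i * L)) = g x := by
      intro s
      induction s using Finset.induction_on with
      | empty => intro x; simp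
      | insert i s hi ih => intro x; rw [Finset.sum_insert hi, ← add_assoc, ih, h1]
    intro x
    rw [← h2 Finset.univ x]
    congr 2
    ext j
    simp [Finset.sum_apply, Pi.single_apply]
  -- An arbitrary, possibly discontinuous, section of the quotient map. By lattice periodicity the
  -- values of g do not depend on the choice, so g descends to a continuous function on the torus.
  let sec : UnitAddTorus (Fin d) → (Fin d → ℝ) := Function.surjInv hπ.surjective
  have hsec : ∀ t, π (sec t) = t := Function.surjInv_eq hπ.surjective
  have hcomp : ∀ x : Fin d → ℝ,
      g (WithLp.toLp 2 (fun i => sec (π x) i * L)) = g (WithLp.toLp 2 (fun i => x i * L)) := by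
    intro x
    have h := hsec (π x)
    have h' : ∀ i, ∃ n : ℤ, sec (π x) i = x i + n := by
      intro i
      have hi : ((sec (π x) i : ℝ) : UnitAddCircle) = (x i : ℝ) := congrFun h i
      obtain ⟨n, hn⟩ := AddSubgroup.mem_zmultiples_iff.1 (QuotientAddGroup.eq.1 hi.symm)
      refine ⟨n, ?_⟩
      rw [zsmul_eq_mul, mul_one] at hn
      rw [hn]
      ring
    choose n hn using h'
    rw [← hperZ n (WithLp.toLp 2 (fun i => x i * L))]
    congr 1
    ext i
    simp [hn, add_mul]
  let f : C(UnitAddTorus (Fin d), ℂ) :=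
    ⟨fun t => ((g (WithLp.toLp 2 (fun i => sec t i * L)) : ℝ) : ℂ), by
      rw [hπ.isQuotientMap.continuous_iff]
      have : ((fun t => ((g (WithLp.toLp 2 (fun i => sec t i * L)) : ℝ) : ℂ)) ∘ π) =
          fun x => ((g (WithLp.toLp 2 (fun i => x i * L)) : ℝ) : ℂ) :=
        funext fun x => congrArg _ (hcomp x)
      rw [this]
      refine Complex.continuous_ofReal.comp (hg.comp ((PiLp.continuous_toLp 2 _).comp ?_))
      fun_prop⟩
  have hf : f ∈ closure (Submodule.span ℂ (Set.range (UnitAddTorus.mFourier (d := Fin d))) :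
      Set C(UnitAddTorus (Fin d), ℂ)) := by
    rw [← Submodule.topologicalClosure_coe, UnitAddTorus.span_mFourier_closure_eq_top]; trivial
  obtain ⟨p, hpm, hpd⟩ := Metric.mem_closure_iff.1 hf ε hε
  let q : Vec d → UnitAddTorus (Fin d) := fun x i => ((x i / L : ℝ) : UnitAddCircle)
  -- The free factor z makes the induction stable under complex scalars. The real part of z exp(iθ)
  -- is a real combination of the Hartley functions of indices k and -k.
  have hspan : ∀ z : ℂ, (fun x : Vec d => (z * p (q x)).re) ∈
      Submodule.span ℝ (Set.range (har L : (Fin d → ℤ) → Vec d → ℝ)) := by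
    clear hpd
    induction hpm using Submodule.span_induction with
    | mem p h =>
      obtain ⟨k, rfl⟩ := h
      intro z
      have hc : (√(L ^ d)) ≠ 0 := by positivity
      have : (fun x : Vec d => (z * UnitAddTorus.mFourier k (q x)).re) =
          (√(L ^ d) * (z.re - z.im) / 2) • har L k +
            (√(L ^ d) * (z.re + z.im) / 2) • har L (-k) := by
        ext x
        simp only [q]
        rw [mFourier_coe, Complex.mul_re, Complex.exp_ofReal_mul_I_re,
          Complex.exp_ofReal_mul_I_im]
        simp only [Pi.add_apply, Pi.smul_apply, smul_eq_mul, har, phase_neg, Real.cos_neg,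
          Real.sin_neg]
        field_simp
        ring
      rw [this]
      exact Submodule.add_mem _ (Submodule.smul_mem _ _ (Submodule.subset_span ⟨k, rfl⟩))
        (Submodule.smul_mem _ _ (Submodule.subset_span ⟨-k, rfl⟩))
    | zero =>
      intro z
      have : (fun x : Vec d => (z * (0 : C(UnitAddTorus (Fin d), ℂ)) (q x)).re) = 0 := by
        ext x; simp
      rw [this]; exact Submodule.zero_mem _
    | add p1 p2 _ _ h1 h2 =>
      intro z
      have : (fun x : Vec d => (z * (p1 + p2) (q x)).re) =
          (fun x : Vec d => (z * p1 (q x)).re) + fun x : Vec d => (z * p2 (q x)).re := by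
        ext x; simp [mul_add]
      rw [this]; exact Submodule.add_mem _ (h1 z) (h2 z)
    | smul a p _ h =>
      intro z
      have : (fun x : Vec d => (z * (a • p) (q x)).re) =
          (fun x : Vec d => (z * a * p (q x)).re) := by
        ext x; simp [mul_assoc]
      rw [this]; exact h (z * a)
  refine ⟨_, hspan 1, fun x => ?_⟩
  have h1 := (ContinuousMap.dist_apply_le_dist (f := f) (g := p) (q x)).trans_lt hpd
  have h2 : f (q x) = (g x : ℂ) := by
    have := hcomp (fun i => x i / L)
    simp only [div_mul_cancel₀ _ hL.ne'] at this
    exact congrArg Complex.ofReal this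
  rw [h2, dist_eq_norm] at h1
  refine lt_of_le_of_lt ?_ h1
  have := Complex.abs_re_le_norm ((g x : ℂ) - p (q x))
  simpa using this

end Completeness

/-! ### Summability of the inverse squared weights in dimension at most three. -/

section Summability

variable {d : ℕ} {L : ℝ}

/-- Away from k = 0 the terms are dominated by a multiple of |k|^{-4}, which is summable over a
lattice of rank d < 4. Both H² ⊂ C⁰ and H¹ ⊂ L⁴ rest on this. -/
lemma summable_wt_inv_sq (hd : d ≤ 3) (hL : 0 < L) :
    Summable fun k : Fin d → ℤ => ((wt L k) ^ 2)⁻¹ := by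
  let b := (EuclideanSpace.basisFun (Fin d) ℝ).toBasis
  let Λ : Submodule ℤ (Vec d) := Submodule.span ℤ (Set.range b)
  have hrank : Module.finrank ℤ Λ = d := by
    rw [ZLattice.rank ℝ Λ, finrank_euclideanSpace_fin]
  have hsum := ZLattice.summable_norm_rpow Λ (-4) (by
    rw [hrank]
    have : (d : ℝ) ≤ 3 := by exact_mod_cast hd
    linarith)
  let e : (Fin d → ℤ) → Λ := fun k => ⟨∑ i, k i • b i,
    Submodule.sum_mem _ fun i _ => Submodule.smul_mem _ _ (Submodule.subset_span ⟨i, rfl⟩)⟩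
  have he : ∀ k i, (e k : Vec d) i = k i := by
    intro k i
    simp [e, b, Finset.sum_apply, Pi.single_apply]
  have hinj : Function.Injective e := by
    intro k l h
    funext i
    have h1 := he k i
    rw [h, he l i] at h1
    exact Int.cast_injective (α := ℝ) h1.symm
  have hs := hsum.comp_injective hinj
  have hω : 0 < 2 * Real.pi / L := by positivity
  refine Summable.of_norm_bounded_eventually (hs.mul_left ((2 * Real.pi / L) ^ 4)⁻¹) ?_
  have hfin : ({0} : Set (Fin d → ℤ))ᶜ ∈ Filter.cofinite := (Set.finite_singleton 0).compl_mem_cofinite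
  filter_upwards [hfin] with k hk
  have hn : (e k : Vec d) ≠ 0 := by
    intro h
    refine hk (funext fun i => ?_)
    have h1 := he k i
    rw [h] at h1
    simpa using h1.symm
  have hn' : 0 < ‖e k‖ := norm_pos_iff.2 fun h => hn (congrArg Subtype.val h)
  have hlam : lam L k = (2 * Real.pi / L) ^ 2 * ‖e k‖ ^ 2 := by
    have : ‖e k‖ ^ 2 = ∑ i, (k i : ℝ) ^ 2 := by
      rw [Submodule.coe_norm, EuclideanSpace.real_norm_sq_eq]
      simp [he]
    rw [this, lam, Finset.mul_sum]
    exact Finset.sum_congr rfl fun i _ => by rw [freq, mul_pow]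
  rw [Real.norm_of_nonneg (by positivity)]
  simp only [Function.comp_apply]
  rw [show (-4 : ℝ) = -((4 : ℕ) : ℝ) by norm_num, Real.rpow_neg hn'.le, Real.rpow_natCast, ← mul_inv]
  gcongr
  have h0 := lam_nonneg (L := L) k
  calc (2 * Real.pi / L) ^ 4 * ‖e k‖ ^ 4 = lam L k ^ 2 := by rw [hlam]; ring
    _ ≤ wt L k ^ 2 := by
      unfold wt
      gcongr
      linarith

end Summability

/-! ### Square summable families, multipliers and tight operators. -/

section Coefficients

/-- Square summable families of Hartley coefficients. -/
abbrev Coef (d : ℕ) : Type := lp (fun _ : Fin d → ℤ => Vec d) 2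

variable {d : ℕ}

lemma two_toReal_pos : 0 < (2 : ENNReal).toReal := by norm_num

lemma two_ne_zero_ennreal : (2 : ENNReal) ≠ 0 := by norm_num

lemma holderConjugate_two : ((2 : ENNReal).toReal).HolderConjugate (2 : ENNReal).toReal := by
  simpa using Real.HolderConjugate.two_two

lemma hasSum_norm_sq (a : Coef d) : HasSum (fun k => ‖a k‖ ^ 2) (‖a‖ ^ 2) := by
  have h := lp.hasSum_norm two_toReal_pos a
  simpa using h

/-- The finitely supported family that agrees with `a` on `S`. -/
def trunc (S : Finset (Fin d → ℤ)) (a : Coef d) : Coef d := ∑ k ∈ S, lp.single 2 k (a k)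

lemma trunc_apply (S : Finset (Fin d → ℤ)) (a : Coef d) (k : Fin d → ℤ) :
    trunc S a k = if k ∈ S then a k else 0 := by
  rw [trunc, lp.coeFn_sum, Finset.sum_apply]
  simp only [lp.single_apply]
  rw [Finset.sum_pi_single]

lemma tendsto_trunc (a : Coef d) :
    Filter.Tendsto (fun S => trunc S a) Filter.atTop (nhds a) :=
  lp.hasSum_single (by norm_num) a

/-- Multiplication of the coefficients by a family bounded by one. -/
def mulC (m : (Fin d → ℤ) → ℝ) (hm : ∀ k, |m k| ≤ 1) : Coef d →L[ℝ] Coef d :=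
  LinearMap.mkContinuous
    { toFun := fun a => ⟨fun k => m k • a k, by
        refine memℓp_gen (((lp.memℓp a).summable two_toReal_pos).of_nonneg_of_le
          (fun k => by positivity) (fun k => ?_))
        gcongr
        rw [norm_smul]
        exact mul_le_of_le_one_left (norm_nonneg _) (hm k)⟩
      map_add' := fun a b => by ext k : 2; exact smul_add _ _ _
      map_smul' := fun c a => by ext k : 2; exact smul_comm (m k) c (a k) }
    1 (fun a => by
      rw [one_mul]
      refine lp.norm_mono two_ne_zero_ennreal fun k => ?_
      change ‖m k • a k‖ ≤ _
      rw [norm_smul]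
      exact mul_le_of_le_one_left (norm_nonneg _) (hm k))

lemma mulC_apply (m : (Fin d → ℤ) → ℝ) (hm : ∀ k, |m k| ≤ 1) (a : Coef d) (k : Fin d → ℤ) :
    mulC m hm a k = m k • a k := rfl

lemma mulC_trunc (m : (Fin d → ℤ) → ℝ) (hm : ∀ k, |m k| ≤ 1) (S : Finset (Fin d → ℤ))
    (a : Coef d) : mulC m hm (trunc S a) = trunc S (mulC m hm a) := by
  ext k : 2
  rw [mulC_apply, trunc_apply, trunc_apply, mulC_apply]
  split_ifs <;> simp

/-- An operator is tight when it is small on families that vanish on a large finite set. -/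
def IsTight {Z : Type*} [NormedAddCommGroup Z] [NormedSpace ℝ Z] (T : Coef d →L[ℝ] Z) : Prop :=
  ∀ ε > 0, ∃ S : Finset (Fin d → ℤ), ∀ a : Coef d, (∀ k ∈ S, a k = 0) → ‖T a‖ ≤ ε * ‖a‖

variable {Z : Type*} [NormedAddCommGroup Z] [NormedSpace ℝ Z]

lemma sub_trunc_apply_eq_zero (S : Finset (Fin d → ℤ)) (a : Coef d) :
    ∀ k ∈ S, (a - trunc S a) k = 0 := by
  intro k hk
  rw [lp.coeFn_sub, Pi.sub_apply, trunc_apply, if_pos hk, sub_self]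

/-- Tight operators turn bounded coordinatewise convergence into norm convergence. -/
lemma IsTight.tendsto {T : Coef d →L[ℝ] Z} (hT : IsTight T) {a : ℕ → Coef d} {b : Coef d} {M : ℝ}
    (hM : ∀ n, ‖a n‖ ≤ M) (hab : ∀ k, Filter.Tendsto (fun n => a n k) Filter.atTop (nhds (b k))) :
    Filter.Tendsto (fun n => T (a n)) Filter.atTop (nhds (T b)) := by
  have hM0 : 0 ≤ M := (norm_nonneg _).trans (hM 0)
  rw [Metric.tendsto_atTop]
  intro ε hε
  set M' := M + ‖b‖ + 1
  have hM' : 0 < M' := by positivity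
  -- Split a n - b at S. The part on S tends to zero, a finite sum of convergent coordinates; the
  -- tail has norm at most M' eventually and contributes at most ε/4.
  obtain ⟨S, hS⟩ := hT (ε / (4 * M')) (by positivity)
  have htr : Filter.Tendsto (fun n => trunc S (a n - b)) Filter.atTop (nhds 0) := by
    have : (0 : Coef d) = ∑ k ∈ S, lp.single 2 k (0 : Vec d) := by simp
    rw [this]
    refine tendsto_finsetSum _ fun k _ => ?_
    have h1 : Filter.Tendsto (fun n => (a n - b) k) Filter.atTop (nhds 0) := by
      simpa using (hab k).sub_const (b k)
    exact ((lp.isometry_single (E := fun _ => Vec d) (p := 2) k).continuous.tendsto 0).comp h1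
  have htr1 : Filter.Tendsto (fun n => ‖trunc S (a n - b)‖) Filter.atTop (nhds 0) := by
    simpa using htr.norm
  have htr2 : Filter.Tendsto (fun n => ‖T (trunc S (a n - b))‖) Filter.atTop (nhds 0) := by
    simpa using ((T.continuous.tendsto 0).comp htr).norm
  obtain ⟨N, hN⟩ := Filter.eventually_atTop.1
    ((htr1.eventually (gt_mem_nhds one_pos)).and (htr2.eventually (gt_mem_nhds (half_pos hε))))
  refine ⟨N, fun n hn => ?_⟩
  obtain ⟨h1, h2⟩ := hN n hn
  have h3 := hS _ (sub_trunc_apply_eq_zero S (a n - b))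
  have h4 : ‖a n - b - trunc S (a n - b)‖ ≤ M' := by
    calc _ ≤ ‖a n - b‖ + ‖trunc S (a n - b)‖ := norm_sub_le _ _
      _ ≤ (‖a n‖ + ‖b‖) + 1 := add_le_add (norm_sub_le _ _) h1.le
      _ ≤ M' := by simp only [M']; linarith [hM n]
  have h5 : ε / (4 * M') * ‖a n - b - trunc S (a n - b)‖ ≤ ε / 4 := by
    calc _ ≤ ε / (4 * M') * M' := by gcongr
      _ = ε / 4 := by field_simp
  rw [dist_eq_norm, ← map_sub]
  calc ‖T (a n - b)‖ = ‖T (trunc S (a n - b)) + T (a n - b - trunc S (a n - b))‖ := by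
        rw [← map_add]; congr 2; abel
    _ ≤ _ := norm_add_le _ _
    _ < ε := by linarith

lemma IsTight.of_norm_le {T : Coef d →L[ℝ] Z} {Y : Type*} [NormedAddCommGroup Y] [NormedSpace ℝ Y]
    {R : Coef d →L[ℝ] Y} (hR : IsTight R) {C : ℝ} (h : ∀ a, ‖T a‖ ≤ C * ‖R a‖) :
    IsTight T := by
  intro ε hε
  obtain ⟨S, hS⟩ := hR (ε / (|C| + 1)) (by positivity)
  refine ⟨S, fun a ha => (h a).trans ?_⟩
  calc C * ‖R a‖ ≤ |C| * (ε / (|C| + 1) * ‖a‖) := by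
        gcongr
        · exact le_abs_self C
        · exact hS a ha
    _ = |C| / (|C| + 1) * (ε * ‖a‖) := by ring
    _ ≤ 1 * (ε * ‖a‖) := by
        gcongr
        rw [div_le_one (by positivity)]
        linarith
    _ = _ := one_mul _

/-- On families vanishing on S the functional sees only the tail of z. With `IsTight.tendsto` this
says that bounded coordinatewise convergence is weak convergence. -/
lemma isTight_innerSL (z : Coef d) : IsTight (innerSL ℝ z) := by
  intro ε hε
  have h := (tendsto_trunc z).const_sub z
  rw [sub_self] at h
  obtain ⟨S, hS⟩ := Filter.eventually_atTop.1 (h.norm.eventually (gt_mem_nhds (by simpa using hε)))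
  refine ⟨S, fun a ha => ?_⟩
  have h0 : inner ℝ (trunc S z) a = 0 := by
    rw [lp.inner_eq_tsum]
    refine (tsum_congr fun k => ?_).trans tsum_zero
    rw [trunc_apply]
    split_ifs with hk
    · rw [ha k hk, inner_zero_right]
    · rw [inner_zero_left]
  have h1 : innerSL ℝ z a = inner ℝ (z - trunc S z) a := by
    rw [inner_sub_left, h0, sub_zero]; rfl
  rw [h1]
  exact (abs_real_inner_le_norm _ _).trans (by gcongr; exact (hS S le_rfl).le)

/-- Outside a finite set the multiplier is smaller than ε. -/
lemma isTight_mulC {m : (Fin d → ℤ) → ℝ} {hm : ∀ k, |m k| ≤ 1}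
    (h0 : Filter.Tendsto m Filter.cofinite (nhds 0)) : IsTight (mulC m hm) := by
  intro ε hε
  have h1 : ∀ᶠ k in Filter.cofinite, |m k| < ε := by
    have := h0.norm.eventually (gt_mem_nhds (by simpa using hε : ‖(0 : ℝ)‖ < ε))
    simpa using this
  refine ⟨(Filter.eventually_cofinite.1 h1).toFinset, fun a ha => ?_⟩
  rw [← Real.norm_of_nonneg hε.le, ← norm_smul]
  refine lp.norm_mono two_ne_zero_ennreal fun k => ?_
  rw [mulC_apply, lp.coeFn_smul, Pi.smul_apply]
  by_cases hk : |m k| < ε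
  · rw [norm_smul, norm_smul, Real.norm_of_nonneg hε.le]
    gcongr
    exact hk.le
  · rw [ha k (by simpa using hk)]
    simp

end Coefficients

/-! ### Hartley series in L². -/

section Series

variable {d : ℕ} (L : ℝ)

/-- The field `x ↦ har k x • a`. -/
def harB (k : Fin d → ℤ) : Vec d →L[ℝ] BoundedContinuousFunction (Vec d) (Vec d) :=
  LinearMap.mkContinuous
    { toFun := fun a => BoundedContinuousFunction.ofNormedAddCommGroup (fun x => har L k x • a)
        ((continuous_har k).smul continuous_const) (harBound d L * ‖a‖) (fun x => by
          rw [norm_smul]; gcongr; exact abs_har_le k x)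
      map_add' := fun a b => by ext x : 1; simp
      map_smul' := fun c a => by ext x : 1; exact smul_comm _ _ _ }
    (harBound d L) (fun a => by
      refine (BoundedContinuousFunction.norm_le (mul_nonneg harBound_nonneg (norm_nonneg _))).2
        fun x => ?_
      change ‖har L k x • a‖ ≤ _
      rw [norm_smul]; gcongr; exact abs_har_le k x)

lemma harB_apply (k : Fin d → ℤ) (a : Vec d) (x : Vec d) : harB L k a x = har L k x • a := rfl

lemma norm_harB_le (k : Fin d → ℤ) (a : Vec d) : ‖harB L k a‖ ≤ harBound d L * ‖a‖ :=
  (harB L k).le_of_opNorm_le (LinearMap.mkContinuous_norm_le _ harBound_nonneg _) a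

/-- The class in `L²(𝕋^d)` of a bounded continuous field. -/
def toL2 : BoundedContinuousFunction (Vec d) (Vec d) →L[ℝ] L2 d L :=
  BoundedContinuousFunction.toLp 2 (torusMeasure d L) ℝ

variable {L}

lemma coeFn_toL2 (u : BoundedContinuousFunction (Vec d) (Vec d)) :
    toL2 L u =ᵐ[torusMeasure d L] u :=
  BoundedContinuousFunction.coeFn_toLp 2 (torusMeasure d L) ℝ u

lemma inner_eq_integral {y z : L2 d L} {φ ψ : Vec d → Vec d} (hy : y =ᵐ[torusMeasure d L] φ)
    (hz : z =ᵐ[torusMeasure d L] ψ) :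
    inner ℝ y z = ∫ x, inner ℝ (φ x) (ψ x) ∂torusMeasure d L := by
  rw [MeasureTheory.L2.inner_def]
  refine integral_congr_ae ?_
  filter_upwards [hy, hz] with x h1 h2
  rw [h1, h2]

lemma inner_toL2 (u v : BoundedContinuousFunction (Vec d) (Vec d)) :
    inner ℝ (toL2 L u) (toL2 L v) = ∫ x, inner ℝ (u x) (v x) ∂torusMeasure d L :=
  inner_eq_integral (coeFn_toL2 u) (coeFn_toL2 v)

variable [hL : Fact (0 < L)]

lemma inner_toL2_harB (k l : Fin d → ℤ) (a b : Vec d) :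
    inner ℝ (toL2 L (harB L k a)) (toL2 L (harB L l b)) = if k = l then inner ℝ a b else 0 := by
  rw [inner_toL2]
  simp only [harB_apply, real_inner_smul_left, real_inner_smul_right]
  simp_rw [← mul_assoc]
  rw [integral_mul_const]
  simp_rw [mul_comm (har L l _)]
  rw [integral_har_mul_har hL.out]
  split_ifs <;> simp

variable (L)

/-- The isometric embedding `a ↦ har k • a` into `L²`. -/
def harIso (k : Fin d → ℤ) : Vec d →ₗᵢ[ℝ] L2 d L where
  toLinearMap := (toL2 L ∘L harB L k : Vec d →L[ℝ] L2 d L)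
  norm_map' := fun a => by
    have h := inner_toL2_harB (L := L) k k a a
    rw [if_pos rfl, real_inner_self_eq_norm_sq, real_inner_self_eq_norm_sq] at h
    exact (sq_eq_sq₀ (norm_nonneg _) (norm_nonneg _)).1 h

lemma inner_harIso (k l : Fin d → ℤ) (a b : Vec d) :
    inner ℝ (harIso L k a) (harIso L l b) = if k = l then inner ℝ a b else 0 :=
  inner_toL2_harB k l a b

lemma orthogonalFamily_harIso :
    OrthogonalFamily ℝ (fun _ : Fin d → ℤ => Vec d) (fun k => harIso L k) := by
  intro k l hkl a b
  rw [inner_harIso, if_neg hkl]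

lemma orthogonalFamily_harIso_neg :
    OrthogonalFamily ℝ (fun _ : Fin d → ℤ => Vec d) (fun k => harIso L (-k)) := by
  intro k l hkl a b
  rw [inner_harIso, if_neg (fun h => hkl (neg_injective h))]

/-- The Hartley series with given coefficients. -/
def ser : Coef d →ₗᵢ[ℝ] L2 d L := (orthogonalFamily_harIso (d := d) L).linearIsometry

/-- The Hartley series with reflected coefficients. -/
def serNeg : Coef d →ₗᵢ[ℝ] L2 d L := (orthogonalFamily_harIso_neg (d := d) L).linearIsometry

lemma ser_single (k : Fin d → ℤ) (v : Vec d) : ser L (lp.single 2 k v) = harIso L k v :=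
  (orthogonalFamily_harIso (d := d) L).linearIsometry_apply_single v

lemma serNeg_single (k : Fin d → ℤ) (v : Vec d) : serNeg L (lp.single 2 k v) = harIso L (-k) v :=
  (orthogonalFamily_harIso_neg (d := d) L).linearIsometry_apply_single v

lemma inner_harIso_ser (k : Fin d → ℤ) (v : Vec d) (a : Coef d) :
    inner ℝ (harIso L k v) (ser L a) = inner ℝ v (a k) := by
  rw [← ser_single, LinearIsometry.inner_map_map, lp.inner_single_left]

lemma inner_harIso_serNeg (k : Fin d → ℤ) (v : Vec d) (a : Coef d) :
    inner ℝ (harIso L k v) (serNeg L a) = inner ℝ v (a (-k)) := by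
  have : harIso L k v = serNeg L (lp.single 2 (-k) v) := by rw [serNeg_single, neg_neg]
  rw [this, LinearIsometry.inner_map_map, lp.inner_single_left]

lemma ser_trunc (S : Finset (Fin d → ℤ)) (a : Coef d) :
    ser L (trunc S a) = ∑ k ∈ S, harIso L k (a k) := by
  rw [trunc, map_sum]
  exact Finset.sum_congr rfl fun k _ => ser_single L k _

lemma serNeg_trunc (S : Finset (Fin d → ℤ)) (a : Coef d) :
    serNeg L (trunc S a) = ∑ k ∈ S, harIso L (-k) (a k) := by
  rw [trunc, map_sum]
  exact Finset.sum_congr rfl fun k _ => serNeg_single L k _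

/-- The closed subspace of all Hartley series. -/
def serRange : Submodule ℝ (L2 d L) := LinearMap.range (ser (d := d) L).toLinearMap

lemma isClosed_serRange : IsClosed (serRange (d := d) L : Set (L2 d L)) :=
  (ser (d := d) L).isometry.isClosedEmbedding.isClosed_range

lemma harIso_mem_serRange (k : Fin d → ℤ) (v : Vec d) : harIso L k v ∈ serRange (d := d) L :=
  ⟨lp.single 2 k v, ser_single L k v⟩

lemma ser_mem_serRange (a : Coef d) : ser L a ∈ serRange (d := d) L := ⟨a, rfl⟩

lemma serNeg_mem_serRange (a : Coef d) : serNeg L a ∈ serRange (d := d) L := by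
  have h := ((serNeg (d := d) L).continuous.tendsto a).comp (tendsto_trunc a)
  refine (isClosed_serRange L).mem_of_tendsto h (Filter.Eventually.of_forall fun S => ?_)
  simp only [Function.comp_apply, serNeg_trunc]
  exact Submodule.sum_mem _ fun k _ => harIso_mem_serRange L _ _

variable {L}

lemma eq_of_mem_serRange {y z : L2 d L} (hy : y ∈ serRange (d := d) L)
    (hz : z ∈ serRange (d := d) L)
    (h : ∀ (k : Fin d → ℤ) (v : Vec d), inner ℝ (harIso L k v) y = inner ℝ (harIso L k v) z) :
    y = z := by
  obtain ⟨a, rfl⟩ := hy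
  obtain ⟨b, rfl⟩ := hz
  change ser L a = ser L b
  congr 1
  ext k : 2
  refine ext_inner_left ℝ fun v => ?_
  have := h k v
  change inner ℝ _ (ser L a) = inner ℝ _ (ser L b) at this
  rwa [inner_harIso_ser, inner_harIso_ser] at this

/-- The class of a continuous periodic field is the sum of its Hartley series. -/
lemma mem_serRange_of_isPeriodic {φ : Vec d → Vec d} (hφ : Continuous φ) (pφ : IsPeriodic L φ)
    {y : L2 d L} (hy : y =ᵐ[torusMeasure d L] φ) : y ∈ serRange (d := d) L := by
  have hspan : ∀ (j : Fin d), ∀ p ∈ Submodule.span ℝ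
      (Set.range (har L : (Fin d → ℤ) → Vec d → ℝ)),
      ∃ z ∈ serRange (d := d) L, z =ᵐ[torusMeasure d L] fun x => p x • EuclideanSpace.single j 1 := by
    intro j p hp
    induction hp using Submodule.span_induction with
    | mem p h =>
      obtain ⟨k, rfl⟩ := h
      exact ⟨_, harIso_mem_serRange L k (EuclideanSpace.single j 1), coeFn_toL2 _⟩
    | zero =>
      refine ⟨0, Submodule.zero_mem _, ?_⟩
      filter_upwards [Lp.coeFn_zero (E := Vec d) (p := 2) (μ := torusMeasure d L)] with x hx
      rw [hx]; simp
    | add p q _ _ h1 h2 =>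
      obtain ⟨z1, m1, e1⟩ := h1
      obtain ⟨z2, m2, e2⟩ := h2
      refine ⟨z1 + z2, Submodule.add_mem _ m1 m2, ?_⟩
      filter_upwards [Lp.coeFn_add z1 z2, e1, e2] with x hx h1 h2
      rw [hx, Pi.add_apply, h1, h2, Pi.add_apply, add_smul]
    | smul c p _ h =>
      obtain ⟨z, m, e⟩ := h
      refine ⟨c • z, Submodule.smul_mem _ _ m, ?_⟩
      filter_upwards [Lp.coeFn_smul c z, e] with x hx h1
      rw [hx, Pi.smul_apply, h1, Pi.smul_apply, smul_smul, smul_eq_mul]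
  rw [← SetLike.mem_coe, ← (isClosed_serRange (d := d) L).closure_eq]
  refine Metric.mem_closure_iff.2 fun ε hε => ?_
  set M : ℝ := (measureUnivNNReal (torusMeasure d L) : ℝ) ^ (2 : ENNReal).toReal⁻¹ with hM
  have hM0 : 0 ≤ M := by positivity
  -- With M the square root of the total mass, approximating each of the d components uniformly
  -- within δ costs at most M d δ < ε in L².
  set δ := ε / ((M + 1) * (d + 1)) with hδ
  have hδ0 : 0 < δ := by positivity
  have hcomp : ∀ j : Fin d, ∃ p : Vec d → ℝ, (∃ z ∈ serRange (d := d) L,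
      z =ᵐ[torusMeasure d L] fun x => p x • EuclideanSpace.single j 1) ∧
      ∀ x, |φ x j - p x| < δ := by
    intro j
    obtain ⟨p, hp, hd⟩ := exists_mem_span_har_norm_sub_lt hL.out
      (g := fun x => φ x j) (by fun_prop) (fun x i => by simp only [pφ x i]) hδ0
    exact ⟨p, hspan j p hp, hd⟩
  choose p hp hd using hcomp
  choose z hzm hz using hp
  refine ⟨∑ j, z j, Submodule.sum_mem _ fun j _ => hzm j, ?_⟩
  have hsum : (∑ j, z j : L2 d L) =ᵐ[torusMeasure d L]
      fun x => ∑ j, p j x • EuclideanSpace.single j 1 := by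
    have h1 : ∀ᵐ x ∂torusMeasure d L, ∀ j, z j x = p j x • EuclideanSpace.single j 1 :=
      ae_all_iff.2 hz
    filter_upwards [Lp.coeFn_finsetSum Finset.univ z, h1] with x hx h2
    rw [hx]
    simp [h2]
  rw [dist_eq_norm]
  have hb : ‖y - ∑ j, z j‖ ≤ M * (d * δ) := by
    refine Lp.norm_le_of_ae_bound (by positivity) ?_
    filter_upwards [Lp.coeFn_sub y (∑ j, z j), hy, hsum] with x h1 h2 h3
    rw [h1, Pi.sub_apply, h2, h3]
    have h4 : φ x - ∑ j, p j x • EuclideanSpace.single j 1 =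
        ∑ j, (φ x j - p j x) • (EuclideanSpace.single j 1 : Vec d) := by
      simp_rw [sub_smul]
      rw [Finset.sum_sub_distrib]
      congr 1
      ext i
      simp [Finset.sum_apply, Pi.single_apply]
    rw [h4]
    calc _ ≤ ∑ j, ‖(φ x j - p j x) • (EuclideanSpace.single j 1 : Vec d)‖ := norm_sum_le _ _
      _ ≤ ∑ _j : Fin d, δ := by
          refine Finset.sum_le_sum fun j _ => ?_
          rw [norm_smul]
          simpa using (hd j x).le
      _ = d * δ := by simp
  refine hb.trans_lt ?_
  have e : M * (d * δ) = ε * ((M / (M + 1)) * (d / (d + 1))) := by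
    rw [hδ]; field_simp
  rw [e]
  have h1 : M / (M + 1) < 1 := by rw [div_lt_one (by positivity)]; linarith
  have h2 : (d : ℝ) / (d + 1) ≤ 1 := by rw [div_le_one (by positivity)]; linarith
  have h3 : (M / (M + 1)) * (d / (d + 1)) < 1 := by
    calc _ ≤ (M / (M + 1)) * 1 := by gcongr
      _ < 1 := by linarith
  nlinarith

end Series

/-! ### Fields in H² encoded by square summable families. -/

section Sobolev

variable {d : ℕ} (L : ℝ)

lemma abs_div_wt_le_one {t : ℝ} {k : Fin d → ℤ} (h : |t| ≤ wt L k) : |t / wt L k| ≤ 1 := by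
  rw [abs_div, abs_of_pos (wt_pos k), div_le_one (wt_pos k)]
  exact h

/-- The coefficients of the field that corresponds to `a`, a family normalized in `H²`. -/
def coefField : Coef d →L[ℝ] Coef d :=
  mulC (fun k => 1 / wt L k) fun k => abs_div_wt_le_one L (by simpa using one_le_wt k)

/-- The coefficients of the partial derivatives. -/
def coefGrad (i : Fin d) : Coef d →L[ℝ] Coef d :=
  mulC (fun k => freq L k i / wt L k) fun k => abs_div_wt_le_one L (abs_freq_le_wt k i)

/-- The coefficients of the second derivatives, up to the sign. -/
def coefHess (i j : Fin d) : Coef d →L[ℝ] Coef d :=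
  mulC (fun k => freq L k i * freq L k j / wt L k) fun k => abs_div_wt_le_one L (by
    rw [abs_mul]
    have h1 := freq_sq_le_wt (L := L) k i
    have h2 := freq_sq_le_wt (L := L) k j
    nlinarith [sq_nonneg (|freq L k i| - |freq L k j|), sq_abs (freq L k i), sq_abs (freq L k j)])

/-- The coefficients of `-Δ`. -/
def coefLap : Coef d →L[ℝ] Coef d :=
  mulC (fun k => lam L k / wt L k) fun k => abs_div_wt_le_one L (by
    rw [abs_of_nonneg (lam_nonneg k)]; unfold wt; linarith)

lemma coefField_apply (a : Coef d) (k : Fin d → ℤ) : coefField L a k = (1 / wt L k) • a k := rfl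
lemma coefGrad_apply (i : Fin d) (a : Coef d) (k : Fin d → ℤ) :
    coefGrad L i a k = (freq L k i / wt L k) • a k := rfl
lemma coefHess_apply (i j : Fin d) (a : Coef d) (k : Fin d → ℤ) :
    coefHess L i j a k = (freq L k i * freq L k j / wt L k) • a k := rfl
lemma coefLap_apply (a : Coef d) (k : Fin d → ℤ) :
    coefLap L a k = (lam L k / wt L k) • a k := rfl

/-- Because the weight is 1 + λ, the family a consists of the coefficients of y - Δy. -/
lemma coefField_add_coefLap (a : Coef d) : coefField L a + coefLap L a = a := by
  ext k : 2
  rw [lp.coeFn_add, Pi.add_apply, coefField_apply, coefLap_apply, ← add_smul]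
  have : 1 / wt L k + lam L k / wt L k = 1 := by
    rw [← add_div, div_eq_one_iff_eq (wt_pos k).ne']; rfl
  rw [this, one_smul]

lemma sum_coefHess (a : Coef d) : ∑ i, coefHess L i i a = coefLap L a := by
  ext k : 2
  rw [lp.coeFn_sum, Finset.sum_apply, coefLap_apply, lam, Finset.sum_div, Finset.sum_smul]
  refine Finset.sum_congr rfl fun i _ => ?_
  rw [coefHess_apply, sq]

/-- Parseval form of ⟨-Δy, y⟩ = ‖∇y‖²; both sides have the multiplier λ/wt². -/
lemma inner_coefLap_coefField (a : Coef d) :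
    inner ℝ (coefLap L a) (coefField L a) = ∑ i, ‖coefGrad L i a‖ ^ 2 := by
  have h1 := lp.hasSum_inner (𝕜 := ℝ) (coefLap L a) (coefField L a)
  have h2 : HasSum (fun k => ∑ i, ‖coefGrad L i a k‖ ^ 2) (∑ i, ‖coefGrad L i a‖ ^ 2) :=
    hasSum_sum fun i _ => hasSum_norm_sq (coefGrad L i a)
  have e : (fun k => inner ℝ (coefLap L a k) (coefField L a k)) =
      fun k => ∑ i, ‖coefGrad L i a k‖ ^ 2 := ?_
  · rw [e] at h1
    exact h1.unique h2
  ext k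
  rw [coefLap_apply, coefField_apply, real_inner_smul_left, real_inner_smul_right,
    real_inner_self_eq_norm_sq]
  simp_rw [coefGrad_apply, norm_smul, mul_pow, Real.norm_eq_abs, sq_abs, div_pow]
  rw [← Finset.sum_mul, ← Finset.sum_div, lam]
  field_simp

variable [hL : Fact (0 < L)]

/-- The field in `L²` that corresponds to the family `a`. -/
def fieldL2 : Coef d →L[ℝ] L2 d L := (ser L).toContinuousLinearMap ∘L coefField L

/-- Its partial derivatives. -/
def gradL2 (i : Fin d) : Coef d →L[ℝ] L2 d L := (serNeg L).toContinuousLinearMap ∘L coefGrad L i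

/-- Its second derivatives. -/
def hessL2 (i j : Fin d) : Coef d →L[ℝ] L2 d L :=
  -((ser L).toContinuousLinearMap ∘L coefHess L i j)

lemma fieldL2_apply (a : Coef d) : fieldL2 L a = ser L (coefField L a) := rfl
lemma gradL2_apply (i : Fin d) (a : Coef d) : gradL2 L i a = serNeg L (coefGrad L i a) := rfl
lemma hessL2_apply (i j : Fin d) (a : Coef d) :
    hessL2 L i j a = -ser L (coefHess L i j a) := rfl

lemma sum_hessL2 (a : Coef d) : ∑ i, hessL2 L i i a = -ser L (coefLap L a) := by
  simp_rw [hessL2_apply]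
  rw [Finset.sum_neg_distrib, ← map_sum, sum_coefHess]

lemma fieldL2_sub_sum_hessL2 (a : Coef d) : fieldL2 L a - ∑ i, hessL2 L i i a = ser L a := by
  rw [sum_hessL2, sub_neg_eq_add, fieldL2_apply, ← map_add, coefField_add_coefLap]

lemma norm_le_fieldL2_add (a : Coef d) : ‖a‖ ≤ ‖fieldL2 L a‖ + ‖∑ i, hessL2 L i i a‖ := by
  rw [← (ser L).norm_map a, ← fieldL2_sub_sum_hessL2]
  exact norm_sub_le _ _

lemma inner_sum_hessL2_fieldL2 (a : Coef d) :
    inner ℝ (∑ i, hessL2 L i i a) (fieldL2 L a) = -∑ i, ‖gradL2 L i a‖ ^ 2 := by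
  rw [sum_hessL2, inner_neg_left, fieldL2_apply, LinearIsometry.inner_map_map,
    inner_coefLap_coefField]
  simp_rw [gradL2_apply, LinearIsometry.norm_map]

section Analysis

/-- A finite sum of Hartley functions with vector coefficients. -/
def trigB (S : Finset (Fin d → ℤ)) (m : (Fin d → ℤ) → (Fin d → ℤ)) (c : (Fin d → ℤ) → Vec d) :
    BoundedContinuousFunction (Vec d) (Vec d) := ∑ k ∈ S, harB L (m k) (c k)

variable {L}

lemma trigB_apply (S : Finset (Fin d → ℤ)) (m : (Fin d → ℤ) → (Fin d → ℤ))
    (c : (Fin d → ℤ) → Vec d) (x : Vec d) :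
    trigB L S m c x = ∑ k ∈ S, har L (m k) x • c k := by
  simp [trigB, harB_apply]

lemma toL2_trigB (S : Finset (Fin d → ℤ)) (m : (Fin d → ℤ) → (Fin d → ℤ))
    (c : (Fin d → ℤ) → Vec d) : toL2 L (trigB L S m c) = ∑ k ∈ S, harIso L (m k) (c k) := by
  rw [trigB, map_sum]
  rfl

lemma contDiff_trigB (S : Finset (Fin d → ℤ)) (m : (Fin d → ℤ) → (Fin d → ℤ))
    (c : (Fin d → ℤ) → Vec d) : ContDiff ℝ ∞ (trigB L S m c) := by
  have : (trigB L S m c : Vec d → Vec d) = fun x => ∑ k ∈ S, har L (m k) x • c k :=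
    funext (trigB_apply S m c)
  rw [this]
  exact ContDiff.sum fun k _ => (contDiff_har _).smul contDiff_const

lemma isPeriodic_trigB (S : Finset (Fin d → ℤ)) (m : (Fin d → ℤ) → (Fin d → ℤ))
    (c : (Fin d → ℤ) → Vec d) : IsPeriodic L (trigB L S m c) := by
  intro x i
  simp only [trigB_apply]
  simp_rw [isPeriodic_har hL.out _ x i]

lemma trigB_mem_smoothPeriodic (S : Finset (Fin d → ℤ)) (m : (Fin d → ℤ) → (Fin d → ℤ))
    (c : (Fin d → ℤ) → Vec d) : (trigB L S m c : Vec d → Vec d) ∈ SmoothPeriodic d L :=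
  ⟨contDiff_trigB S m c, isPeriodic_trigB S m c⟩

lemma partialDeriv_trigB (S : Finset (Fin d → ℤ)) (m : (Fin d → ℤ) → (Fin d → ℤ))
    (c : (Fin d → ℤ) → Vec d) (i : Fin d) : partialDeriv i (trigB L S m c) =
      trigB L S (fun k => -m k) (fun k => freq L (m k) i • c k) := by
  have : (trigB L S m c : Vec d → Vec d) = fun x => ∑ k ∈ S, har L (m k) x • c k :=
    funext (trigB_apply S m c)
  ext1 x
  rw [trigB_apply, partialDeriv, this]
  have h : HasFDerivAt (fun x => ∑ k ∈ S, har L (m k) x • c k)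
      (∑ k ∈ S, (har L (-m k) x • phase L (m k)).smulRight (c k)) x :=
    HasFDerivAt.fun_sum fun k _ => (hasFDerivAt_har (m k) x).smul_const (c k)
  rw [h.fderiv, sum_apply]
  refine Finset.sum_congr rfl fun k _ => ?_
  simp [phase_single, mul_smul]

lemma partialDeriv_har_smul (k : Fin d → ℤ) (v : Vec d) (i : Fin d) (x : Vec d) :
    partialDeriv i (fun x => har L k x • v) x = har L (-k) x • (freq L k i • v) := by
  rw [partialDeriv, ((hasFDerivAt_har k x).smul_const v).fderiv]
  simp [phase_single, mul_smul]

lemma fieldL2_trunc (S : Finset (Fin d → ℤ)) (a : Coef d) :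
    fieldL2 L (trunc S a) = toL2 L (trigB L S id (coefField L a)) := by
  rw [fieldL2_apply, coefField, mulC_trunc, ser_trunc, toL2_trigB]
  rfl

lemma gradL2_trunc (S : Finset (Fin d → ℤ)) (a : Coef d) (i : Fin d) :
    gradL2 L i (trunc S a) =ᵐ[torusMeasure d L]
      partialDeriv i (trigB L S id (coefField L a)) := by
  rw [partialDeriv_trigB]
  have : gradL2 L i (trunc S a) = toL2 L (trigB L S (fun k => -id k)
      (fun k => freq L (id k) i • coefField L a k)) := by
    rw [gradL2_apply, coefGrad, mulC_trunc, serNeg_trunc, toL2_trigB]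
    refine Finset.sum_congr rfl fun k _ => ?_
    simp only [mulC_apply, coefField_apply, smul_smul, id, mul_one_div]
  rw [this]
  exact coeFn_toL2 _

lemma hessL2_trunc (S : Finset (Fin d → ℤ)) (a : Coef d) (i j : Fin d) :
    hessL2 L i j (trunc S a) =ᵐ[torusMeasure d L]
      partialDeriv j (partialDeriv i (trigB L S id (coefField L a))) := by
  rw [partialDeriv_trigB, partialDeriv_trigB]
  have : hessL2 L i j (trunc S a) = toL2 L (trigB L S (fun k => - -id k)
      (fun k => freq L (-id k) j • freq L (id k) i • coefField L a k)) := by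
    rw [hessL2_apply, coefHess, mulC_trunc, ser_trunc, toL2_trigB, ← Finset.sum_neg_distrib]
    refine Finset.sum_congr rfl fun k _ => ?_
    simp only [mulC_apply, coefField_apply, smul_smul, id, neg_neg, freq_neg, ← map_neg]
    congr 1
    rw [← neg_smul]
    congr 1
    ring
  rw [this]
  exact coeFn_toL2 _

/-- Every family `a` defines a field in the space `H²`. -/
lemma hasH2Derivs_fieldL2 (a : Coef d) :
    HasH2Derivs (fieldL2 L a) (fun i => gradL2 L i a) (fun i j => hessL2 L i j a) := by
  have h := tendsto_trunc a
  have hT : Filter.Tendsto (fun S => (fieldL2 L (trunc S a), (fun i => gradL2 L i (trunc S a)),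
      fun i j => hessL2 L i j (trunc S a))) Filter.atTop
      (nhds (fieldL2 L a, (fun i => gradL2 L i a), fun i j => hessL2 L i j a)) := by
    have hc : Continuous fun a : Coef d => (fieldL2 L a, (fun i => gradL2 L i a),
        fun i j => hessL2 L i j a) := by fun_prop
    exact (hc.tendsto a).comp h
  refine mem_closure_of_tendsto hT (Filter.Eventually.of_forall fun S => ?_)
  refine ⟨trigB L S id (coefField L a), trigB_mem_smoothPeriodic _ _ _, ?_, ?_, ?_⟩
  · change (fieldL2 L (trunc S a) : Vec d → Vec d) =ᵐ[_] _
    rw [fieldL2_trunc]; exact coeFn_toL2 _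
  · exact fun i => gradL2_trunc S a i
  · exact fun i j => hessL2_trunc S a i j

/-- Integration by parts moves the derivative to the Hartley function, turning index k into -k. -/
lemma inner_harIso_of_partialDeriv {φ : Vec d → Vec d} (hφ : ContDiff ℝ 1 φ)
    (pφ : IsPeriodic L φ) {y g : L2 d L} (hy : y =ᵐ[torusMeasure d L] φ) {i : Fin d}
    (hg : g =ᵐ[torusMeasure d L] partialDeriv i φ) (k : Fin d → ℤ) (v : Vec d) :
    inner ℝ (harIso L k v) g = -(freq L k i * inner ℝ (harIso L (-k) v) y) := by
  have h1 : (harIso L k v : L2 d L) =ᵐ[torusMeasure d L] fun x => har L k x • v := coeFn_toL2 _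
  have h2 : (harIso L (-k) v : L2 d L) =ᵐ[torusMeasure d L] fun x => har L (-k) x • v :=
    coeFn_toL2 _
  rw [inner_eq_integral h1 hg, inner_eq_integral h2 hy]
  have hψ : ContDiff ℝ 1 fun x => har L k x • v :=
    ((contDiff_har k).of_le (by norm_cast)).smul contDiff_const
  have pψ : IsPeriodic L fun x => har L k x • v := fun x i => by
    simp only [isPeriodic_har hL.out k x i]
  have h := integral_inner_partialDeriv hL.out hψ hφ pψ pφ i
  simp_rw [partialDeriv_har_smul, smul_comm _ (freq L k i)] at h
  have h' : ∫ x, inner ℝ (freq L k i • har L (-k) x • v) (φ x) ∂torusMeasure d L =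
      freq L k i * ∫ x, inner ℝ (har L (-k) x • v) (φ x) ∂torusMeasure d L := by
    rw [← integral_const_mul]
    simp_rw [real_inner_smul_left]
  linarith

end Analysis

end Sobolev

/-! ### Every element of H² comes from such a family. -/

section SobolevChar

variable {d : ℕ} {L : ℝ} [hL : Fact (0 < L)]

variable (L) in
/-- The Hartley coefficients of a field in `L²`. -/
def analysis : L2 d L →L[ℝ] Coef d := ContinuousLinearMap.adjoint (ser L).toContinuousLinearMap

lemma inner_analysis (k : Fin d → ℤ) (v : Vec d) (y : L2 d L) :
    inner ℝ v (analysis L y k) = inner ℝ (harIso L k v) y := by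
  refine (lp.inner_single_left (𝕜 := ℝ) k v (analysis L y)).symm.trans ?_
  rw [analysis, ContinuousLinearMap.adjoint_inner_right]
  change inner ℝ (ser L (lp.single 2 k v)) y = _
  rw [ser_single]

/-- All the fields are sums of their Hartley series, so comparing coefficients is enough;
integration by parts expresses every coefficient through those of y, and the family of y - Δy
multiplies these by wt. -/
lemma eq_fieldL2_of_smoothPeriodic {φ : Vec d → Vec d} (hφ : φ ∈ SmoothPeriodic d L)
    {y : L2 d L} {G : Fin d → L2 d L} {D : Fin d → Fin d → L2 d L}
    (hy : y =ᵐ[torusMeasure d L] φ) (hG : ∀ i, G i =ᵐ[torusMeasure d L] partialDeriv i φ)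
    (hD : ∀ i j, D i j =ᵐ[torusMeasure d L] partialDeriv j (partialDeriv i φ)) :
    y = fieldL2 L (analysis L (y - ∑ i, D i i)) ∧
      (∀ i, G i = gradL2 L i (analysis L (y - ∑ i, D i i))) ∧
      ∀ i j, D i j = hessL2 L i j (analysis L (y - ∑ i, D i i)) := by
  obtain ⟨hs, hp⟩ := hφ
  have pφ : IsPeriodic L φ := hp
  have hs1 : ∀ i, ContDiff ℝ ∞ (partialDeriv i φ) := fun i =>
    (hs.fderiv_right (m := ∞) (by norm_cast)).clm_apply contDiff_const
  have hs2 : ∀ i j, ContDiff ℝ ∞ (partialDeriv j (partialDeriv i φ)) := fun i j =>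
    ((hs1 i).fderiv_right (m := ∞) (by norm_cast)).clm_apply contDiff_const
  have one_le : (1 : WithTop ℕ∞) ≤ ∞ := by norm_cast
  have my : y ∈ serRange (d := d) L := mem_serRange_of_isPeriodic hs.continuous pφ hy
  have mG : ∀ i, G i ∈ serRange (d := d) L := fun i =>
    mem_serRange_of_isPeriodic (hs1 i).continuous (pφ.partialDeriv i) (hG i)
  have mD : ∀ i j, D i j ∈ serRange (d := d) L := fun i j =>
    mem_serRange_of_isPeriodic (hs2 i j).continuous ((pφ.partialDeriv i).partialDeriv j) (hD i j)
  have cG : ∀ i k v, inner ℝ (harIso L k v) (G i) =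
      -(freq L k i * inner ℝ (harIso L (-k) v) y) := fun i k v =>
    inner_harIso_of_partialDeriv (hs.of_le one_le) pφ hy (hG i) k v
  have cD : ∀ i j k v, inner ℝ (harIso L k v) (D i j) =
      -(freq L k i * freq L k j * inner ℝ (harIso L k v) y) := by
    intro i j k v
    rw [inner_harIso_of_partialDeriv ((hs1 i).of_le one_le) (pφ.partialDeriv i) (hG i) (hD i j) k v,
      cG, freq_neg, neg_neg]
    ring
  set a := analysis L (y - ∑ i, D i i)
  have ca : ∀ k v, inner ℝ v (a k) = wt L k * inner ℝ (harIso L k v) y := by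
    intro k v
    rw [inner_analysis, inner_sub_right, inner_sum]
    simp_rw [cD]
    rw [Finset.sum_neg_distrib, ← Finset.sum_mul, wt, lam]
    simp_rw [sq]
    ring
  refine ⟨eq_of_mem_serRange my (ser_mem_serRange L _) fun k v => ?_, fun i =>
    eq_of_mem_serRange (mG i) (serNeg_mem_serRange L _) fun k v => ?_, fun i j =>
    eq_of_mem_serRange (mD i j) (Submodule.neg_mem _ (ser_mem_serRange L _)) fun k v => ?_⟩
  · change _ = inner ℝ _ (ser L (coefField L a))
    rw [inner_harIso_ser, coefField_apply, real_inner_smul_right, ca, ← mul_assoc,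
      one_div_mul_cancel (wt_pos k).ne', one_mul]
  · change _ = inner ℝ _ (serNeg L (coefGrad L i a))
    rw [inner_harIso_serNeg, coefGrad_apply, real_inner_smul_right, ca, cG, ← mul_assoc,
      div_mul_cancel₀ _ (wt_pos _).ne', freq_neg, neg_mul]
  · change _ = inner ℝ _ (-ser L (coefHess L i j a))
    rw [inner_neg_right, inner_harIso_ser, coefHess_apply, real_inner_smul_right, ca, cD,
      ← mul_assoc, div_mul_cancel₀ _ (wt_pos _).ne']

/-- Fields in `H²` are described by square summable families. -/
lemma HasH2Derivs.exists_coef {y : L2 d L} {G : Fin d → L2 d L} {D : Fin d → Fin d → L2 d L}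
    (h : HasH2Derivs y G D) : ∃ a : Coef d, y = fieldL2 L a ∧ (∀ i, G i = gradL2 L i a) ∧
      ∀ i j, D i j = hessL2 L i j a := by
  -- The family depends continuously on the triple, so the representation is a closed condition and
  -- passes from smooth fields to their closure.
  let A : L2 d L × (Fin d → L2 d L) × (Fin d → Fin d → L2 d L) → Coef d :=
    fun p => analysis L (p.1 - ∑ i, p.2.2 i i)
  have hA : Continuous A := by fun_prop
  have hcl : IsClosed {p : L2 d L × (Fin d → L2 d L) × (Fin d → Fin d → L2 d L) |
      p.1 = fieldL2 L (A p) ∧ (∀ i, p.2.1 i = gradL2 L i (A p)) ∧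
        ∀ i j, p.2.2 i j = hessL2 L i j (A p)} := by
    simp only [Set.ofPred_and, Set.ofPred_forall]
    refine IsClosed.inter ?_ (IsClosed.inter (isClosed_iInter fun i => ?_)
      (isClosed_iInter fun i => isClosed_iInter fun j => ?_)) <;>
    exact isClosed_eq (by fun_prop) (by fun_prop)
  have hmem := closure_minimal (t := _) ?_ hcl h
  · exact ⟨_, hmem⟩
  · rintro ⟨y, G, D⟩ ⟨φ, hφ, h1, h2, h3⟩
    exact eq_fieldL2_of_smoothPeriodic hφ h1 h2 h3

end SobolevChar

/-! ### Solenoidal fields, ℍ and the Leray projection. -/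

section DivFree

variable {d : ℕ} {L : ℝ} [hL : Fact (0 < L)]

variable (L) in
/-- The frequency vector. -/
def freqVec (k : Fin d → ℤ) : Vec d := WithLp.toLp 2 (freq L k)

/-- The coefficients of a divergence free field. -/
def IsSolenoidal (L : ℝ) (a : Coef d) : Prop := ∀ k, inner ℝ (freqVec L k) (a k) = 0

lemma IsSolenoidal.sub {a b : Coef d} (ha : IsSolenoidal L a) (hb : IsSolenoidal L b) :
    IsSolenoidal L (a - b) := by
  intro k
  rw [lp.coeFn_sub, Pi.sub_apply, inner_sub_right, ha, hb, sub_zero]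

lemma trigB_mem_divFree {S : Finset (Fin d → ℤ)} {c : (Fin d → ℤ) → Vec d}
    (hc : ∀ k, inner ℝ (freqVec L k) (c k) = 0) :
    (trigB L S id c : Vec d → Vec d) ∈ DivFree d L := by
  refine ⟨trigB_mem_smoothPeriodic S id c, fun x => ?_⟩
  rw [divergence]
  simp_rw [partialDeriv_trigB, trigB_apply]
  have h : ∀ i, (∑ k ∈ S, har L (-id k) x • freq L (id k) i • c k) i =
      ∑ k ∈ S, har L (-k) x * (freq L k i * c k i) := by
    intro i
    simp [Finset.sum_apply]
  simp_rw [h]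
  rw [Finset.sum_comm]
  refine Finset.sum_eq_zero fun k _ => ?_
  rw [← Finset.mul_sum]
  have := hc k
  rw [PiLp.inner_apply] at this
  simp only [freqVec, RCLike.inner_apply, conj_trivial] at this
  rw [Finset.sum_congr rfl fun i _ => mul_comm _ _, this, mul_zero]

lemma IsSolenoidal.coefField {a : Coef d} (ha : IsSolenoidal L a) (k : Fin d → ℤ) :
    inner ℝ (freqVec L k) (coefField L a k) = 0 := by
  rw [coefField_apply, real_inner_smul_right, ha, mul_zero]

lemma IsSolenoidal.fieldL2_mem_spaceV {a : Coef d} (ha : IsSolenoidal L a) :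
    fieldL2 L a ∈ SpaceV d L := by
  refine ⟨fun i => gradL2 L i a, ?_⟩
  have hT : Filter.Tendsto (fun S => (fieldL2 L (CBFeD.trunc S a),
      (fun i => gradL2 L i (CBFeD.trunc S a)))) Filter.atTop
      (nhds (fieldL2 L a, (fun i => gradL2 L i a))) := by
    have hc : Continuous fun a : Coef d => (fieldL2 L a, (fun i => gradL2 L i a)) := by fun_prop
    exact (hc.tendsto a).comp (tendsto_trunc a)
  refine mem_closure_of_tendsto hT (Filter.Eventually.of_forall fun S => ?_)
  refine ⟨trigB L S id (CBFeD.coefField L a), trigB_mem_divFree ha.coefField, ?_,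
    fun i => gradL2_trunc S a i⟩
  change (fieldL2 L (CBFeD.trunc S a) : Vec d → Vec d) =ᵐ[_] _
  rw [fieldL2_trunc]; exact coeFn_toL2 _

lemma spaceV_subset_spaceH {y : L2 d L} (hy : y ∈ SpaceV d L) : y ∈ SpaceH d L := by
  obtain ⟨G, hG⟩ := hy
  have h1 := map_mem_closure (t := {u : L2 d L | ∃ φ ∈ DivFree d L, u =ᵐ[torusMeasure d L] φ})
    continuous_fst hG (by
      rintro ⟨u, H⟩ ⟨φ, hφ, h1, _⟩
      exact ⟨φ, hφ, h1⟩)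
  exact closure_mono Submodule.subset_span h1

lemma IsSolenoidal.fieldL2_mem_spaceH {a : Coef d} (ha : IsSolenoidal L a) :
    fieldL2 L a ∈ SpaceH d L := spaceV_subset_spaceH ha.fieldL2_mem_spaceV

/-- The test field is minus the gradient of the Hartley function of index -k, so integration by
parts produces the divergence of φ. -/
lemma inner_freqVec_of_mem_divFree {φ : Vec d → Vec d} (hφ : φ ∈ DivFree d L) {y : L2 d L}
    (hy : y =ᵐ[torusMeasure d L] φ) (k : Fin d → ℤ) :
    inner ℝ (harIso L k (freqVec L k)) y = 0 := by
  obtain ⟨⟨hs, hp⟩, hdiv⟩ := hφ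
  have h1 : (harIso L k (freqVec L k) : L2 d L) =ᵐ[torusMeasure d L]
      fun x => har L k x • freqVec L k := coeFn_toL2 _
  rw [inner_eq_integral h1 hy]
  have hψ : ∀ i : Fin d, ContDiff ℝ 1 fun x => har L (-k) x • (EuclideanSpace.single i 1 : Vec d) :=
    fun i => ((contDiff_har (-k)).of_le (by norm_cast)).smul contDiff_const
  have pψ : ∀ i : Fin d, IsPeriodic L fun x => har L (-k) x • (EuclideanSpace.single i 1 : Vec d) :=
    fun i x j => by simp only [isPeriodic_har hL.out (-k) x j]
  have hφ1 : ContDiff ℝ 1 φ := hs.of_le (by norm_cast)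
  have h2 := fun i => integral_inner_partialDeriv hL.out (hψ i) hφ1 (pψ i) hp i
  have hc : ∀ i, Continuous (partialDeriv i φ) := fun i =>
    (hφ1.continuous_fderiv one_ne_zero).clm_apply continuous_const
  have e1 : ∀ i, ∀ x, inner ℝ (partialDeriv i (fun x => har L (-k) x •
      (EuclideanSpace.single i 1 : Vec d)) x) (φ x) = -(har L k x * (freq L k i * φ x i)) := by
    intro i x
    rw [partialDeriv_har_smul, neg_neg, freq_neg, real_inner_smul_left, real_inner_smul_left,
      EuclideanSpace.inner_single_left]
    simp
  have e2 : ∀ i, ∀ x, inner ℝ (har L (-k) x • (EuclideanSpace.single i 1 : Vec d))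
      (partialDeriv i φ x) = har L (-k) x * partialDeriv i φ x i := by
    intro i x
    rw [real_inner_smul_left, EuclideanSpace.inner_single_left]
    simp
  simp_rw [e1, e2] at h2
  have h3 := Finset.sum_congr (rfl : (Finset.univ : Finset (Fin d)) = _) fun i _ => h2 i
  rw [← integral_finsetSum, Finset.sum_neg_distrib, ← integral_finsetSum] at h3
  · simp_rw [← Finset.mul_sum] at h3
    have h4 : ∀ x, ∑ i, partialDeriv i φ x i = 0 := hdiv
    simp_rw [h4] at h3
    simp only [mul_zero, integral_zero, neg_zero, Finset.sum_neg_distrib] at h3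
    rw [integral_neg, neg_eq_zero] at h3
    rw [← h3]
    congr 1
    ext x
    rw [real_inner_smul_left, PiLp.inner_apply, Finset.mul_sum]
    refine Finset.sum_congr rfl fun i _ => ?_
    simp only [freqVec, RCLike.inner_apply, conj_trivial]
    ring
  · exact fun i _ => Continuous.integrable_torus
      ((continuous_har (-k)).mul ((EuclideanSpace.proj i).continuous.comp (hc i)))
  · exact fun i _ => Continuous.integrable_torus
      ((continuous_har k).mul (continuous_const.mul
        ((EuclideanSpace.proj i).continuous.comp hs.continuous))).neg

/-- The conditions define a closed subspace that contains the classes of all fields in 𝒱. -/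
lemma mem_spaceH_imp {y : L2 d L} (hy : y ∈ SpaceH d L) :
    y ∈ serRange (d := d) L ∧ ∀ k, inner ℝ (harIso L k (freqVec L k)) y = 0 := by
  let W : Submodule ℝ (L2 d L) :=
    serRange (d := d) L ⊓ ⨅ k, (innerSL ℝ (harIso L k (freqVec L k))).ker
  have hW : IsClosed (W : Set (L2 d L)) := by
    simp only [W, Submodule.coe_inf, Submodule.coe_iInf]
    exact (isClosed_serRange L).inter (isClosed_iInter fun k =>
      (innerSL ℝ (harIso L k (freqVec L k))).isClosed_ker)
  have hle : SpaceH d L ≤ W := by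
    refine Submodule.topologicalClosure_minimal _ (Submodule.span_le.2 ?_) hW
    rintro u ⟨φ, hφ, hu⟩
    refine ⟨mem_serRange_of_isPeriodic hφ.1.1.continuous hφ.1.2 hu, ?_⟩
    simp only [SetLike.mem_coe, Submodule.mem_iInf]
    exact fun k => inner_freqVec_of_mem_divFree hφ hu k
  obtain ⟨h1, h2⟩ := hle hy
  refine ⟨h1, fun k => ?_⟩
  simp only [SetLike.mem_coe, Submodule.mem_iInf] at h2
  exact h2 k

lemma isSolenoidal_of_fieldL2_mem_spaceH {a : Coef d} (h : fieldL2 L a ∈ SpaceH d L) :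
    IsSolenoidal L a := by
  intro k
  have h1 := (mem_spaceH_imp h).2 k
  rw [fieldL2_apply, inner_harIso_ser, coefField_apply, real_inner_smul_right] at h1
  exact (mul_eq_zero.1 h1).resolve_left (one_div_ne_zero (wt_pos k).ne')

/-- A field of `ℍ` that is orthogonal to all solenoidal trigonometric polynomials vanishes. -/
lemma eq_zero_of_mem_spaceH {z : L2 d L} (hz : z ∈ SpaceH d L)
    (h : ∀ a : Coef d, IsSolenoidal L a → (∃ S, trunc S a = a) → inner ℝ z (fieldL2 L a) = 0) :
    z = 0 := by
  obtain ⟨⟨c, rfl⟩, h2⟩ := mem_spaceH_imp hz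
  change ser L c = 0
  have hc : c = 0 := by
    ext k : 2
    have h3 := h2 k
    change inner ℝ _ (ser L c) = 0 at h3
    rw [inner_harIso_ser] at h3
    -- The single mode k of z is itself an admissible test field, and testing with it returns a
    -- positive multiple of |c k|².
    have hsol : IsSolenoidal L (lp.single 2 k (c k) : Coef d) := by
      intro l
      rw [lp.single_apply]
      by_cases hl : l = k
      · subst hl; rw [Pi.single_eq_same]; exact h3
      · rw [Pi.single_eq_of_ne hl, inner_zero_right]
    have h4 := h _ hsol ⟨{k}, by
      simp [trunc]⟩
    have h5 : coefField L (lp.single 2 k (c k) : Coef d) = lp.single 2 k ((1 / wt L k) • c k) := by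
      ext l : 2
      rw [coefField_apply, lp.single_apply, lp.single_apply]
      by_cases hl : l = k
      · subst hl; simp
      · simp [Pi.single_eq_of_ne hl]
    rw [fieldL2_apply] at h4
    change inner ℝ (ser L c) _ = 0 at h4
    rw [LinearIsometry.inner_map_map, h5, lp.inner_single_right, real_inner_smul_right,
      real_inner_self_eq_norm_sq] at h4
    have h6 := (mul_eq_zero.1 h4).resolve_left (one_div_ne_zero (wt_pos k).ne')
    simpa using h6
  rw [hc, map_zero]

/-- Against elements of ℍ the projection can be omitted; this is how the equation is reduced to the
unprojected residual. -/
lemma inner_leray {y z : L2 d L} (hz : z ∈ SpaceH d L) :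
    inner ℝ (leray d L y) z = inner ℝ y z := by
  rw [leray, Submodule.inner_starProjection_left_eq_right,
    Submodule.starProjection_eq_self_iff.2 hz]

lemma leray_mem (y : L2 d L) : leray d L y ∈ SpaceH d L :=
  Submodule.starProjection_apply_mem _ _

end DivFree

/-! ### The compact embedding of H² into the continuous fields. -/

section UniformField

variable {d : ℕ} (L : ℝ) [hL : Fact (0 < L)] [hd : Fact (d ≤ 3)]

/-- The square summable family of inverse weights. -/
def winv (d : ℕ) (L : ℝ) [hL : Fact (0 < L)] [hd : Fact (d ≤ 3)] :
    lp (fun _ : Fin d → ℤ => ℝ) 2 :=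
  ⟨fun k => (wt L k)⁻¹, memℓp_gen (by simpa using summable_wt_inv_sq hd.out hL.out)⟩

/-- Cauchy-Schwarz against the inverse weights. Since v need only agree with them on the support of
a, the full family of inverse weights gives boundedness and its tails give tightness. -/
lemma summable_coefField_of {v : lp (fun _ : Fin d → ℤ => ℝ) 2} {a : Coef d}
    (h : ∀ k, a k ≠ 0 → v k = (wt L k)⁻¹) :
    (Summable fun k => ‖harB L k (coefField L a k)‖) ∧
      ∑' k, ‖harB L k (coefField L a k)‖ ≤ harBound d L * (‖v‖ * ‖a‖) := by
  have h0 := lp.tsum_mul_le_mul_norm holderConjugate_two v (lp.toNorm a)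
  have hn : ∀ k, ‖lp.toNorm a k‖ = ‖a k‖ := fun k => norm_norm (a k)
  simp_rw [hn] at h0
  rw [lp.norm_toNorm] at h0
  obtain ⟨h1, h2⟩ := h0
  have hle : ∀ k, ‖harB L k (coefField L a k)‖ ≤ harBound d L * (‖v k‖ * ‖a k‖) := by
    intro k
    refine (norm_harB_le L k _).trans (mul_le_mul_of_nonneg_left ?_ harBound_nonneg)
    rw [coefField_apply, norm_smul]
    by_cases hk : a k = 0
    · simp [hk]
    · rw [h k hk, one_div]
  have hs := (h1.mul_left (harBound d L)).of_nonneg_of_le (fun k => norm_nonneg _) hle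
  refine ⟨hs, (hs.tsum_le_tsum hle (h1.mul_left _)).trans ?_⟩
  rw [tsum_mul_left]
  exact mul_le_mul_of_nonneg_left h2 harBound_nonneg

lemma summable_harB_coefField (a : Coef d) : Summable fun k => harB L k (coefField L a k) :=
  (summable_coefField_of L (v := winv d L) (a := a) fun _ _ => rfl).1.of_norm

/-- The bounded continuous field that corresponds to the family `a`. -/
def field : Coef d →L[ℝ] BoundedContinuousFunction (Vec d) (Vec d) :=
  LinearMap.mkContinuous
    { toFun := fun a => ∑' k, harB L k (coefField L a k)
      map_add' := fun a b => by
        rw [← (summable_harB_coefField L a).tsum_add (summable_harB_coefField L b)]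
        refine tsum_congr fun k => ?_
        rw [← map_add, map_add (coefField L)]
        rfl
      map_smul' := fun c a => by
        rw [RingHom.id_apply, ← (summable_harB_coefField L a).tsum_const_smul c]
        refine tsum_congr fun k => ?_
        rw [← map_smul, map_smul (coefField L)]
        rfl }
    (harBound d L * ‖winv d L‖) (fun a => by
      have h := summable_coefField_of L (v := winv d L) (a := a) fun _ _ => rfl
      rw [mul_assoc]
      exact (norm_tsum_le_tsum_norm h.1).trans h.2)

lemma field_apply (a : Coef d) : field L a = ∑' k, harB L k (coefField L a k) := rfl

lemma field_trunc (S : Finset (Fin d → ℤ)) (a : Coef d) :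
    field L (trunc S a) = trigB L S id (coefField L a) := by
  rw [field_apply, tsum_eq_sum (s := S), trigB]
  · refine Finset.sum_congr rfl fun k hk => ?_
    rw [coefField_apply, trunc_apply, if_pos hk]
    rfl
  · intro k hk
    rw [coefField_apply, trunc_apply, if_neg hk, smul_zero, map_zero]

lemma toL2_field (a : Coef d) : toL2 L (field L a) = fieldL2 L a := by
  have h1 := ((toL2 L ∘L field L).continuous.tendsto a).comp (tendsto_trunc a)
  have h2 := ((fieldL2 L).continuous.tendsto a).comp (tendsto_trunc a)
  refine tendsto_nhds_unique h1 (h2.congr fun S => ?_)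
  simp only [Function.comp_apply, ContinuousLinearMap.comp_apply]
  rw [field_trunc, fieldL2_trunc]

lemma fieldL2_ae_eq (a : Coef d) : fieldL2 L a =ᵐ[torusMeasure d L] field L a := by
  rw [← toL2_field]; exact coeFn_toL2 _

lemma isTight_field : IsTight (field (d := d) L) := by
  intro ε hε
  have h0 : Filter.Tendsto (fun S => ∑ k ∈ S, lp.single 2 k (winv d L k)) Filter.atTop
      (nhds (winv d L)) := lp.hasSum_single (by norm_num) (winv d L)
  have h := h0.const_sub (winv d L)
  rw [sub_self] at h
  have hpos : ‖(0 : lp (fun _ : Fin d → ℤ => ℝ) 2)‖ < ε / (harBound d L + 1) := by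
    rw [norm_zero]
    have := harBound_nonneg (d := d) (L := L)
    positivity
  obtain ⟨S, hS⟩ := Filter.eventually_atTop.1 (h.norm.eventually_lt_const hpos)
  refine ⟨S, fun a ha => ?_⟩
  have h1 := summable_coefField_of L (a := a)
    (v := winv d L - ∑ k ∈ S, lp.single 2 k (winv d L k)) (by
      intro k hk
      have hkS : k ∉ S := fun hkS => hk (ha k hkS)
      rw [lp.coeFn_sub, Pi.sub_apply, lp.coeFn_sum, Finset.sum_apply]
      simp only [lp.single_apply]
      rw [Finset.sum_pi_single, if_neg hkS, sub_zero]
      rfl)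
  have hb := harBound_nonneg (d := d) (L := L)
  calc ‖field L a‖ ≤ _ := norm_tsum_le_tsum_norm h1.1
    _ ≤ _ := h1.2
    _ ≤ harBound d L * (ε / (harBound d L + 1) * ‖a‖) := by
        gcongr
        exact (hS S le_rfl).le
    _ = harBound d L / (harBound d L + 1) * (ε * ‖a‖) := by ring
    _ ≤ 1 * (ε * ‖a‖) := by
        gcongr
        rw [div_le_one (by positivity)]
        linarith
    _ = _ := one_mul _

lemma isTight_fieldL2 : IsTight (fieldL2 (d := d) L) :=
  (isTight_field L).of_norm_le (C := ‖toL2 (d := d) L‖) fun a => by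
    rw [← toL2_field]; exact (toL2 L).le_opNorm _

/-- The multiplier is at most wt^{-1/2}, written here as a double square root of wt^{-2}, and this
tends to zero by summability. -/
lemma isTight_gradL2 (i : Fin d) : IsTight (gradL2 L i) := by
  have h1 : Filter.Tendsto (fun k : Fin d → ℤ => ((wt L k) ^ 2)⁻¹) Filter.cofinite (nhds 0) :=
    (summable_wt_inv_sq hd.out hL.out).tendsto_cofinite_zero
  have h2 : Filter.Tendsto (fun k : Fin d → ℤ => √(√((wt L k) ^ 2)⁻¹)) Filter.cofinite
      (nhds 0) := by
    have h := (Real.continuous_sqrt.comp Real.continuous_sqrt).tendsto 0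
    simp only [Function.comp_apply, Real.sqrt_zero] at h
    exact h.comp h1
  have h3 : Filter.Tendsto (fun k : Fin d → ℤ => freq L k i / wt L k) Filter.cofinite
      (nhds 0) := by
    refine squeeze_zero_norm (fun k => ?_) h2
    have hw := wt_pos (L := L) k
    rw [← inv_pow, Real.sqrt_sq (by positivity), Real.norm_eq_abs]
    refine Real.abs_le_sqrt ?_
    rw [div_pow, div_le_iff₀ (by positivity), sq (wt L k), inv_mul_cancel_left₀ hw.ne']
    exact freq_sq_le_wt k i
  exact (isTight_mulC (hm := fun k => abs_div_wt_le_one L (abs_freq_le_wt k i)) h3).of_norm_le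
    (C := 1) fun a => by
      rw [one_mul, gradL2_apply, LinearIsometry.norm_map]; rfl

/-- A weak form of Agmon's inequality. -/
lemma exists_norm_field_le {ε : ℝ} (hε : 0 < ε) :
    ∃ C ≥ 0, ∀ a : Coef d, ‖field L a‖ ≤ ε * ‖a‖ + C * ‖fieldL2 L a‖ := by
  obtain ⟨S, hS⟩ := isTight_field (d := d) L ε hε
  set T : ℝ := ‖field (d := d) L‖
  set W : ℝ := ∑ k ∈ S, wt L k
  have hW0 : 0 ≤ W := Finset.sum_nonneg fun k _ => (wt_pos k).le
  refine ⟨T * W, by positivity, fun a => ?_⟩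
  -- On the finitely many modes in S every weight is at most W, so there the H² norm is controlled
  -- by the L² norm. The modes outside S are handled by tightness.
  have h1 : ‖trunc S a‖ ≤ W * ‖fieldL2 L a‖ := by
    rw [fieldL2_apply, LinearIsometry.norm_map, ← Real.norm_of_nonneg hW0, ← norm_smul]
    refine lp.norm_mono two_ne_zero_ennreal fun k => ?_
    rw [trunc_apply, lp.coeFn_smul, Pi.smul_apply, coefField_apply, smul_smul, mul_one_div]
    split_ifs with hk
    · rw [norm_smul, Real.norm_of_nonneg (div_nonneg hW0 (wt_pos k).le)]
      refine le_mul_of_one_le_left (norm_nonneg _) ?_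
      rw [one_le_div (wt_pos k)]
      exact Finset.single_le_sum (fun k _ => (wt_pos (L := L) k).le) hk
    · rw [norm_zero]; positivity
  have h2 : ‖a - trunc S a‖ ≤ ‖a‖ := by
    refine lp.norm_mono two_ne_zero_ennreal fun k => ?_
    rw [lp.coeFn_sub, Pi.sub_apply, trunc_apply]
    split_ifs <;> simp
  calc ‖field L a‖ = ‖field L (a - trunc S a) + field L (trunc S a)‖ := by
        rw [← map_add, sub_add_cancel]
    _ ≤ ‖field L (a - trunc S a)‖ + ‖field L (trunc S a)‖ := norm_add_le _ _
    _ ≤ ε * ‖a - trunc S a‖ + T * ‖trunc S a‖ :=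
        add_le_add (hS _ (sub_trunc_apply_eq_zero S a)) ((field L).le_opNorm _)
    _ ≤ ε * ‖a‖ + T * (W * ‖fieldL2 L a‖) := by gcongr
    _ = _ := by ring

end UniformField

/-! ### Continuity of the convection and composition operators. -/

section Nonlinear

variable {d : ℕ} (L : ℝ)

lemma norm_coord_smul_le (u : BoundedContinuousFunction (Vec d) (Vec d)) (i : Fin d) (x v : Vec d) :
    ‖u x i • v‖ ≤ ‖u‖ * ‖v‖ := by
  rw [norm_smul]
  gcongr
  exact (PiLp.norm_apply_le (u x) i).trans (u.norm_coe_le_norm x)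

lemma memLp_coord_smul (u : BoundedContinuousFunction (Vec d) (Vec d)) (i : Fin d) (g : L2 d L) :
    MemLp (fun x => u x i • g x) 2 (torusMeasure d L) := by
  refine (Lp.memLp g).of_le_mul (c := ‖u‖) ?_
    (Filter.Eventually.of_forall fun x => norm_coord_smul_le u i x (g x))
  exact (((EuclideanSpace.proj i).continuous.comp u.continuous).aestronglyMeasurable).smul
    (Lp.aestronglyMeasurable g)

/-- Multiplication of a field in `L²` by a component of a bounded continuous field. -/
def coordMul (i : Fin d) :
    BoundedContinuousFunction (Vec d) (Vec d) →L[ℝ] L2 d L →L[ℝ] L2 d L :=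
  LinearMap.mkContinuous₂
    (LinearMap.mk₂ ℝ (fun u g => (memLp_coord_smul L u i g).toLp _)
      (fun u v g => by
        rw [← MemLp.toLp_add]
        refine MemLp.toLp_congr _ _ (Filter.Eventually.of_forall fun x => ?_)
        simp [add_smul])
      (fun c u g => by
        rw [← MemLp.toLp_const_smul]
        refine MemLp.toLp_congr _ _ (Filter.Eventually.of_forall fun x => ?_)
        simp [mul_smul])
      (fun u g h => by
        rw [← MemLp.toLp_add]
        refine MemLp.toLp_congr _ _ ?_
        filter_upwards [Lp.coeFn_add g h] with x hx
        rw [Pi.add_apply, ← smul_add, ← Pi.add_apply, ← hx])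
      (fun c u g => by
        rw [← MemLp.toLp_const_smul]
        refine MemLp.toLp_congr _ _ ?_
        filter_upwards [Lp.coeFn_smul c g] with x hx
        rw [Pi.smul_apply, smul_comm, ← Pi.smul_apply c, ← hx]))
    1 (fun u g => by
      rw [one_mul]
      refine Lp.norm_le_mul_norm_of_ae_le_mul ?_
      filter_upwards [(memLp_coord_smul L u i g).coeFn_toLp] with x hx
      simp only [LinearMap.mk₂_apply]
      rw [hx]
      exact norm_coord_smul_le u i x (g x))

variable {L}

lemma coeFn_coordMul (i : Fin d) (u : BoundedContinuousFunction (Vec d) (Vec d)) (g : L2 d L) :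
    coordMul L i u g =ᵐ[torusMeasure d L] fun x => u x i • g x :=
  (memLp_coord_smul L u i g).coeFn_toLp

lemma norm_coordMul_le (i : Fin d) (u : BoundedContinuousFunction (Vec d) (Vec d)) (g : L2 d L) :
    ‖coordMul L i u g‖ ≤ ‖u‖ * ‖g‖ := by
  refine Lp.norm_le_mul_norm_of_ae_le_mul ?_
  filter_upwards [coeFn_coordMul i u g] with x hx
  rw [hx]
  exact norm_coord_smul_le u i x (g x)

lemma inner_coordMul (i : Fin d) (u : BoundedContinuousFunction (Vec d) (Vec d)) (g h : L2 d L) :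
    inner ℝ (coordMul L i u g) h = inner ℝ g (coordMul L i u h) := by
  rw [inner_eq_integral (coeFn_coordMul i u g) (Filter.EventuallyEq.refl _ h),
    inner_eq_integral (Filter.EventuallyEq.refl _ g) (coeFn_coordMul i u h)]
  simp_rw [real_inner_smul_left, real_inner_smul_right]

/-- The convective term `(u · ∇) y`, where `G i = ∂_i y`. -/
def convL2 (u : BoundedContinuousFunction (Vec d) (Vec d)) (G : Fin d → L2 d L) : L2 d L :=
  ∑ i, coordMul L i u (G i)

lemma convL2_ae_eq (u : BoundedContinuousFunction (Vec d) (Vec d)) (G : Fin d → L2 d L) :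
    convL2 u G =ᵐ[torusMeasure d L] fun x => ∑ i, u x i • G i x := by
  have h1 : ∀ᵐ x ∂torusMeasure d L, ∀ i, coordMul L i u (G i) x = u x i • G i x :=
    ae_all_iff.2 fun i => coeFn_coordMul i u (G i)
  filter_upwards [Lp.coeFn_finsetSum Finset.univ (fun i => coordMul L i u (G i)), h1] with x hx h2
  rw [convL2, hx, Finset.sum_apply]
  exact Finset.sum_congr rfl fun i _ => h2 i

lemma norm_convL2_le (u : BoundedContinuousFunction (Vec d) (Vec d)) (G : Fin d → L2 d L) :
    ‖convL2 u G‖ ≤ ‖u‖ * ∑ i, ‖G i‖ := by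
  rw [Finset.mul_sum]
  exact (norm_sum_le _ _).trans (Finset.sum_le_sum fun i _ => norm_coordMul_le i u (G i))

lemma continuous_convL2 : Continuous fun p : BoundedContinuousFunction (Vec d) (Vec d) ×
    (Fin d → L2 d L) => convL2 p.1 p.2 := by
  unfold convL2
  refine continuous_finsetSum _ fun i _ => ?_
  exact ((coordMul L i).continuous.comp continuous_fst).clm_apply
    ((continuous_apply i).comp continuous_snd)

/-- Composition of a bounded continuous field with a continuous map. -/
def compB {P : Vec d → Vec d} (hP : Continuous P)
    (u : BoundedContinuousFunction (Vec d) (Vec d)) :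
    BoundedContinuousFunction (Vec d) (Vec d) where
  toFun := fun x => P (u x)
  continuous_toFun := hP.comp u.continuous
  map_bounded' := by
    obtain ⟨C, hC⟩ := Metric.isBounded_iff.1
      ((isCompact_closedBall (0 : Vec d) ‖u‖).image hP).isBounded
    exact ⟨C, fun x y => hC ⟨u x, by simpa using u.norm_coe_le_norm x, rfl⟩
      ⟨u y, by simpa using u.norm_coe_le_norm y, rfl⟩⟩

/-- All fields within distance 1 of u take values in the ball of radius ‖u‖ + 1, on which P is
uniformly continuous. -/
lemma continuous_compB {P : Vec d → Vec d} (hP : Continuous P) : Continuous (compB hP) := by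
  refine Metric.continuous_iff.2 fun u ε hε => ?_
  have huc := (isCompact_closedBall (0 : Vec d) (‖u‖ + 1)).uniformContinuousOn_of_continuous
    hP.continuousOn
  obtain ⟨δ, hδ, h⟩ := Metric.uniformContinuousOn_iff.1 huc (ε / 2) (half_pos hε)
  refine ⟨min δ 1, by positivity, fun v hv => ?_⟩
  refine lt_of_le_of_lt ?_ (half_lt_self hε)
  refine (BoundedContinuousFunction.dist_le (half_pos hε).le).2 fun x => ?_
  have h1 : dist (v x) (u x) < min δ 1 := (BoundedContinuousFunction.dist_coe_le_dist x).trans_lt hv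
  have h2 : ‖u x‖ ≤ ‖u‖ := u.norm_coe_le_norm x
  have h3 : ‖v x‖ ≤ ‖u‖ + 1 := by
    have := norm_le_norm_add_norm_sub' (v x) (u x)
    rw [← dist_eq_norm] at this
    have := h1.trans_le (min_le_right _ _)
    linarith
  exact (h (v x) (by simpa using h3) (u x) (by simp; linarith)
    (h1.trans_le (min_le_left _ _))).le

end Nonlinear

/-! ### Energy identities for the nonlinear terms. -/

section Identities

variable {d : ℕ} {L : ℝ} [hL : Fact (0 < L)]

/-- The convective term is orthogonal to the transported field. -/
lemma integral_convection_eq_zero {u w : Vec d → Vec d} (hu : u ∈ DivFree d L)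
    (hw : w ∈ SmoothPeriodic d L) :
    ∫ x, inner ℝ (∑ i, u x i • partialDeriv i w x) (w x) ∂torusMeasure d L = 0 := by
  obtain ⟨⟨su, pu⟩, hdiv⟩ := hu
  obtain ⟨sw, pw⟩ := hw
  have hu1 : ContDiff ℝ 1 u := su.of_le (by norm_cast)
  have hw1 : ContDiff ℝ 1 w := sw.of_le (by norm_cast)
  have hui : ∀ i : Fin d, ContDiff ℝ 1 fun x => u x i := fun i =>
    (EuclideanSpace.proj (𝕜 := ℝ) i).contDiff.comp hu1
  have hcu : ∀ i, Continuous (partialDeriv i u) := fun i =>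
    (hu1.continuous_fderiv one_ne_zero).clm_apply continuous_const
  have hcw : ∀ i, Continuous (partialDeriv i w) := fun i =>
    (hw1.continuous_fderiv one_ne_zero).clm_apply continuous_const
  have h := fun i => integral_fderiv_single hL.out ((hui i).mul (hw1.inner ℝ hw1)) i
    (fun x => by simp only [pu x i, pw x i])
  -- Summed over i this is div(|w|²u) = 2 (u·∇)w·w + |w|² div u, whose left side integrates to zero.
  have e : ∀ i x, fderiv ℝ (fun x => u x i * inner ℝ (w x) (w x)) x (EuclideanSpace.single i 1) =
      2 * (u x i * inner ℝ (partialDeriv i w x) (w x)) +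
        partialDeriv i u x i * inner ℝ (w x) (w x) := by
    intro i x
    have d1 : HasFDerivAt (fun x => u x i) ((EuclideanSpace.proj i).comp (fderiv ℝ u x)) x :=
      (EuclideanSpace.proj (𝕜 := ℝ) i).hasFDerivAt.comp x
        (hu1.differentiable one_ne_zero).differentiableAt.hasFDerivAt
    have d2 := (hw1.differentiable one_ne_zero).differentiableAt.hasFDerivAt (x := x)
    have d3 : HasFDerivAt (fun x => u x i * inner ℝ (w x) (w x)) _ x := d1.mul (d2.inner ℝ d2)
    rw [d3.fderiv]
    simp only [partialDeriv, add_apply, smul_apply, ContinuousLinearMap.comp_apply,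
      fderivInnerCLM_apply, ContinuousLinearMap.prod_apply, smul_eq_mul]
    rw [real_inner_comm (fderiv ℝ w x _) (w x)]
    change _ + inner ℝ (w x) (w x) * (fderiv ℝ u x _) i = _
    ring
  simp_rw [e] at h
  have i1 : ∀ i, Integrable (fun x => 2 * (u x i * inner ℝ (partialDeriv i w x) (w x)))
      (torusMeasure d L) := fun i => Continuous.integrable_torus
    (continuous_const.mul ((hui i).continuous.mul ((hcw i).inner hw1.continuous)))
  have i2 : ∀ i, Integrable (fun x => partialDeriv i u x i * inner ℝ (w x) (w x))
      (torusMeasure d L) := fun i => Continuous.integrable_torus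
    ((((EuclideanSpace.proj (𝕜 := ℝ) i).continuous.comp (hcu i))).mul
      (hw1.continuous.inner hw1.continuous))
  have hs := Finset.sum_eq_zero fun i (_ : i ∈ (Finset.univ : Finset (Fin d))) => h i
  simp_rw [fun i => integral_add (i1 i) (i2 i)] at hs
  rw [Finset.sum_add_distrib, ← integral_finsetSum _ fun i _ => i1 i,
    ← integral_finsetSum _ fun i _ => i2 i] at hs
  have h2 : ∀ x, ∑ i, partialDeriv i u x i * inner ℝ (w x) (w x) = 0 := by
    intro x
    rw [← Finset.sum_mul]
    have : ∑ i, partialDeriv i u x i = 0 := hdiv x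
    rw [this, zero_mul]
  simp_rw [h2, ← Finset.mul_sum] at hs
  rw [integral_zero, add_zero, integral_const_mul] at hs
  have h3 := (mul_eq_zero.1 hs).resolve_left two_ne_zero
  rw [← h3]
  congr 1
  ext x
  rw [sum_inner]
  simp_rw [real_inner_smul_left]

variable [hd : Fact (d ≤ 3)]

/-- The expression is continuous in both families, so the smooth identity for truncations passes to
the limit. -/
lemma inner_convL2_field_eq_zero {a : Coef d} (ha : IsSolenoidal L a) (b : Coef d) :
    inner ℝ (convL2 (field L a) fun i => gradL2 L i b) (fieldL2 L b) = 0 := by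
  have hc : Continuous fun p : Coef d × Coef d =>
      inner ℝ (convL2 (field L p.1) fun i => gradL2 L i p.2) (fieldL2 L p.2) := by
    have : Continuous fun p : Coef d × Coef d => (field L p.1, fun i => gradL2 L i p.2) := by
      fun_prop
    exact (continuous_convL2.comp this).inner (by fun_prop)
  have h := (hc.tendsto (a, b)).comp ((tendsto_trunc a).prodMk_nhds (tendsto_trunc b))
  refine tendsto_nhds_unique h (tendsto_const_nhds.congr fun S => ?_)
  simp only [Function.comp_apply]
  have h1 : (convL2 (field L (trunc S a)) fun i => gradL2 L i (trunc S b)) =ᵐ[torusMeasure d L]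
      fun x => ∑ i, trigB L S id (coefField L a) x i •
        partialDeriv i (trigB L S id (coefField L b)) x := by
    have h2 : ∀ᵐ x ∂torusMeasure d L, ∀ i, gradL2 L i (trunc S b) x =
        partialDeriv i (trigB L S id (coefField L b)) x := ae_all_iff.2 fun i => gradL2_trunc S b i
    filter_upwards [convL2_ae_eq (field L (trunc S a)) fun i => gradL2 L i (trunc S b), h2]
      with x hx h3
    rw [hx, field_trunc]
    exact Finset.sum_congr rfl fun i _ => by rw [h3 i]
  have h2 : fieldL2 L (trunc S b) =ᵐ[torusMeasure d L] trigB L S id (coefField L b) := by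
    rw [fieldL2_trunc]; exact coeFn_toL2 _
  rw [inner_eq_integral h1 h2]
  exact (integral_convection_eq_zero (trigB_mem_divFree ha.coefField)
    (trigB_mem_smoothPeriodic S id _)).symm

variable {β γ r q : ℝ}

variable (L β γ) in
/-- The class in `L²` of the damping term of a bounded continuous field. -/
def dampL2 (hq : 1 ≤ q) (hqr : q < r) (u : BoundedContinuousFunction (Vec d) (Vec d)) : L2 d L :=
  toL2 L (compB (continuous_damp (β := β) (γ := γ) hq hqr) u)

lemma dampL2_ae_eq (hq : 1 ≤ q) (hqr : q < r) (u : BoundedContinuousFunction (Vec d) (Vec d)) :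
    dampL2 L β γ hq hqr u =ᵐ[torusMeasure d L] fun x => damp β γ r q (u x) :=
  coeFn_toL2 _

lemma continuous_dampL2 (hq : 1 ≤ q) (hqr : q < r) :
    Continuous (dampL2 (d := d) L β γ hq hqr) :=
  (toL2 L).continuous.comp (continuous_compB _)

lemma neg_K1_le_inner_dampL2 (hβ : 0 < β) (hq : 1 ≤ q) (hqr : q < r)
    (u : BoundedContinuousFunction (Vec d) (Vec d)) :
    -(K1 β γ r q * L ^ d) ≤ inner ℝ (dampL2 L β γ hq hqr u) (toL2 L u) := by
  rw [dampL2, inner_toL2]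
  have h : ∫ _x, -K1 β γ r q ∂torusMeasure d L = -(K1 β γ r q * L ^ d) := by
    rw [integral_const, measureReal_torus hL.out, smul_eq_mul]; ring
  rw [← h]
  refine integral_mono (integrable_const _) (Continuous.integrable_torus
    ((compB _ u).continuous.inner u.continuous)) fun x => ?_
  exact neg_K1_le_inner_damp hβ hq hqr (u x)

lemma neg_kappa_le_inner_dampL2_sub (hβ : 0 < β) (hq : 1 ≤ q) (hqr : q < r)
    (u v : BoundedContinuousFunction (Vec d) (Vec d)) :
    -(kappa β γ r q * ‖toL2 L (u - v)‖ ^ 2) ≤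
      inner ℝ (dampL2 L β γ hq hqr u - dampL2 L β γ hq hqr v) (toL2 L (u - v)) := by
  rw [dampL2, dampL2, ← map_sub, inner_toL2, ← real_inner_self_eq_norm_sq, inner_toL2,
    ← integral_const_mul, ← integral_neg]
  refine integral_mono (Continuous.integrable_torus ?_) (Continuous.integrable_torus ?_)
    fun x => ?_
  · exact (continuous_const.mul ((u - v).continuous.inner (u - v).continuous)).neg
  · exact (BoundedContinuousFunction.continuous _).inner (u - v).continuous
  · simp only [real_inner_self_eq_norm_sq]
    exact neg_kappa_le_inner_damp_sub hβ hq hqr (u x) (v x)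

/-- Integration by parts turns ∫ Q(y)·∂_i∂_i y into -∫ Q'(y)∂_i y·∂_i y, and Q' ≥ -κ. Truncated
fields are smooth and Q is C¹, so this is classical calculus. -/
lemma inner_dampL2_sum_hessL2_le (hβ : 0 < β) (hq : 1 ≤ q) (hqr : q < r)
    (S : Finset (Fin d → ℤ)) (a : Coef d) :
    inner ℝ (dampL2 L β γ hq hqr (field L (trunc S a))) (∑ i, hessL2 L i i (trunc S a)) ≤
      kappa β γ r q * ∑ i, ‖gradL2 L i (trunc S a)‖ ^ 2 := by
  rw [inner_sum, Finset.mul_sum]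
  refine Finset.sum_le_sum fun i _ => ?_
  set y := trigB L S id (coefField L a) with hy
  have sy : ContDiff ℝ ∞ y := contDiff_trigB S id _
  have py : IsPeriodic L y := isPeriodic_trigB S id _
  have sy1 : ContDiff ℝ 1 y := sy.of_le (by norm_cast)
  have sdy : ContDiff ℝ 1 (partialDeriv i y) :=
    ((sy.fderiv_right (m := ∞) (by norm_cast)).clm_apply contDiff_const).of_le (by norm_cast)
  have sQ : ContDiff ℝ 1 fun x => damp β γ r q (y x) := (contDiff_damp hq hqr).comp sy1
  have pQ : IsPeriodic L fun x => damp β γ r q (y x) := fun x j => by simp only [py x j]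
  have h1 := dampL2_ae_eq (L := L) (β := β) (γ := γ) hq hqr (field L (trunc S a))
  rw [field_trunc] at h1 ⊢
  have h3 := integral_inner_partialDeriv hL.out sQ sdy pQ (py.partialDeriv i) i
  have e : ∀ x, partialDeriv i (fun x => damp β γ r q (y x)) x =
      dampD β γ r q (y x) (partialDeriv i y x) := by
    intro x
    have h4 : HasFDerivAt (fun x => damp β γ r q (y x)) _ x :=
      (hasFDerivAt_damp hq hqr (y x)).comp x
        (sy1.differentiable one_ne_zero).differentiableAt.hasFDerivAt
    rw [partialDeriv, h4.fderiv]
    rfl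
  rw [inner_eq_integral h1 (hessL2_trunc S a i i), ← real_inner_self_eq_norm_sq,
    inner_eq_integral (gradL2_trunc S a i) (gradL2_trunc S a i)]
  have h4 : ∫ x, inner ℝ (damp β γ r q (y x)) (partialDeriv i (partialDeriv i y) x)
      ∂torusMeasure d L = -∫ x, inner ℝ (partialDeriv i (fun x => damp β γ r q (y x)) x)
        (partialDeriv i y x) ∂torusMeasure d L := by rw [h3, neg_neg]
  rw [h4, ← integral_neg, ← integral_const_mul]
  refine integral_mono (Continuous.integrable_torus ?_) (Continuous.integrable_torus ?_)
    fun x => ?_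
  · exact (((sQ.continuous_fderiv one_ne_zero).clm_apply continuous_const).inner
      sdy.continuous).neg
  · exact continuous_const.mul (sdy.continuous.inner sdy.continuous)
  · simp only
    rw [e, real_inner_self_eq_norm_sq]
    have := neg_kappa_le_inner_dampD (γ := γ) hβ hq hqr (y x) (partialDeriv i y x)
    linarith

end Identities

/-! ### The Sobolev inequality bounding L⁴ by H¹. -/

section Sobolev

/-- Schur test: A A' ≤ (A² W/W' + A'² W'/W)/2 for each pair with the same image under m, and the two
halves agree by symmetry. -/
lemma sum_sum_ite_mul_le {ι κ : Type*} [DecidableEq κ] (P : Finset ι) (m : ι → κ) (A W : ι → ℝ)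
    (hW : ∀ p, 0 < W p) {T : ℝ}
    (hT : ∀ p, ∑ p' ∈ P, (if m p = m p' then (W p')⁻¹ else 0) ≤ T) :
    ∑ p ∈ P, ∑ p' ∈ P, A p * A p' * (if m p = m p' then 1 else 0) ≤
      T * ∑ p ∈ P, A p ^ 2 * W p := by
  have h1 : ∀ p p', A p * A p' * (if m p = m p' then 1 else 0) ≤
      (1 / 2) * (A p ^ 2 * W p * (if m p = m p' then (W p')⁻¹ else 0)) +
      (1 / 2) * (A p' ^ 2 * W p' * (if m p' = m p then (W p)⁻¹ else 0)) := by
    intro p p'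
    by_cases h : m p = m p'
    · rw [if_pos h, if_pos h, if_pos h.symm]
      have hp := hW p
      have hp' := hW p'
      have : (1 / 2) * (A p ^ 2 * W p * (W p')⁻¹) + (1 / 2) * (A p' ^ 2 * W p' * (W p)⁻¹) -
          A p * A p' * 1 = (1 / 2) * ((A p * W p - A p' * W p') ^ 2 * ((W p)⁻¹ * (W p')⁻¹)) := by
        field_simp
        ring
      have h2 : 0 ≤ (1 / 2) * ((A p * W p - A p' * W p') ^ 2 * ((W p)⁻¹ * (W p')⁻¹)) := by
        positivity
      linarith
    · rw [if_neg h, if_neg h, if_neg (Ne.symm h)]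
      simp
  have h2 : ∑ p ∈ P, ∑ p' ∈ P, A p ^ 2 * W p * (if m p = m p' then (W p')⁻¹ else 0) ≤
      T * ∑ p ∈ P, A p ^ 2 * W p := by
    rw [Finset.mul_sum]
    refine Finset.sum_le_sum fun p _ => ?_
    rw [← Finset.mul_sum, mul_comm T]
    exact mul_le_mul_of_nonneg_left (hT p) (mul_nonneg (sq_nonneg _) (hW p).le)
  refine (Finset.sum_le_sum fun p _ => Finset.sum_le_sum fun p' _ => h1 p p').trans ?_
  have h3 : ∑ p ∈ P, ∑ p' ∈ P, A p' ^ 2 * W p' * (if m p' = m p then (W p)⁻¹ else 0) =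
      ∑ p ∈ P, ∑ p' ∈ P, A p ^ 2 * W p * (if m p = m p' then (W p')⁻¹ else 0) :=
    Finset.sum_comm
  have h4 : ∑ p ∈ P, ∑ p' ∈ P, ((1 / 2) * (A p ^ 2 * W p * (if m p = m p' then (W p')⁻¹ else 0)) +
      (1 / 2) * (A p' ^ 2 * W p' * (if m p' = m p then (W p)⁻¹ else 0))) =
      (1 / 2) * (∑ p ∈ P, ∑ p' ∈ P, A p ^ 2 * W p * (if m p = m p' then (W p')⁻¹ else 0)) +
      (1 / 2) * ∑ p ∈ P, ∑ p' ∈ P, A p' ^ 2 * W p' * (if m p' = m p then (W p)⁻¹ else 0) := by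
    simp only [Finset.sum_add_distrib, Finset.mul_sum]
  rw [h4, h3]
  linarith

variable {d : ℕ} {L : ℝ}

/-- Expand the square. As m may repeat frequencies, orthonormality leaves all the pairs with equal
frequency, which the Schur test controls. -/
lemma integral_sq_sum_har_le (hL : 0 < L) {ι : Type*} (P : Finset ι) (m : ι → Fin d → ℤ)
    (A W : ι → ℝ) (hW : ∀ p, 0 < W p) {T : ℝ}
    (hT : ∀ p, ∑ p' ∈ P, (if m p = m p' then (W p')⁻¹ else 0) ≤ T) :
    ∫ x, (∑ p ∈ P, A p * har L (m p) x) ^ 2 ∂torusMeasure d L ≤ T * ∑ p ∈ P, A p ^ 2 * W p := by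
  refine le_trans (le_of_eq ?_) (sum_sum_ite_mul_le P m A W hW hT)
  have h : ∀ x, (∑ p ∈ P, A p * har L (m p) x) ^ 2 =
      ∑ p ∈ P, ∑ p' ∈ P, A p * A p' * (har L (m p) x * har L (m p') x) := by
    intro x
    rw [sq, Finset.sum_mul_sum]
    exact Finset.sum_congr rfl fun p _ => Finset.sum_congr rfl fun p' _ => by ring
  have hi : ∀ p p', Integrable (fun x => A p * A p' * (har L (m p) x * har L (m p') x))
      (torusMeasure d L) := fun p p' => Continuous.integrable_torus
    (continuous_const.mul ((continuous_har _).mul (continuous_har _)))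
  simp_rw [h]
  rw [integral_finsetSum _ fun p _ => integrable_finsetSum _ fun p' _ => hi p p']
  refine Finset.sum_congr rfl fun p _ => ?_
  rw [integral_finsetSum _ fun p' _ => hi p p']
  refine Finset.sum_congr rfl fun p' _ => ?_
  rw [integral_const_mul, integral_har_mul_har hL]

/-- At a fixed frequency either index determines the other. Splitting 1/(wt k wt l) ≤ (wt k^{-2} +
wt l^{-2})/2 therefore leaves single sums, each bounded by the series. -/
lemma sum_ite_inv_wt_le (hd : d ≤ 3) (hL : 0 < L) (S : Finset (Fin d → ℤ))
    (m : (Fin d → ℤ) × (Fin d → ℤ) → Fin d → ℤ)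
    (h1 : ∀ k l l', m (k, l) = m (k, l') → l = l')
    (h2 : ∀ k k' l, m (k, l) = m (k', l) → k = k') (p : (Fin d → ℤ) × (Fin d → ℤ)) :
    ∑ p' ∈ S ×ˢ S, (if m p = m p' then (wt L p'.1 * wt L p'.2)⁻¹ else 0) ≤
      ∑' k : Fin d → ℤ, ((wt L k) ^ 2)⁻¹ := by
  have hle : ∀ k l : Fin d → ℤ,
      (if m p = m (k, l) then (wt L k * wt L l)⁻¹ else 0) ≤
      (1 / 2) * (if m p = m (k, l) then ((wt L k) ^ 2)⁻¹ else 0) +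
      (1 / 2) * (if m p = m (k, l) then ((wt L l) ^ 2)⁻¹ else 0) := by
    intro k l
    split_ifs
    · have := two_mul_le_add_sq (wt L k)⁻¹ (wt L l)⁻¹
      rw [mul_inv, ← inv_pow, ← inv_pow]
      linarith
    · simp
  have hS : ∑ k ∈ S, ((wt L k) ^ 2)⁻¹ ≤ ∑' k : Fin d → ℤ, ((wt L k) ^ 2)⁻¹ :=
    (summable_wt_inv_sq hd hL).sum_le_tsum S fun k _ => by positivity
  have hcard : ∀ (c : ℝ) (n : (Fin d → ℤ) → Fin d → ℤ), 0 ≤ c → (∀ l l', n l = n l' → l = l') →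
      ∑ l ∈ S, (if m p = n l then c else 0) ≤ c := by
    intro c n hc hn
    by_cases h : ∃ l₀ ∈ S, m p = n l₀
    · obtain ⟨l₀, hl₀, he⟩ := h
      rw [Finset.sum_eq_single l₀, if_pos he]
      · exact fun l _ hl => if_neg fun h => hl (hn _ _ (h.symm.trans he))
      · exact fun h => absurd hl₀ h
    · push Not at h
      rw [Finset.sum_eq_zero fun l hl => if_neg (h l hl)]
      exact hc
  rw [Finset.sum_product]
  refine (Finset.sum_le_sum fun k _ => Finset.sum_le_sum fun l _ => hle k l).trans ?_
  simp_rw [Finset.sum_add_distrib, ← Finset.mul_sum]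
  have e1 : ∑ k ∈ S, ∑ l ∈ S, (if m p = m (k, l) then ((wt L k) ^ 2)⁻¹ else 0) ≤
      ∑ k ∈ S, ((wt L k) ^ 2)⁻¹ := Finset.sum_le_sum fun k _ =>
    hcard _ (fun l => m (k, l)) (by positivity) (h1 k)
  have e2 : ∑ k ∈ S, ∑ l ∈ S, (if m p = m (k, l) then ((wt L l) ^ 2)⁻¹ else 0) ≤
      ∑ k ∈ S, ((wt L k) ^ 2)⁻¹ := by
    rw [Finset.sum_comm]
    exact Finset.sum_le_sum fun l _ =>
      hcard _ (fun k => m (k, l)) (by positivity) fun k k' => h2 k k' l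
  linarith

/-- By the product formula |u|² is a combination of four double sums with frequencies ±(k - l) and
±(k + l). The factor 4 counts them: the 4 in (a+b+c-d)² ≤ 4(a²+b²+c²+d²) cancels against the (1/2)²
of the product formula. -/
lemma integral_norm_pow_four_le (hd : d ≤ 3) [hL : Fact (0 < L)] (S : Finset (Fin d → ℤ))
    (c : (Fin d → ℤ) → Vec d) :
    ∫ x, ‖trigB L S id c x‖ ^ 4 ∂torusMeasure d L ≤
      4 * ((√(L ^ d))⁻¹ ^ 2 * ∑' k : Fin d → ℤ, ((wt L k) ^ 2)⁻¹) *
        (∑ k ∈ S, wt L k * ‖c k‖ ^ 2) ^ 2 := by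
  set s := (√(L ^ d))⁻¹
  set T := ∑' k : Fin d → ℤ, ((wt L k) ^ 2)⁻¹
  set A : (Fin d → ℤ) × (Fin d → ℤ) → ℝ := fun p => inner ℝ (c p.1) (c p.2) with hA
  set W : (Fin d → ℤ) × (Fin d → ℤ) → ℝ := fun p => wt L p.1 * wt L p.2 with hWdef
  have hW : ∀ p, 0 < W p := fun p => mul_pos (wt_pos _) (wt_pos _)
  let F := fun (m : (Fin d → ℤ) × (Fin d → ℤ) → Fin d → ℤ) (x : Vec d) =>
    ∑ p ∈ S ×ˢ S, A p * har L (m p) x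
  have hFc : ∀ m, Continuous (F m) := fun m =>
    continuous_finsetSum _ fun p _ => continuous_const.mul (continuous_har _)
  have hT0 : 0 ≤ T := tsum_nonneg fun k => by positivity
  have hAW : ∑ p ∈ S ×ˢ S, A p ^ 2 * W p ≤ (∑ k ∈ S, wt L k * ‖c k‖ ^ 2) ^ 2 := by
    rw [sq (∑ k ∈ S, _), Finset.sum_mul_sum, Finset.sum_product]
    refine Finset.sum_le_sum fun k _ => Finset.sum_le_sum fun l _ => ?_
    have h : A (k, l) ^ 2 ≤ (‖c k‖ * ‖c l‖) ^ 2 := by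
      rw [← sq_abs]
      exact pow_le_pow_left₀ (abs_nonneg _) (abs_real_inner_le_norm _ _) 2
    calc A (k, l) ^ 2 * W (k, l) ≤ (‖c k‖ * ‖c l‖) ^ 2 * W (k, l) :=
          mul_le_mul_of_nonneg_right h (hW _).le
      _ = _ := by simp only [hWdef]; ring
  have hF : ∀ m : (Fin d → ℤ) × (Fin d → ℤ) → Fin d → ℤ,
      (∀ k l l', m (k, l) = m (k, l') → l = l') → (∀ k k' l, m (k, l) = m (k', l) → k = k') →
      ∫ x, F m x ^ 2 ∂torusMeasure d L ≤ T * (∑ k ∈ S, wt L k * ‖c k‖ ^ 2) ^ 2 :=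
    fun m h1 h2 => (integral_sq_sum_har_le hL.out _ m A W hW
      (sum_ite_inv_wt_le hd hL.out S m h1 h2)).trans (mul_le_mul_of_nonneg_left hAW hT0)
  let m1 : (Fin d → ℤ) × (Fin d → ℤ) → Fin d → ℤ := fun p => p.1 - p.2
  let m2 : (Fin d → ℤ) × (Fin d → ℤ) → Fin d → ℤ := fun p => p.2 - p.1
  let m3 : (Fin d → ℤ) × (Fin d → ℤ) → Fin d → ℤ := fun p => p.1 + p.2
  let m4 : (Fin d → ℤ) × (Fin d → ℤ) → Fin d → ℤ := fun p => -(p.1 + p.2)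
  have b1 := hF m1 (fun k l l' h => by simpa [m1] using h) (fun k k' l h => by simpa [m1] using h)
  have b2 := hF m2 (fun k l l' h => by simpa [m2] using h) (fun k k' l h => by simpa [m2] using h)
  have b3 := hF m3 (fun k l l' h => by simpa [m3] using h) (fun k k' l h => by simpa [m3] using h)
  have b4 := hF m4 (fun k l l' h => by simpa [m4] using h) (fun k k' l h => by simpa [m4] using h)
  have hx : ∀ x, ‖trigB L S id c x‖ ^ 2 = s / 2 * (F m1 x + F m2 x + F m3 x - F m4 x) := by
    intro x
    rw [trigB_apply, ← real_inner_self_eq_norm_sq]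
    simp_rw [sum_inner, inner_sum, F, ← Finset.sum_add_distrib, ← Finset.sum_sub_distrib]
    rw [Finset.mul_sum, Finset.sum_product]
    refine Finset.sum_congr rfl fun k _ => Finset.sum_congr rfl fun l _ => ?_
    rw [real_inner_smul_left, real_inner_smul_right, ← mul_assoc, id, id, har_mul_har' hL.out]
    simp only [hA, m1, m2, m3, m4]
    ring
  have hpt : ∀ x, ‖trigB L S id c x‖ ^ 4 ≤
      s ^ 2 * (F m1 x ^ 2 + F m2 x ^ 2 + F m3 x ^ 2 + F m4 x ^ 2) := by
    intro x
    have e : ‖trigB L S id c x‖ ^ 4 = (‖trigB L S id c x‖ ^ 2) ^ 2 := by ring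
    rw [e, hx]
    have : (F m1 x + F m2 x + F m3 x - F m4 x) ^ 2 ≤
        4 * (F m1 x ^ 2 + F m2 x ^ 2 + F m3 x ^ 2 + F m4 x ^ 2) := by
      nlinarith [sq_nonneg (F m1 x - F m2 x), sq_nonneg (F m1 x - F m3 x),
        sq_nonneg (F m1 x + F m4 x), sq_nonneg (F m2 x - F m3 x), sq_nonneg (F m2 x + F m4 x),
        sq_nonneg (F m3 x + F m4 x)]
    have h := mul_le_mul_of_nonneg_left this (sq_nonneg (s / 2))
    calc _ = (s / 2) ^ 2 * (F m1 x + F m2 x + F m3 x - F m4 x) ^ 2 := by ring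
      _ ≤ _ := h
      _ = _ := by ring
  have hi : ∀ m, Integrable (fun x => F m x ^ 2) (torusMeasure d L) := fun m =>
    Continuous.integrable_torus ((hFc m).pow 2)
  have hint : ∫ x, s ^ 2 * (F m1 x ^ 2 + F m2 x ^ 2 + F m3 x ^ 2 + F m4 x ^ 2)
      ∂torusMeasure d L = s ^ 2 * (∫ x, F m1 x ^ 2 ∂torusMeasure d L +
        ∫ x, F m2 x ^ 2 ∂torusMeasure d L + ∫ x, F m3 x ^ 2 ∂torusMeasure d L +
        ∫ x, F m4 x ^ 2 ∂torusMeasure d L) := by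
    have hi2 : Integrable (fun x => F m1 x ^ 2 + F m2 x ^ 2) (torusMeasure d L) :=
      (hi m1).add (hi m2)
    have hi3 : Integrable (fun x => F m1 x ^ 2 + F m2 x ^ 2 + F m3 x ^ 2) (torusMeasure d L) :=
      hi2.add (hi m3)
    rw [integral_const_mul, integral_add hi3 (hi m4), integral_add hi2 (hi m3),
      integral_add (hi m1) (hi m2)]
  have hi4 : Integrable (fun x => s ^ 2 * (F m1 x ^ 2 + F m2 x ^ 2 + F m3 x ^ 2 + F m4 x ^ 2))
      (torusMeasure d L) := Continuous.integrable_torus (by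
    have c1 := hFc m1
    have c2 := hFc m2
    have c3 := hFc m3
    have c4 := hFc m4
    fun_prop)
  refine (integral_mono (Continuous.integrable_torus
    ((trigB L S id c).continuous.norm.pow 4)) hi4 hpt).trans ?_
  rw [hint]
  have h := mul_le_mul_of_nonneg_left (add_le_add (add_le_add (add_le_add b1 b2) b3) b4)
    (sq_nonneg s)
  refine h.trans (le_of_eq ?_)
  ring

variable [hL : Fact (0 < L)]

variable (L) in
/-- The square of the `H¹`-norm. -/
def h1sq (a : Coef d) : ℝ := ‖fieldL2 L a‖ ^ 2 + ∑ i, ‖gradL2 L i a‖ ^ 2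

lemma h1sq_nonneg (a : Coef d) : 0 ≤ h1sq L a :=
  add_nonneg (sq_nonneg _) (Finset.sum_nonneg fun _ _ => sq_nonneg _)

lemma h1sq_trunc (S : Finset (Fin d → ℤ)) (a : Coef d) :
    h1sq L (trunc S a) = ∑ k ∈ S, wt L k * ‖coefField L a k‖ ^ 2 := by
  have h1 : h1sq L (trunc S a) = inner ℝ (coefField L (trunc S a)) (trunc S a) := by
    have h2 := inner_sum_hessL2_fieldL2 (L := L) (trunc S a)
    rw [sum_hessL2, inner_neg_left, fieldL2_apply, LinearIsometry.inner_map_map, neg_inj] at h2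
    rw [h1sq, ← h2, fieldL2_apply, LinearIsometry.norm_map, ← real_inner_self_eq_norm_sq,
      ← inner_add_left, coefField_add_coefLap, real_inner_comm]
  rw [h1, lp.inner_eq_tsum, tsum_eq_sum (s := S)]
  · refine Finset.sum_congr rfl fun k hk => ?_
    simp only [coefField_apply, trunc_apply, if_pos hk]
    rw [real_inner_smul_left, real_inner_self_eq_norm_sq, norm_smul, Real.norm_eq_abs, mul_pow,
      sq_abs]
    have := wt_pos (L := L) k
    field_simp
  · intro k hk
    simp only [trunc_apply, if_neg hk, inner_zero_right]

variable [hd : Fact (d ≤ 3)]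

/-- The Sobolev inequality: the `L⁴`-norm is bounded by the `H¹`-norm. -/
lemma norm_coordMul_field_le (i : Fin d) (a : Coef d) :
    ‖coordMul L i (field L a) (fieldL2 L a)‖ ≤
      √(4 * ((√(L ^ d))⁻¹ ^ 2 * ∑' k : Fin d → ℤ, ((wt L k) ^ 2)⁻¹)) * h1sq L a := by
  have c1 : Continuous fun a : Coef d => ‖coordMul L i (field L a) (fieldL2 L a)‖ :=
    (((coordMul L i).continuous.comp (field L).continuous).clm_apply (fieldL2 L).continuous).norm
  have c2 : Continuous fun a : Coef d => h1sq L a := by unfold h1sq; fun_prop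
  -- Both sides are continuous in a, so truncations suffice.
  refine le_of_tendsto_of_tendsto' ((c1.tendsto a).comp (tendsto_trunc a))
    (((c2.tendsto a).comp (tendsto_trunc a)).const_mul _) fun S => ?_
  simp only [Function.comp_apply]
  have hT0 : 0 ≤ ∑' k : Fin d → ℤ, ((wt L k) ^ 2)⁻¹ := tsum_nonneg fun k => by positivity
  refine le_of_sq_le_sq ?_ (mul_nonneg (Real.sqrt_nonneg _) (h1sq_nonneg _))
  rw [mul_pow, Real.sq_sqrt (by positivity), h1sq_trunc]
  refine le_trans ?_ (integral_norm_pow_four_le hd.out S _)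
  set u := trigB L S id (coefField L a) with hu
  have h1 : coordMul L i (field L (trunc S a)) (fieldL2 L (trunc S a)) =ᵐ[torusMeasure d L]
      fun x => u x i • u x := by
    rw [field_trunc, fieldL2_trunc]
    filter_upwards [coeFn_coordMul i u (toL2 L u), coeFn_toL2 (L := L) u] with x hx hx2
    rw [hx, hx2]
  have cu : Continuous fun x => u x i := (EuclideanSpace.proj (𝕜 := ℝ) i).continuous.comp u.continuous
  rw [← real_inner_self_eq_norm_sq, inner_eq_integral h1 h1]
  refine integral_mono (Continuous.integrable_torus ((cu.smul u.continuous).inner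
    (cu.smul u.continuous))) (Continuous.integrable_torus (u.continuous.norm.pow 4)) fun x => ?_
  simp only
  rw [real_inner_self_eq_norm_sq, norm_smul, mul_pow]
  have h2 : ‖u x i‖ ^ 2 ≤ ‖u x‖ ^ 2 :=
    pow_le_pow_left₀ (norm_nonneg _) (PiLp.norm_apply_le (u x) i) 2
  calc _ ≤ ‖u x‖ ^ 2 * ‖u x‖ ^ 2 := mul_le_mul_of_nonneg_right h2 (sq_nonneg _)
    _ = _ := by ring

lemma sum_norm_le_sqrt (a : Coef d) :
    ∑ i, ‖gradL2 L i a‖ ≤ √d * √(∑ i, ‖gradL2 L i a‖ ^ 2) := by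
  rw [← Real.sqrt_mul (by positivity)]
  refine Real.le_sqrt_of_sq_le ?_
  simpa using sq_sum_le_card_mul_sum_sq (s := (Finset.univ : Finset (Fin d)))
    (f := fun i => ‖gradL2 L i a‖)

-- Multiplication by a component is symmetric, so ⟨w_i ∂_i y, w⟩ = ⟨∂_i y, w_i w⟩ and the Sobolev
-- inequality applies to w_i w. Summing over i costs √d.
variable (d L) in
lemma exists_inner_convL2_le : ∃ C : ℝ, 0 ≤ C ∧ ∀ a b : Coef d,
    |inner ℝ (convL2 (field L a) fun i => gradL2 L i b) (fieldL2 L a)| ≤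
      C * h1sq L a * √(∑ i, ‖gradL2 L i b‖ ^ 2) := by
  set C := √(4 * ((√(L ^ d))⁻¹ ^ 2 * ∑' k : Fin d → ℤ, ((wt L k) ^ 2)⁻¹))
  have hC : 0 ≤ C := Real.sqrt_nonneg _
  refine ⟨C * √d, by positivity, fun a b => ?_⟩
  rw [convL2, sum_inner]
  have h1 : ∀ i, |inner ℝ (coordMul L i (field L a) (gradL2 L i b)) (fieldL2 L a)| ≤
      C * h1sq L a * ‖gradL2 L i b‖ := by
    intro i
    rw [inner_coordMul]
    refine (abs_real_inner_le_norm _ _).trans ?_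
    rw [mul_comm]
    exact mul_le_mul_of_nonneg_right (norm_coordMul_field_le i a) (norm_nonneg _)
  refine (Finset.abs_sum_le_sum_abs _ _).trans ((Finset.sum_le_sum fun i _ => h1 i).trans ?_)
  rw [← Finset.mul_sum]
  calc _ ≤ C * h1sq L a * (√d * √(∑ i, ‖gradL2 L i b‖ ^ 2)) :=
        mul_le_mul_of_nonneg_left (sum_norm_le_sqrt b) (mul_nonneg hC (h1sq_nonneg _))
    _ = _ := by ring

end Sobolev

/-! ### Galerkin approximation and passage to the limit. -/

section Galerkin

variable {d : ℕ} {L : ℝ} [hL : Fact (0 < L)] [hd : Fact (d ≤ 3)] {μ α β γ r q : ℝ}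

/-- The residual of the stationary equation, without the Leray projection. -/
def residual (μ α β γ : ℝ) (hq : 1 ≤ q) (hqr : q < r) (f : L2 d L) (a : Coef d) : L2 d L :=
  -(μ • ∑ i, hessL2 L i i a) + convL2 (field L a) (fun i => gradL2 L i a) + α • fieldL2 L a +
    dampL2 L β γ hq hqr (field L a) - f

lemma continuous_convL2_field :
    Continuous fun a : Coef d => convL2 (field L a) fun i => gradL2 L i a := by
  have h : Continuous fun a : Coef d => (field L a, fun i => gradL2 L i a) :=
    (field L).continuous.prodMk (continuous_pi fun i => (gradL2 L i).continuous)
  have h2 := continuous_convL2.comp h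
  exact h2

lemma continuous_residual (hq : 1 ≤ q) (hqr : q < r) (f : L2 d L) :
    Continuous (residual μ α β γ hq hqr f) := by
  have h1 := continuous_convL2_field (d := d) (L := L)
  have h2 : Continuous fun a : Coef d => dampL2 L β γ hq hqr (field L a) :=
    (continuous_dampL2 hq hqr).comp (field L).continuous
  have h3 : Continuous fun a : Coef d => ∑ i, hessL2 L i i a := by fun_prop
  have h4 : Continuous fun a : Coef d => fieldL2 L a := (fieldL2 L).continuous
  exact ((((h3.const_smul μ).neg.add h1).add (h4.const_smul α)).add h2).sub continuous_const

/-- The energy inequality. -/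
lemma le_inner_residual_fieldL2 (hβ : 0 < β) (hq : 1 ≤ q) (hqr : q < r) (f : L2 d L) {a : Coef d}
    (ha : IsSolenoidal L a) :
    μ * ∑ i, ‖gradL2 L i a‖ ^ 2 + α * ‖fieldL2 L a‖ ^ 2 - K1 β γ r q * L ^ d -
      ‖f‖ * ‖fieldL2 L a‖ ≤ inner ℝ (residual μ α β γ hq hqr f a) (fieldL2 L a) := by
  have h1 := neg_K1_le_inner_dampL2 (L := L) (γ := γ) hβ hq hqr (field L a)
  have h2 := real_inner_le_norm f (fieldL2 L a)
  rw [toL2_field] at h1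
  rw [residual, inner_sub_left, inner_add_left, inner_add_left, inner_add_left, inner_neg_left,
    real_inner_smul_left, real_inner_smul_left, inner_sum_hessL2_fieldL2,
    inner_convL2_field_eq_zero ha, real_inner_self_eq_norm_sq]
  linarith

variable (L) in
/-- The space of the solenoidal families supported in `S`. -/
def galerkinSpace (S : Finset (Fin d → ℤ)) : Submodule ℝ (Coef d) where
  carrier := {a | trunc S a = a ∧ IsSolenoidal L a}
  zero_mem' := ⟨by ext k : 2; simp [trunc_apply], fun k => by simp⟩
  add_mem' := by
    rintro a b ⟨h1, h2⟩ ⟨h3, h4⟩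
    refine ⟨?_, fun k => ?_⟩
    · ext k : 2
      have e1 := congrArg (fun c : Coef d => c k) h1
      have e2 := congrArg (fun c : Coef d => c k) h3
      simp only [trunc_apply] at e1 e2
      simp only [trunc_apply, lp.coeFn_add, Pi.add_apply]
      rw [← e1, ← e2]
      split_ifs <;> simp
    · rw [lp.coeFn_add, Pi.add_apply, inner_add_right, h2, h4, add_zero]
  smul_mem' := by
    rintro c a ⟨h1, h2⟩
    refine ⟨?_, fun k => ?_⟩
    · ext k : 2
      have e1 := congrArg (fun c : Coef d => c k) h1
      simp only [trunc_apply] at e1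
      simp only [trunc_apply, lp.coeFn_smul, Pi.smul_apply]
      rw [← e1]
      split_ifs <;> simp
    · rw [lp.coeFn_smul, Pi.smul_apply, real_inner_smul_right, h2, mul_zero]

lemma trunc_eq_self_iff {S : Finset (Fin d → ℤ)} {a : Coef d} :
    trunc S a = a ↔ ∀ k, k ∉ S → a k = 0 := by
  constructor
  · intro h k hk
    rw [← h, trunc_apply, if_neg hk]
  · intro h
    ext k : 2
    rw [trunc_apply]
    split_ifs with hk
    · rfl
    · exact (h k hk).symm

instance (S : Finset (Fin d → ℤ)) : FiniteDimensional ℝ (galerkinSpace L S) := by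
  let T : galerkinSpace L S →ₗ[ℝ] (S → Vec d) :=
    { toFun := fun a k => (a : Coef d) k
      map_add' := fun a b => rfl
      map_smul' := fun c a => rfl }
  refine FiniteDimensional.of_injective T fun a b hab => ?_
  ext k : 3
  by_cases hk : k ∈ S
  · exact congrFun hab ⟨k, hk⟩
  · rw [trunc_eq_self_iff.1 a.2.1 k hk, trunc_eq_self_iff.1 b.2.1 k hk]

lemma fieldL2_injective : Function.Injective (fieldL2 (d := d) L) := by
  intro a b h
  have h1 := (ser L).injective h
  ext k : 2
  have h2 := congrArg (fun c : Coef d => c k) h1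
  exact smul_right_injective _ (one_div_pos.2 (wt_pos (L := L) k)).ne' h2

/-- For the adjoint T* of T, ⟨T*(residual a), a⟩ = ⟨residual a, Ta⟩, which the energy inequality
makes positive once ‖Ta‖ is large. T is injective on a finite-dimensional space, so ‖a‖ ≤ K‖Ta‖ and
a large ‖a‖ suffices. -/
lemma exists_galerkin (hμ : 0 < μ) (hα : 0 < α) (hβ : 0 < β) (hq : 1 ≤ q) (hqr : q < r)
    (f : L2 d L) (S : Finset (Fin d → ℤ)) : ∃ a ∈ galerkinSpace L S, ∀ v ∈ galerkinSpace L S,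
      inner ℝ (residual μ α β γ hq hqr f a) (fieldL2 L v) = 0 := by
  let T : galerkinSpace L S →L[ℝ] L2 d L := (fieldL2 L).comp (galerkinSpace L S).subtypeL
  have hTinj : Function.Injective T := fieldL2_injective.comp Subtype.val_injective
  obtain ⟨K, hK, hanti⟩ := (LinearMap.injective_iff_antilipschitz T.toLinearMap).1 hTinj
  have hbd : ∀ a : galerkinSpace L S, ‖a‖ ≤ K * ‖T a‖ := fun a => by
    simpa using hanti.le_mul_dist a 0
  set M := K1 β γ r q * L ^ d
  have hM : 0 ≤ M := mul_nonneg (K1_nonneg hβ hq hqr) (pow_nonneg hL.out.le d)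
  -- Chosen so that α t₀ = M + ‖f‖ + α; then α t² > M + ‖f‖ t for all t ≥ t₀, as t₀ ≥ 1.
  set t₀ := (M + ‖f‖) / α + 1
  have ht₀ : 1 ≤ t₀ := le_add_of_nonneg_left (by positivity)
  have hK' : (0 : ℝ) < K := hK
  obtain ⟨a, ha⟩ := exists_zero_of_inner_pos
    (Φ := fun a : galerkinSpace L S =>
      ContinuousLinearMap.adjoint T (residual μ α β γ hq hqr f (a : Coef d)))
    ((ContinuousLinearMap.adjoint T).continuous.comp
      ((continuous_residual hq hqr f).comp continuous_subtype_val))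
    (R := K * t₀) (by positivity) (by
      intro a haR
      rw [ContinuousLinearMap.adjoint_inner_left]
      have h1 := le_inner_residual_fieldL2 (μ := μ) (α := α) (γ := γ) hβ hq hqr f a.2.2
      have h2 : t₀ ≤ ‖fieldL2 L (a : Coef d)‖ :=
        le_of_mul_le_mul_left (haR.trans (hbd a)) hK'
      refine lt_of_lt_of_le ?_ h1
      set t := ‖fieldL2 L (a : Coef d)‖
      have h3 : 0 ≤ μ * ∑ i, ‖gradL2 L i (a : Coef d)‖ ^ 2 :=
        mul_nonneg hμ.le (Finset.sum_nonneg fun _ _ => sq_nonneg _)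
      have h4 : M + ‖f‖ + α ≤ α * t := by
        calc M + ‖f‖ + α = α * t₀ := by simp only [t₀]; field_simp
          _ ≤ α * t := mul_le_mul_of_nonneg_left h2 hα.le
      have h5 : 1 ≤ t := ht₀.trans h2
      have h6 := mul_le_mul_of_nonneg_right h4 (zero_le_one.trans h5)
      nlinarith [mul_nonneg hM (sub_nonneg.2 h5)])
  refine ⟨a, a.2, fun v hv => ?_⟩
  have h := ContinuousLinearMap.adjoint_inner_left T ⟨v, hv⟩
    (residual μ α β γ hq hqr f (a : Coef d))
  rw [ha, inner_zero_left] at h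
  exact h.symm

/-- Young's inequality ‖f‖t ≤ ‖f‖²/(2α) + αt²/2 spends half of the α term, whence the 1/(2α) of the
smallness condition. -/
lemma energy_bound (hα : 0 < α) (hβ : 0 < β) (hq : 1 ≤ q) (hqr : q < r) {f : L2 d L} {a : Coef d}
    (ha : IsSolenoidal L a)
    (h : inner ℝ (residual μ α β γ hq hqr f a) (fieldL2 L a) = 0) :
    μ * ∑ i, ‖gradL2 L i a‖ ^ 2 + α / 2 * ‖fieldL2 L a‖ ^ 2 ≤
      1 / (2 * α) * ‖f‖ ^ 2 + K1 β γ r q * L ^ d := by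
  have h1 := le_inner_residual_fieldL2 (μ := μ) (α := α) (γ := γ) hβ hq hqr f ha
  rw [h] at h1
  set t := ‖fieldL2 L a‖
  have h2 : ‖f‖ * t = 1 / (2 * α) * ‖f‖ ^ 2 + α / 2 * t ^ 2 - 1 / (2 * α) * (‖f‖ - α * t) ^ 2 := by
    field_simp
    ring
  have h3 : 0 ≤ 1 / (2 * α) * (‖f‖ - α * t) ^ 2 := by positivity
  linarith

/-- The Galerkin spaces are invariant under -Δ, so -Δy is an admissible test field; its encoding
family is λ_k a_k. -/
lemma exists_fieldL2_eq_neg_sum_hessL2 {S : Finset (Fin d → ℤ)} {a : Coef d}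
    (ha : a ∈ galerkinSpace L S) :
    ∃ v ∈ galerkinSpace L S, fieldL2 L v = -∑ i, hessL2 L i i a := by
  refine ⟨∑ k ∈ S, lp.single 2 k (lam L k • a k), ?_⟩
  have hv : ∀ k, (∑ k ∈ S, lp.single 2 k (lam L k • a k) : Coef d) k = lam L k • a k := by
    intro k
    rw [lp.coeFn_sum, Finset.sum_apply]
    simp only [lp.single_apply]
    rw [Finset.sum_pi_single]
    split_ifs with hk
    · rfl
    · rw [trunc_eq_self_iff.1 ha.1 k hk, smul_zero]
  refine ⟨⟨trunc_eq_self_iff.2 fun k hk => ?_, fun k => ?_⟩, ?_⟩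
  · rw [hv, trunc_eq_self_iff.1 ha.1 k hk, smul_zero]
  · rw [hv, real_inner_smul_right, ha.2, mul_zero]
  · rw [sum_hessL2, neg_neg, fieldL2_apply]
    congr 1
    ext k : 2
    rw [coefField_apply, coefLap_apply, hv, smul_smul]
    congr 1
    ring

lemma le_of_quadratic_le {μ B Q D : ℝ} (hμ : 0 < μ) (hB : 0 ≤ B) (hQ : 0 ≤ Q)
    (h : μ / 2 * D ^ 2 ≤ B * D + Q) : D ≤ 2 * (B + Q) / μ + 1 := by
  by_contra! hlt
  have h1 : 1 < D := lt_of_le_of_lt (le_add_of_nonneg_left (by positivity)) hlt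
  have h2 : B + Q < μ / 2 * D := by
    have h3 : 2 * (B + Q) / μ < D := by linarith
    rw [div_lt_iff₀ hμ] at h3
    linarith
  have h3 := mul_lt_mul_of_pos_right h2 (zero_lt_one.trans h1)
  have h4 := mul_le_mul_of_nonneg_left h1.le hQ
  linarith

/-- The bound in `H²` of the Galerkin approximations. -/
lemma exists_galerkin_bound (hμ : 0 < μ) (hα : 0 < α) (hβ : 0 < β) (hq : 1 ≤ q) (hqr : q < r)
    (f : L2 d L) : ∃ M : ℝ, ∀ (S : Finset (Fin d → ℤ)), ∀ a ∈ galerkinSpace L S,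
      (∀ v ∈ galerkinSpace L S, inner ℝ (residual μ α β γ hq hqr f a) (fieldL2 L v) = 0) →
      ‖a‖ ≤ M := by
  set E := 1 / (2 * α) * ‖f‖ ^ 2 + K1 β γ r q * L ^ d with hE
  have hE0 : 0 ≤ E := add_nonneg (by positivity)
    (mul_nonneg (K1_nonneg hβ hq hqr) (pow_nonneg hL.out.le d))
  set Y := √(2 * E / α)
  set H := √d * √(E / μ)
  have hY : 0 ≤ Y := Real.sqrt_nonneg _
  have hH : 0 ≤ H := by positivity
  -- With this choice ε H ≤ μ/2, so half of μ‖Δy‖² absorbs the quadratic part of the convection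
  -- estimate.
  set ε := μ / (2 * (H + 1))
  have hε : 0 < ε := by positivity
  obtain ⟨C, hC, hfield⟩ := exists_norm_field_le (d := d) L hε
  set B := (ε + C) * Y * H + ‖f‖
  set κ := kappa β γ r q
  have hκ : 0 ≤ κ := kappa_nonneg hβ hq hqr
  refine ⟨Y + (2 * (B + κ * (E / μ)) / μ + 1), fun S a ha hN => ?_⟩
  have hB : 0 ≤ B := by positivity
  have he := energy_bound hα hβ hq hqr ha.2 (hN a ha)
  rw [← hE] at he
  have hg0 : 0 ≤ ∑ i, ‖gradL2 L i a‖ ^ 2 := Finset.sum_nonneg fun _ _ => sq_nonneg _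
  have hg : ∑ i, ‖gradL2 L i a‖ ^ 2 ≤ E / μ := by
    rw [le_div_iff₀ hμ]
    have : 0 ≤ α / 2 * ‖fieldL2 L a‖ ^ 2 := by positivity
    linarith
  have hy : ‖fieldL2 L a‖ ≤ Y := by
    refine Real.le_sqrt_of_sq_le ?_
    rw [le_div_iff₀ hα]
    have : 0 ≤ μ * ∑ i, ‖gradL2 L i a‖ ^ 2 := mul_nonneg hμ.le hg0
    linarith
  obtain ⟨v, hv, hvD⟩ := exists_fieldL2_eq_neg_sum_hessL2 ha
  have h0 := hN v hv
  set D := ‖∑ i, hessL2 L i i a‖ with hD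
  have hna : ‖a‖ ≤ Y + D := (norm_le_fieldL2_add L a).trans (by linarith)
  have hconv : ‖convL2 (field L a) fun i => gradL2 L i a‖ ≤ (ε * (Y + D) + C * Y) * H := by
    refine (norm_convL2_le _ _).trans ?_
    have h1 : ‖field L a‖ ≤ ε * (Y + D) + C * Y := (hfield a).trans
      (add_le_add (mul_le_mul_of_nonneg_left hna hε.le) (mul_le_mul_of_nonneg_left hy hC))
    have h2 : ∑ i, ‖gradL2 L i a‖ ≤ H := (sum_norm_le_sqrt a).trans
      (mul_le_mul_of_nonneg_left (Real.sqrt_le_sqrt hg) (Real.sqrt_nonneg _))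
    exact mul_le_mul h1 h2 (Finset.sum_nonneg fun _ _ => norm_nonneg _)
      ((norm_nonneg _).trans h1)
  have hdamp := inner_dampL2_sum_hessL2_le (L := L) (γ := γ) hβ hq hqr S a
  rw [ha.1] at hdamp
  have hα1 : inner ℝ (fieldL2 L a) (∑ i, hessL2 L i i a) ≤ 0 := by
    rw [real_inner_comm, inner_sum_hessL2_fieldL2]
    linarith
  have hc1 := real_inner_le_norm (convL2 (field L a) fun i => gradL2 L i a)
    (∑ i, hessL2 L i i a)
  have hf1 := real_inner_le_norm (-f) (∑ i, hessL2 L i i a)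
  rw [norm_neg, inner_neg_left] at hf1
  rw [hvD, inner_neg_right, neg_eq_zero, residual, inner_sub_left, inner_add_left, inner_add_left,
    inner_add_left, inner_neg_left, real_inner_smul_left, real_inner_smul_left,
    real_inner_self_eq_norm_sq] at h0
  have hD0 : 0 ≤ D := norm_nonneg _
  have hc2 := hc1.trans (mul_le_mul_of_nonneg_right hconv hD0)
  have hκg : κ * ∑ i, ‖gradL2 L i a‖ ^ 2 ≤ κ * (E / μ) := mul_le_mul_of_nonneg_left hg hκ
  have hα2 : α * inner ℝ (fieldL2 L a) (∑ i, hessL2 L i i a) ≤ 0 :=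
    mul_nonpos_of_nonneg_of_nonpos hα.le hα1
  have hεH : ε * H ≤ μ / 2 := by
    have : ε * (H + 1) = μ / 2 := by simp only [ε]; field_simp
    nlinarith
  -- Here D = ‖Δy‖. The α term has a favourable sign, the damping costs κ‖∇y‖², and convection is
  -- linear in D after absorption.
  have hmain : μ / 2 * D ^ 2 ≤ B * D + κ * (E / μ) := by
    have h1 : ε * H * D ^ 2 ≤ μ / 2 * D ^ 2 := mul_le_mul_of_nonneg_right hεH (sq_nonneg D)
    have h2 : (ε * (Y + D) + C * Y) * H * D = ε * H * D ^ 2 + (ε + C) * Y * H * D := by ring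
    have h3 : B * D = (ε + C) * Y * H * D + ‖f‖ * D := by simp only [B]; ring
    linarith
  have hDle : D ≤ 2 * (B + κ * (E / μ)) / μ + 1 :=
     le_of_quadratic_le hμ hB (mul_nonneg hκ (by positivity)) hmain
  exact hna.trans (by gcongr)

/-- A countable product of closed balls is sequentially compact, and a coordinatewise limit of a
family bounded in ℓ² is again in ℓ². -/
lemma exists_subseq_tendsto {a : ℕ → Coef d} {M : ℝ} (hM : ∀ n, ‖a n‖ ≤ M) :
    ∃ (b : Coef d) (φ : ℕ → ℕ), StrictMono φ ∧
      ∀ k, Filter.Tendsto (fun n => a (φ n) k) Filter.atTop (nhds (b k)) := by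
  have hK : IsCompact (Set.univ.pi fun _ : Fin d → ℤ => Metric.closedBall (0 : Vec d) M) :=
    isCompact_univ_pi fun _ => isCompact_closedBall _ _
  obtain ⟨b, -, φ, hφ, hb⟩ := hK.tendsto_subseq (x := fun n k => a n k) fun n k _ => by
    rw [mem_closedBall_zero_iff]
    exact (lp.norm_apply_le_norm two_ne_zero (a n) k).trans (hM n)
  refine ⟨⟨b, lp.memℓp_of_tendsto (F := fun n => a (φ n)) (l := Filter.atTop) ?_ hb⟩, φ, hφ,
    tendsto_pi_nhds.1 hb⟩
  exact (isBounded_iff_forall_norm_le).2 ⟨M, by rintro _ ⟨n, rfl⟩; exact hM _⟩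

/-- Existence of a solution of the stationary equation tested with solenoidal fields. -/
lemma exists_residual_eq_zero (hμ : 0 < μ) (hα : 0 < α) (hβ : 0 < β) (hq : 1 ≤ q) (hqr : q < r)
    (f : L2 d L) : ∃ a : Coef d, IsSolenoidal L a ∧ ∀ v, IsSolenoidal L v →
      (∃ S, trunc S v = v) → inner ℝ (residual μ α β γ hq hqr f a) (fieldL2 L v) = 0 := by
  obtain ⟨M, hM⟩ := exists_galerkin_bound (γ := γ) hμ hα hβ hq hqr f
  choose A hA hA0 using exists_galerkin (γ := γ) hμ hα hβ hq hqr f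
  obtain ⟨S, hS⟩ := Filter.exists_seq_tendsto (Filter.atTop : Filter (Finset (Fin d → ℤ)))
  obtain ⟨b, φ, hφ, hb⟩ := exists_subseq_tendsto (a := fun n => A (S n)) fun n =>
    hM _ _ (hA _) (hA0 _)
  have hbd : ∀ n, ‖A (S (φ n))‖ ≤ M := fun n => hM _ _ (hA _) (hA0 _)
  have hSφ := hS.comp hφ.tendsto_atTop
  refine ⟨b, fun k => ?_, ?_⟩
  · have h1 := (tendsto_const_nhds (x := freqVec L k)).inner (𝕜 := ℝ) (hb k)
    refine tendsto_nhds_unique h1 (tendsto_const_nhds.congr fun n => ?_)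
    exact ((hA (S (φ n))).2 k).symm
  · rintro v hv ⟨S₀, hS₀⟩
    have t1 := (isTight_field (d := d) L).tendsto hbd hb
    have t2 := (isTight_fieldL2 (d := d) L).tendsto hbd hb
    have t3 : ∀ i, Filter.Tendsto (fun n => gradL2 L i (A (S (φ n)))) Filter.atTop
        (nhds (gradL2 L i b)) := fun i => (isTight_gradL2 L i).tendsto hbd hb
    have t4 : Filter.Tendsto (fun n => convL2 (field L (A (S (φ n))))
        fun i => gradL2 L i (A (S (φ n)))) Filter.atTop
        (nhds (convL2 (field L b) fun i => gradL2 L i b)) := by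
      have h := (continuous_convL2.tendsto (field L b, fun i => gradL2 L i b)).comp
        (t1.prodMk_nhds (tendsto_pi_nhds.2 t3))
      exact h
    have t5 : Filter.Tendsto (fun n => dampL2 L β γ hq hqr (field L (A (S (φ n))))) Filter.atTop
        (nhds (dampL2 L β γ hq hqr (field L b))) :=
      ((continuous_dampL2 hq hqr).tendsto _).comp t1
    -- The tightness results do not cover the Laplacian, whose multiplier does not decay. Against
    -- the fixed field v, moving it to the other side by its adjoint gives the weak convergence that
    -- is needed.
    have t6 : Filter.Tendsto (fun n => inner ℝ (∑ i, hessL2 L i i (A (S (φ n)))) (fieldL2 L v))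
        Filter.atTop (nhds (inner ℝ (∑ i, hessL2 L i i b) (fieldL2 L v))) := by
      let T : Coef d →L[ℝ] L2 d L := ∑ i, hessL2 L i i
      have hT : ∀ c, ∑ i, hessL2 L i i c = T c := fun c =>
        (sum_apply _ _ c).symm
      have e : ∀ c, inner ℝ (∑ i, hessL2 L i i c) (fieldL2 L v) =
          innerSL ℝ (ContinuousLinearMap.adjoint T (fieldL2 L v)) c := by
        intro c
        rw [innerSL_apply_apply, ContinuousLinearMap.adjoint_inner_left, real_inner_comm, hT]
      simp_rw [e]
      exact (isTight_innerSL _).tendsto hbd hb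
    have e : ∀ c : Coef d, inner ℝ (residual μ α β γ hq hqr f c) (fieldL2 L v) =
        -(μ * inner ℝ (∑ i, hessL2 L i i c) (fieldL2 L v)) +
        inner ℝ (convL2 (field L c) (fun i => gradL2 L i c) + α • fieldL2 L c +
          dampL2 L β γ hq hqr (field L c) - f) (fieldL2 L v) := by
      intro c
      rw [← real_inner_smul_left, ← inner_neg_left, ← inner_add_left, residual]
      congr 1
      abel
    have t7 := ((t6.const_mul μ).neg).add
      ((((t4.add (t2.const_smul α)).add t5).sub_const f).inner (𝕜 := ℝ)
        (tendsto_const_nhds (x := fieldL2 L v)))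
    rw [← e] at t7
    refine tendsto_nhds_unique t7 (tendsto_const_nhds.congr' ?_)
    -- Once the Galerkin set contains S₀, v is an admissible test field.
    filter_upwards [hSφ.eventually_ge_atTop S₀] with n hn
    rw [← e]
    refine (hA0 _ v ⟨trunc_eq_self_iff.2 fun k hk => ?_, hv⟩).symm
    exact trunc_eq_self_iff.1 hS₀ k fun h => hk (hn h)

end Galerkin

/-! ### Strong solutions and uniqueness. -/

section StrongSolutions

variable {d : ℕ} {L : ℝ} [hL : Fact (0 < L)] [hd : Fact (d ≤ 3)] {μ α β γ r q : ℝ}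

lemma convL2_field_ae_eq (a : Coef d) :
    (convL2 (field L a) fun i => gradL2 L i a) =ᵐ[torusMeasure d L]
      convection (fieldL2 L a) fun i => gradL2 L i a := by
  filter_upwards [convL2_ae_eq (field L a) fun i => gradL2 L i a, fieldL2_ae_eq L a] with x h1 h2
  rw [h1, convection, h2]

lemma toL2_compB_field_ae_eq {s : ℝ} (hs : 1 ≤ s) (a : Coef d) :
    toL2 L (compB (continuous_pw hs) (field L a)) =ᵐ[torusMeasure d L]
      powerField s (fieldL2 L a) := by
  filter_upwards [coeFn_toL2 (L := L) (compB (continuous_pw hs) (field L a)), fieldL2_ae_eq L a]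
    with x h1 h2
  rw [h1, powerField, h2]
  rfl

lemma residual_eq (hq : 1 ≤ q) (hqr : q < r) (f : L2 d L) (a : Coef d) {b c₁ c₂ : L2 d L}
    (hb : b =ᵐ[torusMeasure d L] convection (fieldL2 L a) fun i => gradL2 L i a)
    (hc₁ : c₁ =ᵐ[torusMeasure d L] powerField r (fieldL2 L a))
    (hc₂ : c₂ =ᵐ[torusMeasure d L] powerField q (fieldL2 L a)) :
    residual μ α β γ hq hqr f a =
      -(μ • ∑ i, hessL2 L i i a) + b + α • fieldL2 L a + (β • c₁ + γ • c₂) - f := by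
  have h1 : (convL2 (field L a) fun i => gradL2 L i a) = b :=
    Lp.ext ((convL2_field_ae_eq a).trans hb.symm)
  have h2 : dampL2 L β γ hq hqr (field L a) = β • c₁ + γ • c₂ := by
    refine Lp.ext ?_
    filter_upwards [dampL2_ae_eq (L := L) (β := β) (γ := γ) hq hqr (field L a), fieldL2_ae_eq L a,
      hc₁, hc₂, Lp.coeFn_add (β • c₁) (γ • c₂), Lp.coeFn_smul β c₁, Lp.coeFn_smul γ c₂]
      with x e1 e2 e3 e4 e5 e6 e7
    rw [e1, e5, Pi.add_apply, e6, e7, Pi.smul_apply, Pi.smul_apply, e3, e4, powerField, powerField,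
      e2]
    rfl
  rw [residual, h1, h2]

lemma inner_leray_equation {w : L2 d L} (hw : w ∈ SpaceH d L) (y D b c₁ c₂ f : L2 d L) :
    inner ℝ (μ • (-leray d L D) + leray d L b + α • y + β • leray d L c₁ + γ • leray d L c₂ - f) w =
      inner ℝ (-(μ • D) + b + α • y + (β • c₁ + γ • c₂) - f) w := by
  simp only [inner_add_left, inner_sub_left, inner_neg_left, real_inner_smul_left, inner_leray hw]
  ring

/-- Since f lies in ℍ, so does the difference of the two sides of the projected equation. It is
orthogonal to every solenoidal trigonometric polynomial, hence zero. -/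
lemma isStrongSolution_fieldL2 (hq : 1 ≤ q) (hqr : q < r) {f : L2 d L} (hf : f ∈ SpaceH d L)
    {a : Coef d} (ha : IsSolenoidal L a) (h : ∀ v, IsSolenoidal L v → (∃ S, trunc S v = v) →
      inner ℝ (residual μ α β γ hq hqr f a) (fieldL2 L v) = 0) :
    IsStrongSolution μ α β γ r q f (fieldL2 L a) := by
  have hr : 1 ≤ r := by linarith
  refine ⟨ha.fieldL2_mem_spaceV, _, _, hasH2Derivs_fieldL2 a, _, _, _, convL2_field_ae_eq a,
    toL2_compB_field_ae_eq hr a, toL2_compB_field_ae_eq hq a, ?_⟩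
  rw [← sub_eq_zero]
  refine eq_zero_of_mem_spaceH (L := L) ?_ fun v hv hS => ?_
  · have hP := fun y => leray_mem (d := d) (L := L) y
    exact Submodule.sub_mem _ (Submodule.add_mem _ (Submodule.add_mem _ (Submodule.add_mem _
      (Submodule.add_mem _ (Submodule.smul_mem _ _ (Submodule.neg_mem _ (hP _))) (hP _))
      (Submodule.smul_mem _ _ ha.fieldL2_mem_spaceH)) (Submodule.smul_mem _ _ (hP _)))
      (Submodule.smul_mem _ _ (hP _))) hf
  · rw [inner_leray_equation hv.fieldL2_mem_spaceH, ← h v hv hS,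
      residual_eq hq hqr f a (convL2_field_ae_eq a) (toL2_compB_field_ae_eq hr a)
        (toL2_compB_field_ae_eq hq a)]

/-- Converse to the previous lemma, now for every solenoidal test family, so that solutions and
their differences may be tested with themselves. -/
lemma IsStrongSolution.exists_coef (hq : 1 ≤ q) (hqr : q < r) {f y : L2 d L}
    (h : IsStrongSolution μ α β γ r q f y) : ∃ a : Coef d, y = fieldL2 L a ∧ IsSolenoidal L a ∧
      ∀ v, IsSolenoidal L v → inner ℝ (residual μ α β γ hq hqr f a) (fieldL2 L v) = 0 := by
  obtain ⟨hV, G, D, hGD, b, c₁, c₂, hb, hc₁, hc₂, he⟩ := h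
  obtain ⟨a, rfl, hG, hD⟩ := hGD.exists_coef
  obtain rfl : G = fun i => gradL2 L i a := funext hG
  refine ⟨a, rfl, isSolenoidal_of_fieldL2_mem_spaceH (spaceV_subset_spaceH hV), fun v hv => ?_⟩
  rw [residual_eq hq hqr f a hb hc₁ hc₂, ← inner_leray_equation hv.fieldL2_mem_spaceH]
  simp_rw [← hD]
  rw [he, sub_self, inner_zero_left]

/-- Existence of a strong solution. -/
lemma exists_isStrongSolution (hμ : 0 < μ) (hα : 0 < α) (hβ : 0 < β) (hq : 1 ≤ q) (hqr : q < r)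
    {f : L2 d L} (hf : f ∈ SpaceH d L) : ∃ y, IsStrongSolution μ α β γ r q f y := by
  obtain ⟨a, ha, h⟩ := exists_residual_eq_zero (γ := γ) hμ hα hβ hq hqr f
  exact ⟨_, isStrongSolution_fieldL2 hq hqr hf ha h⟩

/-- Tested with the difference w, the first term vanishes and only (w·∇)y₂ remains. -/
lemma convL2_sub_convL2 (a₁ a₂ : Coef d) :
    (convL2 (field L a₁) fun i => gradL2 L i a₁) - (convL2 (field L a₂) fun i => gradL2 L i a₂) =
      (convL2 (field L a₁) fun i => gradL2 L i (a₁ - a₂)) +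
        convL2 (field L (a₁ - a₂)) fun i => gradL2 L i a₂ := by
  unfold convL2
  rw [← Finset.sum_sub_distrib, ← Finset.sum_add_distrib]
  refine Finset.sum_congr rfl fun i _ => ?_
  simp only [map_sub, sub_apply]
  abel

lemma residual_sub_residual (hq : 1 ≤ q) (hqr : q < r) (f : L2 d L) (a₁ a₂ : Coef d) :
    residual μ α β γ hq hqr f a₁ - residual μ α β γ hq hqr f a₂ =
      -(μ • ∑ i, hessL2 L i i (a₁ - a₂)) +
      ((convL2 (field L a₁) fun i => gradL2 L i (a₁ - a₂)) +
        convL2 (field L (a₁ - a₂)) fun i => gradL2 L i a₂) + α • fieldL2 L (a₁ - a₂) +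
      (dampL2 L β γ hq hqr (field L a₁) - dampL2 L β γ hq hqr (field L a₂)) := by
  have h1 : ∑ i, hessL2 L i i (a₁ - a₂) = ∑ i, hessL2 L i i a₁ - ∑ i, hessL2 L i i a₂ := by
    rw [← Finset.sum_sub_distrib]
    exact Finset.sum_congr rfl fun i _ => map_sub _ _ _
  rw [← convL2_sub_convL2, h1, map_sub, smul_sub, smul_sub, residual, residual]
  abel

/-- The estimate for the difference of two solutions. -/
lemma mul_h1sq_sub_le {C : ℝ} (hC : ∀ a b : Coef d,
      |inner ℝ (convL2 (field L a) fun i => gradL2 L i b) (fieldL2 L a)| ≤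
        C * h1sq L a * √(∑ i, ‖gradL2 L i b‖ ^ 2))
    (hβ : 0 < β) (hq : 1 ≤ q) (hqr : q < r) {f : L2 d L} {a₁ a₂ : Coef d}
    (ha₁ : IsSolenoidal L a₁)
    (h : inner ℝ (residual μ α β γ hq hqr f a₁ - residual μ α β γ hq hqr f a₂)
      (fieldL2 L (a₁ - a₂)) = 0) :
    min μ α * h1sq L (a₁ - a₂) ≤
      (kappa β γ r q + C * √(∑ i, ‖gradL2 L i a₂‖ ^ 2)) * h1sq L (a₁ - a₂) := by
  set w := a₁ - a₂ with hw
  have hdamp := neg_kappa_le_inner_dampL2_sub (L := L) (γ := γ) hβ hq hqr (field L a₁) (field L a₂)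
  rw [← map_sub, toL2_field, ← hw] at hdamp
  have hconv := (abs_le.1 (hC w a₂)).1
  rw [residual_sub_residual, ← hw, inner_add_left, inner_add_left, inner_add_left, inner_add_left,
    inner_neg_left, real_inner_smul_left, real_inner_smul_left, inner_sum_hessL2_fieldL2,
    inner_convL2_field_eq_zero ha₁, real_inner_self_eq_norm_sq] at h
  have hg0 : 0 ≤ ∑ i, ‖gradL2 L i w‖ ^ 2 := Finset.sum_nonneg fun _ _ => sq_nonneg _
  have h1 := mul_le_mul_of_nonneg_right (min_le_left μ α) hg0
  have h2 := mul_le_mul_of_nonneg_right (min_le_right μ α) (sq_nonneg ‖fieldL2 L w‖)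
  have h3 : kappa β γ r q * ‖fieldL2 L w‖ ^ 2 ≤ kappa β γ r q * h1sq L w :=
    mul_le_mul_of_nonneg_left (le_add_of_nonneg_right hg0) (kappa_nonneg hβ hq hqr)
  have h4 : min μ α * h1sq L w =
      min μ α * ‖fieldL2 L w‖ ^ 2 + min μ α * ∑ i, ‖gradL2 L i w‖ ^ 2 := mul_add _ _ _
  linarith

variable (d L) in
/-- Uniqueness of the strong solution for large `min μ α`. -/
lemma exists_forall_isStrongSolution_eq : ∃ C : ℝ, 0 < C ∧ ∀ μ α β γ r q : ℝ, 0 < μ → 0 < α →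
    0 < β → 1 ≤ q → q < r → ∀ f : L2 d L,
    kappa β γ r q + C * √(1 / (2 * α * μ) * ‖f‖ ^ 2 + K1 β γ r q / μ * L ^ d) ≤ min μ α →
    ∀ y₁ y₂, IsStrongSolution μ α β γ r q f y₁ → IsStrongSolution μ α β γ r q f y₂ → y₁ = y₂ := by
  obtain ⟨C, hC0, hC⟩ := exists_inner_convL2_le d L
  -- Raising the constant by 1 makes it positive and leaves a spare √X ‖w‖²_{H¹} in the comparison,
  -- which provides the strictness needed for w = 0.
  refine ⟨C + 1, by positivity, fun μ α β γ r q hμ hα hβ hq hqr f hmin y₁ y₂ hy₁ hy₂ => ?_⟩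
  obtain ⟨a₁, rfl, ha₁, h₁⟩ := hy₁.exists_coef hq hqr
  obtain ⟨a₂, rfl, ha₂, h₂⟩ := hy₂.exists_coef hq hqr
  have hw := ha₁.sub ha₂
  have hle := mul_h1sq_sub_le hC hβ hq hqr (μ := μ) (α := α) (γ := γ) (f := f) (a₂ := a₂) ha₁
    (by rw [inner_sub_left, h₁ _ hw, h₂ _ hw, sub_zero])
  have hK := K1_nonneg (γ := γ) hβ hq hqr
  have hLd : 0 < L ^ d := pow_pos hL.out d
  set X := 1 / (2 * α * μ) * ‖f‖ ^ 2 + K1 β γ r q / μ * L ^ d with hX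
  have hgX : ∑ i, ‖gradL2 L i a₂‖ ^ 2 ≤ X := by
    have h := energy_bound hα hβ hq hqr ha₂ (h₂ _ ha₂)
    have h0 : 0 ≤ α / 2 * ‖fieldL2 L a₂‖ ^ 2 := by positivity
    have h3 : μ * ∑ i, ‖gradL2 L i a₂‖ ^ 2 ≤ 1 / (2 * α) * ‖f‖ ^ 2 + K1 β γ r q * L ^ d := by
      linarith
    have h4 : μ * X = 1 / (2 * α) * ‖f‖ ^ 2 + K1 β γ r q * L ^ d := by
      rw [hX]; field_simp
    rw [← h4] at h3
    exact le_of_mul_le_mul_left h3 hμ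
  have hn := h1sq_nonneg (L := L) (a₁ - a₂)
  have hCX := mul_le_mul_of_nonneg_left (Real.sqrt_le_sqrt hgX) hC0
  have h5 := mul_le_mul_of_nonneg_right (add_le_add_right hCX (kappa β γ r q)) hn
  have h6 := mul_le_mul_of_nonneg_right hmin hn
  have h7 : √X * h1sq L (a₁ - a₂) ≤ 0 := by linarith
  have hzero : h1sq L (a₁ - a₂) = 0 := by
    -- If w ≠ 0 the spare term forces X ≤ 0. Then 𝔎₁ = 0, so γ = 0 and κ = 0, and the estimate reads
    -- min{μ,α}‖w‖²_{H¹} ≤ 0, a contradiction.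
    by_contra hne
    have hpos := lt_of_le_of_ne hn (Ne.symm hne)
    have hX0 : √X ≤ 0 := nonpos_of_mul_nonpos_left h7 hpos
    have hX1 : X ≤ 0 := Real.sqrt_eq_zero'.1 (le_antisymm hX0 (Real.sqrt_nonneg _))
    have h8 : 0 ≤ 1 / (2 * α * μ) * ‖f‖ ^ 2 := by positivity
    have h9 : K1 β γ r q / μ * L ^ d ≤ 0 := by linarith
    have h10 : K1 β γ r q ≤ 0 := by
      by_contra! hK1
      exact absurd h9 (not_le.2 (by positivity))
    have hγ := eq_zero_of_K1_eq_zero hβ hq hqr (le_antisymm h10 hK)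
    have hκ : kappa β γ r q = 0 := by rw [kappa, hγ]; simp
    have h11 : √X = 0 := le_antisymm hX0 (Real.sqrt_nonneg _)
    have h12 := hle.trans h5
    rw [hκ, h11, mul_zero, add_zero, zero_mul] at h12
    exact absurd h12 (not_le.2 (mul_pos (lt_min hμ hα) hpos))
  have h8 : ‖fieldL2 L (a₁ - a₂)‖ ^ 2 ≤ 0 := by
    rw [← hzero]
    exact le_add_of_nonneg_right (Finset.sum_nonneg fun _ _ => sq_nonneg _)
  rw [map_sub] at h8
  exact sub_eq_zero.1 (norm_eq_zero.1 (pow_eq_zero_iff two_ne_zero |>.1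
    (le_antisymm h8 (sq_nonneg _))))

end StrongSolutions

end CBFeD

end

theorem theoremB1 (d : ℕ) (hd : d = 2 ∨ d = 3) (L : ℝ) (hL : 0 < L) :
    (∀ μ α β γ r q : ℝ, 0 < μ → 0 < α → 0 < β → 1 ≤ q → q < r →
      ∀ f ∈ CBFeD.SpaceH d L,
        ∃ y : CBFeD.L2 d L, CBFeD.IsStrongSolution μ α β γ r q f y) ∧
    ∃ C : ℝ, 0 < C ∧
      ∀ μ α β γ r q : ℝ, 0 < μ → 0 < α → 0 < β → 1 ≤ q → q < r →
      ∀ f ∈ CBFeD.SpaceH d L,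
        2 ^ (q - 1) * q * |γ| * CBFeD.K2 β γ r q +
            C * Real.sqrt (1 / (2 * α * μ) * ‖f‖ ^ 2 + CBFeD.K1 β γ r q / μ * L ^ d) ≤ min μ α →
        ∃! y : CBFeD.L2 d L, CBFeD.IsStrongSolution μ α β γ r q f y := by
  have : Fact (0 < L) := ⟨hL⟩
  have : Fact (d ≤ 3) := ⟨by omega⟩
  refine ⟨fun μ α β γ r q hμ hα hβ hq hqr f hf =>
    CBFeD.exists_isStrongSolution hμ hα hβ hq hqr hf, ?_⟩
  obtain ⟨C, hC, h⟩ := CBFeD.exists_forall_isStrongSolution_eq d L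
  refine ⟨C, hC, fun μ α β γ r q hμ hα hβ hq hqr f hf hmin => ?_⟩
  obtain ⟨y, hy⟩ := CBFeD.exists_isStrongSolution (γ := γ) hμ hα hβ hq hqr hf
  exact ⟨y, hy, fun z hz => h μ α β γ r q hμ hα hβ hq hqr f hmin z y hz hy⟩
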